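/- Let $\mathbb{F}$ be $\mathbb{R}$ or $\mathbb{C}$ and let $\mathbb{X}$ be a Banach space over $\mathbb{F}$ with a Schauder basis. Let $\mathbb{S}$ be a Banach space over $\mathbb{F}$ with a subsymmetric Schauder basis $(\mathbf{e}_j)_{j=1}^\infty$, that is, one that is unconditional and equivalent to each of its subsequences (two sequences $(x_j)$, $(y_j)$ are equivalent if, for all scalars $(a_j)$, $\sum_j a_j x_j$ converges if and only if $\sum_j a_j y_j$ does). Assume that - $\mathbb{S}$ is isomorphic to a complemented subspace of $\mathbb{X}$; - $\mathbb{S}$ has nontrivial type, i.e., Rademacher type $p$ for some $1<p\le 2$; - $\ell_1$ or $c_0$ is isomorphic to a complemented subspace of $\mathbb{X}$. Then $\mathbb{X}$ has a Schauder basis $\mathcal{B}=(\mathbf{x}_j)_{j=1}^\infty$, with coordinate functionals $(\mathbf{x}_j^*)_{j=1}^\infty$ and coordinate projections $S_A(f)=\sum_{j\in A}\mathbf{x}_j^*(f)\,\mathbf{x}_j$, such that the following hold. 1. $\mathcal{B}$ is almost greedy: it is semi-normalized, $0<\inf_j\|\mathbf{x}_j\|\le\sup_j\|\mathbf{x}_j\|<\infty$,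 and there is a constant $C$ with $$\|f-S_F(f)\|\le C\,\|f-S_A(f)\|$$ whenever $f\in\mathbb{X}$, $A,F\subseteq\mathbb{N}$ are finite with $|A|\le|F|$, and $|\mathbf{x}_j^*(f)|\le|\mathbf{x}_k^*(f)|$ for all $j\in\mathbb{N}\setminus F$ and $k\in F$. 2. Its fundamental function $\varphi_m=\sup_{|A|\le m}\big\|\sum_{j\in A}\mathbf{x}_j\big\|$ satisfies $\varphi_m\approx\big\|\sum_{j=1}^m\mathbf{e}_j\big\|_{\mathbb{S}}$ for $m\ge1$. 3. Its conditionality constants $$L_m=\sup\left\{\frac{\|S_A(f)\|}{\|f\|}\colon 0\ne f\in\mathbb{X},\ \mathbf{x}_j^*(f)=0\text{ for all }j>m,\ A\subseteq\mathbb{N}\right\}$$ satisfy $L_m\approx\log m$ for $m\ge2$. Here $\alpha_m\approx\beta_m$ for $m\ge m_0$ means that there are constants $0<c\le C<\infty$ with $c\,\beta_m\le\alpha_m\le C\,\beta_m$ for all $m\ge m_0$. -/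

import Mathlib

open scoped ZeroAtInfty

noncomputable section

namespace GreedyBases

variable {𝕜 : Type*} [RCLike 𝕜]
variable {X : Type*} [NormedAddCommGroup X] [NormedSpace 𝕜 X]
variable {Y : Type*} [NormedAddCommGroup Y] [NormedSpace 𝕜 Y]

/-- `0 < inf_j ‖x_j‖ ≤ sup_j ‖x_j‖ < ∞`. -/
def IsSemiNormalized (x : ℕ → X) : Prop :=
  ∃ c C : ℝ, 0 < c ∧ ∀ j, c ≤ ‖x j‖ ∧ ‖x j‖ ≤ C

/-- A Schauder basis is unconditional if its coordinate projections `S_A` on the finite sets `A`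
are uniformly bounded. -/
def IsUnconditional (b : SchauderBasis 𝕜 X) : Prop :=
  ∃ C : ℝ, ∀ A : Finset ℕ, ‖GeneralSchauderBasis.proj b A‖ ≤ C

variable (𝕜) in
/-- Two sequences are equivalent if, for every sequence of scalars `(a_j)`, the series
`∑ a_j x_j` converges if and only if `∑ a_j y_j` does (limits of partial sums). -/
def AreEquivalent (x : ℕ → X) (y : ℕ → Y) : Prop :=
  ∀ a : ℕ → 𝕜,
    Summable (fun j ↦ a j • x j) (SummationFilter.conditional ℕ) ↔
      Summable (fun j ↦ a j • y j) (SummationFilter.conditional ℕ)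

/-- A basis is subsymmetric if it is unconditional and equivalent to all of its subsequences. -/
def IsSubsymmetric (b : SchauderBasis 𝕜 X) : Prop :=
  IsUnconditional b ∧
    ∀ φ : ℕ → ℕ, StrictMono φ → AreEquivalent 𝕜 b.basis (fun j ↦ b.basis (φ j))

/-- Rademacher type `p`: `(𝔼 ‖∑ ε_i x_i‖ ^ p) ^ (1/p) ≤ C (∑ ‖x_i‖ ^ p) ^ (1/p)` for all finite
families of vectors, where the expectation is the average over all choices of signs. -/
def HasRademacherType (X : Type*) [NormedAddCommGroup X] (p : ℝ) : Prop :=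
  ∃ C : ℝ, ∀ (n : ℕ) (x : Fin n → X),
    ((2 ^ n : ℝ)⁻¹ * ∑ ε : Fin n → ℤˣ, ‖∑ i, (ε i : ℤ) • x i‖ ^ p) ^ (1 / p) ≤
      C * (∑ i, ‖x i‖ ^ p) ^ (1 / p)

/-- Nontrivial type: Rademacher type `p` for some `1 < p ≤ 2`. -/
def HasNontrivialType (X : Type*) [NormedAddCommGroup X] : Prop :=
  ∃ p : ℝ, 1 < p ∧ p ≤ 2 ∧ HasRademacherType X p

variable (𝕜) in
/-- `X` is isomorphic to a complemented subspace of `Y`: the identity of `X` factors through `Y`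
by bounded linear operators. -/
def IsComplementedIn (X : Type*) [NormedAddCommGroup X] [NormedSpace 𝕜 X]
    (Y : Type*) [NormedAddCommGroup Y] [NormedSpace 𝕜 Y] : Prop :=
  ∃ (L : X →L[𝕜] Y) (T : Y →L[𝕜] X), T ∘L L = ContinuousLinearMap.id 𝕜 X

/-- The sequence space `ℓ₁`. -/
abbrev SpaceEllOne (𝕜 : Type*) [RCLike 𝕜] : Type _ := lp (fun _ : ℕ ↦ 𝕜) 1

/-- The sequence space `c₀` of scalar sequences tending to `0` (on the discrete space `ℕ`,
vanishing at infinity means exactly that), with the supremum norm. -/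
abbrev SpaceCZero (𝕜 : Type*) [RCLike 𝕜] : Type _ := C₀(ℕ, 𝕜)

/-- `F` is a greedy set of `f`: `|x_j^*(f)| ≤ |x_k^*(f)|` for all `j ∉ F` and `k ∈ F`. -/
def IsGreedySet (b : SchauderBasis 𝕜 X) (f : X) (F : Finset ℕ) : Prop :=
  ∀ j, j ∉ F → ∀ k ∈ F, ‖b.coord j f‖ ≤ ‖b.coord k f‖

/-- Almost greedy bases: a semi-normalized basis such that `‖f - S_F f‖ ≤ C ‖f - S_A f‖` whenever
`F` is a greedy set of `f` and `|A| ≤ |F|`. -/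
def IsAlmostGreedy (b : SchauderBasis 𝕜 X) : Prop :=
  IsSemiNormalized b.basis ∧
    ∃ C : ℝ, ∀ (f : X) (A F : Finset ℕ), A.card ≤ F.card → IsGreedySet b f F →
      ‖f - GeneralSchauderBasis.proj b F f‖ ≤ C * ‖f - GeneralSchauderBasis.proj b A f‖

/-- The fundamental function `φ_m = sup_{|A| ≤ m} ‖∑_{j ∈ A} x_j‖`. -/
def fundamentalFunction (b : SchauderBasis 𝕜 X) (m : ℕ) : ℝ :=
  sSup {r : ℝ | ∃ A : Finset ℕ, A.card ≤ m ∧ r = ‖∑ j ∈ A, b.basis j‖}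

/-- The conditionality constants `L_m`: the supremum of `‖S_A f‖ / ‖f‖` over all nonzero `f`
supported on the first `m` basis vectors (indexed by `0, …, m - 1`) and all sets `A` of indices.
As `S_A f` depends only on `A ∩ {0, …, m - 1}`, finite sets `A` are enough. -/
def conditionalityConstant (b : SchauderBasis 𝕜 X) (m : ℕ) : ℝ :=
  sSup {r : ℝ | ∃ (f : X) (A : Finset ℕ), f ≠ 0 ∧ (∀ j, m ≤ j → b.coord j f = 0) ∧
    r = ‖GeneralSchauderBasis.proj b A f‖ / ‖f‖}

/-- `α_m ≈ β_m` for `m ≥ m₀`. -/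
def EquivalentFrom (m₀ : ℕ) (α β : ℕ → ℝ) : Prop :=
  ∃ c C : ℝ, 0 < c ∧ 0 < C ∧ ∀ m, m₀ ≤ m → c * β m ≤ α m ∧ α m ≤ C * β m

end GreedyBases

end

/-! The basis comes from the averaging construction of Dilworth, Kalton and Kutzarova. Write Λ(m)
for the norm of e_0 + … + e_(m-1) (`initialNorm`). Cut ℕ into consecutive blocks of size (b-1)b^n
and let P average the coefficients over each block. P is a bounded projection on S, so S ≅ Q ⊕ P(S)
with Q = ker P. Given a normalized basis (z_n) of a space Z, put for j in block n: x_j = (e_j - P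
e_j, w_n z_n) in Q × Z, where w_n = Λ(s_n)/s_n and s_n is the size of the block.

On a whole block the Q and Z components of an expansion decouple (`sum_block_coord_smul_vec`), which
makes (x_j) a basis. Sums of x_j over k indices have norm comparable with Λ(k) whatever Z is
(`exists_norm_sum_vec_le_initialNorm`, `exists_initialNorm_le_norm`), and projections onto greedy
sets are bounded (`exists_norm_sum_greedy_le`); together these give almost greediness. Nontrivial
type enters through the choice of b: for b large, 2Λ(m) ≤ Λ(bm) ≤ (b/2)Λ(m) (`exists_regular`).

Each z_n is spread over block n, so the first m vectors x_j meet only about log m of the z_n.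
Projections inside one block are bounded, whence L_m ≲ log m; if projections on the first N vectors
z_n can have norm of order N, then also L_m ≳ log m. The difference basis of ℓ₁ and the summing
basis of c₀ have this property, and it survives interlacing with another basis.

Finally take Z = W × X × P(S), with W = ℓ₁ or c₀. Since S and W are isomorphic to their squares and
complemented in X, X absorbs both: Q × Z ≅ W × X × S ≅ W × X ≅ X.

Subsymmetry is given only qualitatively, through convergence of series; a gliding hump argument
(`not_forall_exists_hump`) first makes it uniform. -/

noncomputable section

namespace GreedyBases

open Filter Topology

/-! ### Convexity: from bounds on subsums to bounds with coefficients in the unit ball -/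

section Unconditional

variable {𝕜 : Type*} [RCLike 𝕜]
variable {X : Type*} [NormedAddCommGroup X] [NormedSpace 𝕜 X]

/-- A convex function on a cube attains its maximum at a vertex. -/
theorem exists_subset_norm_add_sum_le [NormedSpace ℝ X] {ι : Type*} [DecidableEq ι]
    (A : Finset ι) (θ : ι → ℝ) (w : ι → X) (h0 : ∀ i ∈ A, 0 ≤ θ i) (h1 : ∀ i ∈ A, θ i ≤ 1) :
    ∀ u : X, ∃ B ⊆ A, ‖u + ∑ i ∈ A, θ i • w i‖ ≤ ‖u + ∑ i ∈ B, w i‖ := by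
  induction A using Finset.induction_on with
  | empty => intro u; exact ⟨∅, by simp, by simp⟩
  | insert i A hi ih =>
    intro u
    have ih' := ih (fun j hj ↦ h0 j (Finset.mem_insert_of_mem hj))
      (fun j hj ↦ h1 j (Finset.mem_insert_of_mem hj))
    obtain ⟨B₀, hB₀, h₀⟩ := ih' u
    obtain ⟨B₁, hB₁, h₁⟩ := ih' (u + w i)
    have hθ0 := h0 i (Finset.mem_insert_self _ _)
    have hθ1 := h1 i (Finset.mem_insert_self _ _)
    set v := ∑ j ∈ A, θ j • w j
    have key : ‖u + ∑ j ∈ insert i A, θ j • w j‖ ≤ max ‖u + v‖ ‖u + w i + v‖ := by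
      rw [Finset.sum_insert hi]
      have : u + (θ i • w i + v) = (1 - θ i) • (u + v) + θ i • (u + w i + v) := by
        module
      rw [this]
      calc _ ≤ ‖(1 - θ i) • (u + v)‖ + ‖θ i • (u + w i + v)‖ := norm_add_le _ _
        _ = (1 - θ i) * ‖u + v‖ + θ i * ‖u + w i + v‖ := by
          rw [norm_smul, norm_smul, Real.norm_of_nonneg hθ0, Real.norm_of_nonneg (by linarith)]
        _ ≤ (1 - θ i) * max ‖u + v‖ ‖u + w i + v‖ + θ i * max ‖u + v‖ ‖u + w i + v‖ := by
          gcongr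
          · exact le_max_left _ _
          · exact le_max_right _ _
        _ = _ := by ring
    rcases le_max_iff.1 key with h | h
    · exact ⟨B₀, hB₀.trans (Finset.subset_insert _ _), h.trans h₀⟩
    · refine ⟨insert i B₁, Finset.insert_subset_insert _ hB₁, h.trans (h₁.trans ?_)⟩
      rw [Finset.sum_insert (fun h ↦ hi (hB₁ h)), add_assoc]

/-- Bounds for all subsums of a family imply bounds for sums with coefficients in the unit ball. -/
theorem norm_sum_smul_le_of_forall_subset {ι : Type*}
    (A : Finset ι) (θ : ι → 𝕜) (w : ι → X) (M : ℝ) (hθ : ∀ i ∈ A, ‖θ i‖ ≤ 1)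
    (hM : ∀ B ⊆ A, ‖∑ i ∈ B, w i‖ ≤ M) : ‖∑ i ∈ A, θ i • w i‖ ≤ 4 * M := by
  classical
  let _ : NormedSpace ℝ X := NormedSpace.restrictScalars ℝ 𝕜 X
  have _ : IsScalarTower ℝ 𝕜 X := IsScalarTower.restrictScalars ℝ 𝕜 X
  -- Coefficients in [0, 1] cost no constant. Splitting into positive and negative parts doubles the
  -- bound, and splitting into real and imaginary parts doubles it again, hence the factor 4.
  have pos : ∀ η : ι → ℝ, (∀ i ∈ A, 0 ≤ η i) → (∀ i ∈ A, η i ≤ 1) →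
      ‖∑ i ∈ A, η i • w i‖ ≤ M := by
    intro η h0 h1
    obtain ⟨B, hB, h⟩ := exists_subset_norm_add_sum_le A η w h0 h1 0
    simp only [zero_add] at h
    exact h.trans (hM B hB)
  have real : ∀ η : ι → ℝ, (∀ i ∈ A, |η i| ≤ 1) → ‖∑ i ∈ A, η i • w i‖ ≤ 2 * M := by
    intro η h
    have e : ∑ i ∈ A, η i • w i
        = ∑ i ∈ A, (max (η i) 0) • w i - ∑ i ∈ A, (max (-η i) 0) • w i := by
      rw [← Finset.sum_sub_distrib]
      refine Finset.sum_congr rfl fun i _ ↦ ?_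
      rw [← sub_smul]
      congr 1
      rcases le_total (η i) 0 with h | h
      · rw [max_eq_right h, max_eq_left (by linarith)]; ring
      · rw [max_eq_left h, max_eq_right (by linarith)]; ring
    rw [e]
    have h1 := pos (fun i ↦ max (η i) 0) (fun i _ ↦ le_max_right _ _)
      (fun i hi ↦ max_le ((le_abs_self _).trans (h i hi)) zero_le_one)
    have h2 := pos (fun i ↦ max (-η i) 0) (fun i _ ↦ le_max_right _ _)
      (fun i hi ↦ max_le ((neg_le_abs _).trans (h i hi)) zero_le_one)
    linarith [norm_sub_le (∑ i ∈ A, (max (η i) 0) • w i) (∑ i ∈ A, (max (-η i) 0) • w i)]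
  have e : ∑ i ∈ A, θ i • w i = ∑ i ∈ A, RCLike.re (θ i) • w i
      + (RCLike.I : 𝕜) • ∑ i ∈ A, RCLike.im (θ i) • w i := by
    rw [Finset.smul_sum, ← Finset.sum_add_distrib]
    refine Finset.sum_congr rfl fun i _ ↦ ?_
    conv_lhs => rw [← RCLike.re_add_im (θ i)]
    rw [add_smul, mul_comm, mul_smul]
    simp only [RCLike.real_smul_eq_coe_smul (K := 𝕜)]
  have h1 := real (fun i ↦ RCLike.re (θ i)) (fun i hi ↦ (RCLike.abs_re_le_norm _).trans (hθ i hi))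
  have h2 := real (fun i ↦ RCLike.im (θ i)) (fun i hi ↦ (RCLike.abs_im_le_norm _).trans (hθ i hi))
  rw [e]
  have h3 : ‖(RCLike.I : 𝕜) • ∑ i ∈ A, RCLike.im (θ i) • w i‖ ≤ 2 * M := by
    rw [norm_smul]
    have hI : ‖(RCLike.I : 𝕜)‖ ≤ 1 := by
      rcases RCLike.I_mul_I_ax (K := 𝕜) with h | h
      · simp [h]
      · have : ‖(RCLike.I : 𝕜)‖ * ‖(RCLike.I : 𝕜)‖ = 1 := by
          rw [← norm_mul, h]; simp
        nlinarith [norm_nonneg (RCLike.I : 𝕜)]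
    calc _ ≤ 1 * ‖∑ i ∈ A, RCLike.im (θ i) • w i‖ := by gcongr
      _ ≤ _ := by linarith
  exact (norm_add_le _ _).trans (by linarith)

end Unconditional

/-! ### Coordinates and lattice-type estimates for unconditional bases -/

section Coordinates

variable {𝕜 : Type*} [RCLike 𝕜]
variable {X : Type*} [NormedAddCommGroup X] [NormedSpace 𝕜 X]

theorem coord_basis (b : SchauderBasis 𝕜 X) (i j : ℕ) :
    b.coord i (b.basis j) = if i = j then 1 else 0 := by
  rw [b.ortho]; simp [Pi.single_apply]

theorem coord_sum_smul (b : SchauderBasis 𝕜 X) (A : Finset ℕ) (a : ℕ → 𝕜) (i : ℕ) :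
    b.coord i (∑ j ∈ A, a j • b.basis j) = if i ∈ A then a i else 0 := by
  simp [map_sum, coord_basis]

theorem basis_ne_zero (b : SchauderBasis 𝕜 X) (j : ℕ) : b.basis j ≠ 0 := by
  intro h
  have := coord_basis b j j
  simp [h] at this

theorem tendsto_sum_range (b : SchauderBasis 𝕜 X) (f : X) :
    Tendsto (fun n ↦ ∑ j ∈ Finset.range n, b.coord j f • b.basis j) atTop (𝓝 f) := by
  simpa using SchauderBasis.tendsto_proj b f

/-- Unconditionality allows to compare coefficients in absolute value. -/
theorem IsUnconditional.exists_norm_sum_le {b : SchauderBasis 𝕜 X} (hb : IsUnconditional b) :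
    ∃ K : ℝ, 1 ≤ K ∧ ∀ (A : Finset ℕ) (a c : ℕ → 𝕜), (∀ j ∈ A, ‖a j‖ ≤ ‖c j‖) →
      ‖∑ j ∈ A, a j • b.basis j‖ ≤ K * ‖∑ j ∈ A, c j • b.basis j‖ := by
  obtain ⟨C, hC⟩ := hb
  refine ⟨max 1 (4 * C), le_max_left _ _, fun A a c hac ↦ ?_⟩
  -- The quotients a j / c j have modulus at most 1. Where c j = 0 the quotient is 0 by convention,
  -- which is harmless because a j vanishes there too.
  have h := norm_sum_smul_le_of_forall_subset A (fun j ↦ a j / c j) (fun j ↦ c j • b.basis j)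
    (C * ‖∑ j ∈ A, c j • b.basis j‖) (fun j hj ↦ by
      rw [norm_div]; exact div_le_one_of_le₀ (hac j hj) (norm_nonneg _)) (fun B hB ↦ by
      have := (GeneralSchauderBasis.proj b B).le_of_opNorm_le (hC B) (∑ j ∈ A, c j • b.basis j)
      rw [GeneralSchauderBasis.proj_apply] at this
      have e : ∑ j ∈ B, b.coord j (∑ j ∈ A, c j • b.basis j) • b.basis j
          = ∑ j ∈ B, c j • b.basis j :=
        Finset.sum_congr rfl fun j hj ↦ by rw [coord_sum_smul, if_pos (hB hj)]
      rwa [e] at this)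
  have e : ∑ j ∈ A, (a j / c j) • (c j • b.basis j) = ∑ j ∈ A, a j • b.basis j := by
    refine Finset.sum_congr rfl fun j hj ↦ ?_
    rw [smul_smul]
    by_cases hc : c j = 0
    · have := hac j hj
      have ha : a j = 0 := by simpa [hc] using this
      simp [ha]
    · rw [div_mul_cancel₀ _ hc]
  rw [e] at h
  calc _ ≤ _ := h
    _ = 4 * C * ‖∑ j ∈ A, c j • b.basis j‖ := by ring
    _ ≤ _ := by gcongr; exact le_max_right _ _

end Coordinates

/-! ### Gliding hump: subsymmetry is automatically uniform -/

section GlidingHump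

variable {𝕜 : Type*} [RCLike 𝕜]
variable {S : Type*} [NormedAddCommGroup S] [NormedSpace 𝕜 S]

/-- Follow `φ` below `n` and the sequence `χ` from `n` on. -/
def splice (φ χ : ℕ → ℕ) (n : ℕ) : ℕ → ℕ := fun j ↦ if j < n then φ j else χ (j - n)

theorem splice_of_lt {φ χ : ℕ → ℕ} {n j : ℕ} (h : j < n) : splice φ χ n j = φ j := if_pos h

theorem splice_of_le {φ χ : ℕ → ℕ} {n j : ℕ} (h : n ≤ j) : splice φ χ n j = χ (j - n) :=
  if_neg (not_lt.2 h)

theorem strictMono_splice {φ χ : ℕ → ℕ} {n : ℕ} (hφ : StrictMono φ) (hχ : StrictMono χ)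
    (h : φ n ≤ χ 0) : StrictMono (splice φ χ n) := by
  intro i j hij
  rcases lt_or_ge j n with hj | hj
  · rw [splice_of_lt hj, splice_of_lt (hij.trans hj)]
    exact hφ hij
  · rw [splice_of_le hj]
    rcases lt_or_ge i n with hi | hi
    · rw [splice_of_lt hi]
      calc φ i < φ n := hφ hi
        _ ≤ χ 0 := h
        _ ≤ _ := hχ.monotone (Nat.zero_le _)
    · rw [splice_of_le hi]
      exact hχ (by omega)

theorem norm_sum_comp_le {e : SchauderBasis 𝕜 S} {K : ℝ}
    (hK : ∀ (A : Finset ℕ) (a c : ℕ → 𝕜), (∀ j ∈ A, ‖a j‖ ≤ ‖c j‖) →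
      ‖∑ j ∈ A, a j • e.basis j‖ ≤ K * ‖∑ j ∈ A, c j • e.basis j‖)
    {ψ : ℕ → ℕ} (hψ : Function.Injective ψ) (A : Finset ℕ) (a c : ℕ → 𝕜)
    (h : ∀ j ∈ A, ‖a j‖ ≤ ‖c j‖) :
    ‖∑ j ∈ A, a j • e.basis (ψ j)‖ ≤ K * ‖∑ j ∈ A, c j • e.basis (ψ j)‖ := by
  have key : ∀ a : ℕ → 𝕜, ∑ j ∈ A.image ψ, (a (Function.invFun ψ j)) • e.basis j
      = ∑ j ∈ A, a j • e.basis (ψ j) := by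
    intro a
    rw [Finset.sum_image (fun x _ y _ h ↦ hψ h)]
    refine Finset.sum_congr rfl fun j _ ↦ ?_
    rw [Function.leftInverse_invFun hψ j]
  rw [← key a, ← key c]
  refine hK _ _ _ fun j hj ↦ ?_
  obtain ⟨i, hi, rfl⟩ := Finset.mem_image.1 hj
  rw [Function.leftInverse_invFun hψ i]
  exact h i hi

theorem norm_sum_comp_subset_le {e : SchauderBasis 𝕜 S} {K : ℝ}
    (hK : ∀ (A : Finset ℕ) (a c : ℕ → 𝕜), (∀ j ∈ A, ‖a j‖ ≤ ‖c j‖) →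
      ‖∑ j ∈ A, a j • e.basis j‖ ≤ K * ‖∑ j ∈ A, c j • e.basis j‖)
    {ψ : ℕ → ℕ} (hψ : Function.Injective ψ) {A B : Finset ℕ} (hAB : A ⊆ B) (c : ℕ → 𝕜) :
    ‖∑ j ∈ A, c j • e.basis (ψ j)‖ ≤ K * ‖∑ j ∈ B, c j • e.basis (ψ j)‖ := by
  have := norm_sum_comp_le hK hψ B (fun j ↦ if j ∈ A then c j else 0) c (fun j _ ↦ by
    split_ifs <;> simp)
  refine le_trans (le_of_eq ?_) this
  congr 1
  simp only [ite_smul, zero_smul]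
  rw [Finset.sum_ite_mem, Finset.inter_eq_right.2 hAB]

/-- Gliding hump: if two subsequences of a subsymmetric basis can always be modified from any
index on so as to tell them apart quantitatively, then there are two inequivalent subsequences. -/
theorem not_forall_exists_hump [CompleteSpace S] {e : SchauderBasis 𝕜 S} (he : IsSubsymmetric e)
    (step : ∀ (n : ℕ) (φ ψ : ℕ → ℕ), StrictMono φ → StrictMono ψ → ∀ ε : ℝ, 0 < ε →
      ∃ (n' : ℕ) (φ' ψ' : ℕ → ℕ) (a : ℕ → 𝕜), n < n' ∧ StrictMono φ' ∧ StrictMono ψ' ∧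
        (∀ j < n, φ' j = φ j) ∧ (∀ j < n, ψ' j = ψ j) ∧
        1 ≤ ‖∑ j ∈ Finset.Ico n n', a j • e.basis (φ' j)‖ ∧
        ‖∑ j ∈ Finset.Ico n n', a j • e.basis (ψ' j)‖ ≤ ε) : False := by
  obtain ⟨K, hK1, hK⟩ := he.1.exists_norm_sum_le
  -- A state records the index n up to which everything is frozen, the two subsequences, and the
  -- coefficients chosen so far.
  let State := {p : ℕ × (ℕ → ℕ) × (ℕ → ℕ) × (ℕ → 𝕜) // StrictMono p.2.1 ∧ StrictMono p.2.2.1}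
  have step' : ∀ (i : ℕ) (p : State), ∃ q : State, p.1.1 < q.1.1 ∧
      (∀ j < p.1.1, q.1.2.1 j = p.1.2.1 j) ∧ (∀ j < p.1.1, q.1.2.2.1 j = p.1.2.2.1 j) ∧
      (∀ j < p.1.1, q.1.2.2.2 j = p.1.2.2.2 j) ∧
      1 ≤ ‖∑ j ∈ Finset.Ico p.1.1 q.1.1, q.1.2.2.2 j • e.basis (q.1.2.1 j)‖ ∧
      ‖∑ j ∈ Finset.Ico p.1.1 q.1.1, q.1.2.2.2 j • e.basis (q.1.2.2.1 j)‖ ≤ (1 / 2) ^ i := by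
    rintro i ⟨⟨n, φ, ψ, a⟩, hφ, hψ⟩
    obtain ⟨n', φ', ψ', a', hn, h1, h2, h3, h4, h5, h6⟩ :=
      step n φ ψ hφ hψ ((1 / 2) ^ i) (by positivity)
    refine ⟨⟨⟨n', φ', ψ', fun j ↦ if j < n then a j else a' j⟩, h1, h2⟩, hn, h3, h4,
      fun j hj ↦ if_pos hj, ?_, ?_⟩
    · refine h5.trans (le_of_eq ?_)
      congr 1
      refine Finset.sum_congr rfl fun j hj ↦ ?_
      simp [not_lt.2 (Finset.mem_Ico.1 hj).1]
    · refine le_trans (le_of_eq ?_) h6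
      congr 1
      refine Finset.sum_congr rfl fun j hj ↦ ?_
      simp [not_lt.2 (Finset.mem_Ico.1 hj).1]
  choose next hlt hφ hψ ha hbig hsmall using step'
  let st : ℕ → State := fun i ↦
    Nat.rec ⟨(0, id, id, fun _ ↦ 0), strictMono_id, strictMono_id⟩ (fun i p ↦ next i p) i
  have st_succ : ∀ i, st (i + 1) = next i (st i) := fun i ↦ rfl
  let n : ℕ → ℕ := fun i ↦ (st i).1.1
  let Φ : ℕ → ℕ → ℕ := fun i ↦ (st i).1.2.1
  let Ψ : ℕ → ℕ → ℕ := fun i ↦ (st i).1.2.2.1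
  let α : ℕ → ℕ → 𝕜 := fun i ↦ (st i).1.2.2.2
  have hn : StrictMono n := strictMono_nat_of_lt_succ fun i ↦ hlt i (st i)
  have stable : ∀ i k j, j < n i → i ≤ k → Φ k j = Φ i j ∧ Ψ k j = Ψ i j ∧ α k j = α i j := by
    intro i k j hj hik
    induction k, hik using Nat.le_induction with
    | base => exact ⟨rfl, rfl, rfl⟩
    | succ k hik ih =>
      have hjk : j < n k := hj.trans_le (hn.monotone hik)
      exact ⟨(hφ k (st k) j hjk).trans ih.1, (hψ k (st k) j hjk).trans ih.2.1,
        (ha k (st k) j hjk).trans ih.2.2⟩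
  have hid : ∀ i, i ≤ n i := hn.id_le
  -- Entry j is frozen at stage j + 1 at the latest, because n (j + 1) ≥ j + 1; the diagonal thus
  -- agrees with every later stage.
  let φ : ℕ → ℕ := fun j ↦ Φ (j + 1) j
  let ψ : ℕ → ℕ := fun j ↦ Ψ (j + 1) j
  let a : ℕ → 𝕜 := fun j ↦ α (j + 1) j
  have hlim : ∀ i j, j < n i → φ j = Φ i j ∧ ψ j = Ψ i j ∧ a j = α i j := by
    intro i j hj
    have hj' : j < n (j + 1) := hid (j + 1)
    obtain ⟨h1, h2, h3⟩ := stable i (max i (j + 1)) j hj (le_max_left _ _)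
    obtain ⟨h1', h2', h3'⟩ := stable (j + 1) (max i (j + 1)) j hj' (le_max_right _ _)
    exact ⟨h1'.symm.trans h1, h2'.symm.trans h2, h3'.symm.trans h3⟩
  have φmono : StrictMono φ := by
    intro i j hij
    have hj' : j < n (j + 1) := hid (j + 1)
    rw [(hlim (j + 1) i (hij.trans hj')).1]
    exact (st (j + 1)).2.1 hij
  have ψmono : StrictMono ψ := by
    intro i j hij
    have hj' : j < n (j + 1) := hid (j + 1)
    rw [(hlim (j + 1) i (hij.trans hj')).2.1]
    exact (st (j + 1)).2.2 hij
  have big : ∀ i, 1 ≤ ‖∑ j ∈ Finset.Ico (n i) (n (i + 1)), a j • e.basis (φ j)‖ := by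
    intro i
    refine (hbig i (st i)).trans (le_of_eq ?_)
    congr 1
    refine Finset.sum_congr rfl fun j hj ↦ ?_
    obtain ⟨h1, -, h3⟩ := hlim (i + 1) j (Finset.mem_Ico.1 hj).2
    rw [h1, h3]
  have small : ∀ i, ‖∑ j ∈ Finset.Ico (n i) (n (i + 1)), a j • e.basis (ψ j)‖ ≤ (1 / 2) ^ i := by
    intro i
    refine le_trans (le_of_eq ?_) (hsmall i (st i))
    congr 1
    refine Finset.sum_congr rfl fun j hj ↦ ?_
    obtain ⟨-, h2, h3⟩ := hlim (i + 1) j (Finset.mem_Ico.1 hj).2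
    rw [h2, h3]
  have smalls : ∀ i k, i ≤ k →
      ‖∑ j ∈ Finset.Ico (n i) (n k), a j • e.basis (ψ j)‖ ≤ 2 * (1 / 2) ^ i - 2 * (1 / 2) ^ k := by
    intro i k hik
    induction k, hik using Nat.le_induction with
    | base => simp
    | succ k hik ih =>
      rw [← Finset.sum_Ico_consecutive _ (hn.monotone hik) (hn.monotone (Nat.le_succ k))]
      refine (norm_add_le _ _).trans ((add_le_add ih (small k)).trans (le_of_eq ?_))
      rw [pow_succ]; ring
  -- An interval that is not a union of humps is enlarged to one that is; unconditionality pays for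
  -- this with the factor K.
  have tail : ∀ i p q, n i ≤ p → p ≤ q →
      ‖∑ j ∈ Finset.Ico p q, a j • e.basis (ψ j)‖ ≤ K * (2 * (1 / 2) ^ i) := by
    intro i p q hp hpq
    have hq : q ≤ n (max i q) := (le_max_right i q).trans (hid _)
    refine (norm_sum_comp_subset_le hK ψmono.injective
      (Finset.Ico_subset_Ico hp hq) a).trans ?_
    have := smalls i (max i q) (le_max_left _ _)
    have h2 : (0 : ℝ) ≤ 2 * (1 / 2) ^ (max i q) := by positivity
    gcongr
    linarith
  have hψsum : Summable (fun j ↦ a j • e.basis (ψ j)) (SummationFilter.conditional ℕ) := by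
    have hc : CauchySeq fun N ↦ ∑ j ∈ Finset.range N, a j • e.basis (ψ j) := by
      rw [Metric.cauchySeq_iff']
      intro ε hε
      have h0 : Tendsto (fun i : ℕ ↦ K * (2 * (1 / 2 : ℝ) ^ i)) atTop (𝓝 (K * (2 * 0))) :=
        ((tendsto_pow_atTop_nhds_zero_of_lt_one (by norm_num) (by norm_num)).const_mul 2).const_mul K
      rw [mul_zero, mul_zero] at h0
      obtain ⟨i, hi⟩ := (h0.eventually (gt_mem_nhds hε)).exists
      refine ⟨n i, fun p hp ↦ ?_⟩
      rw [dist_eq_norm, ← Finset.sum_Ico_eq_sub _ hp]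
      exact (tail i (n i) p le_rfl hp).trans_lt hi
    obtain ⟨f, hf⟩ := cauchySeq_tendsto_of_complete hc
    refine ⟨f, ?_⟩
    rw [HasSum, SummationFilter.conditional_filter_eq_map_range, tendsto_map'_iff]
    exact hf
  have hφsum : Summable (fun j ↦ a j • e.basis (φ j)) (SummationFilter.conditional ℕ) :=
    ((he.2 φ φmono a).symm.trans (he.2 ψ ψmono a)).2 hψsum
  obtain ⟨f, hf⟩ := hφsum
  rw [HasSum, SummationFilter.conditional_filter_eq_map_range, tendsto_map'_iff] at hf
  have h1 := (hf.comp (hn.tendsto_atTop.comp (tendsto_add_atTop_nat 1))).sub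
    (hf.comp hn.tendsto_atTop)
  rw [sub_self] at h1
  have h2 := h1.norm
  rw [norm_zero] at h2
  obtain ⟨i, hi⟩ := (h2.eventually (gt_mem_nhds zero_lt_one)).exists
  simp only [Function.comp_apply] at hi
  rw [← Finset.sum_Ico_eq_sub _ (hn.monotone (Nat.le_succ i))] at hi
  exact absurd (big i) (not_le.2 hi)

/-- The gliding hump with humps of a single term: if ratios of norms were unbounded, they would be
unbounded arbitrarily far out, and normalized vectors along one subsequence would face tiny ones
along the other. -/
theorem IsSubsymmetric.exists_norm_basis_le [CompleteSpace S] {e : SchauderBasis 𝕜 S}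
    (he : IsSubsymmetric e) : ∃ D : ℝ, ∀ i j, ‖e.basis i‖ ≤ D * ‖e.basis j‖ := by
  have pos : ∀ i, 0 < ‖e.basis i‖ := fun i ↦ norm_pos_iff.2 (basis_ne_zero e i)
  by_contra! hD
  have far : ∀ (n : ℕ) (D : ℝ), ∃ i j, n ≤ i ∧ n ≤ j ∧ D * ‖e.basis j‖ ≤ ‖e.basis i‖ := by
    intro n D
    by_contra! hn
    have hDpos : 0 < D := by
      have := hn n n le_rfl le_rfl
      have := pos n
      by_contra! h
      nlinarith
    -- If the ratios are bounded by D from n on, the two factors bound all ‖e_i‖ and all ‖e_j‖⁻¹, so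
    -- their product bounds every ratio.
    obtain ⟨i, j, hij⟩ := hD ((∑ l ∈ Finset.range n, ‖e.basis l‖ + D * ‖e.basis n‖) *
      (∑ l ∈ Finset.range n, ‖e.basis l‖⁻¹ + D * ‖e.basis n‖⁻¹))
    have hi : ‖e.basis i‖ ≤ ∑ l ∈ Finset.range n, ‖e.basis l‖ + D * ‖e.basis n‖ := by
      rcases lt_or_ge i n with h | h
      · have := Finset.single_le_sum (f := fun l ↦ ‖e.basis l‖) (fun l _ ↦ norm_nonneg _)
          (Finset.mem_range.2 h)
        have := mul_pos hDpos (pos n)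
        linarith
      · have : 0 ≤ ∑ l ∈ Finset.range n, ‖e.basis l‖ := Finset.sum_nonneg fun l _ ↦ norm_nonneg _
        linarith [hn i n h le_rfl]
    have hj : ‖e.basis j‖⁻¹ ≤ ∑ l ∈ Finset.range n, ‖e.basis l‖⁻¹ + D * ‖e.basis n‖⁻¹ := by
      rcases lt_or_ge j n with h | h
      · have := Finset.single_le_sum (f := fun l ↦ ‖e.basis l‖⁻¹) (fun l _ ↦ by positivity)
          (Finset.mem_range.2 h)
        have := mul_pos hDpos (inv_pos.2 (pos n))
        linarith
      · have h1 : 0 ≤ ∑ l ∈ Finset.range n, ‖e.basis l‖⁻¹ :=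
          Finset.sum_nonneg fun l _ ↦ by positivity
        have h2 := hn n j le_rfl h
        have h3 : ‖e.basis j‖⁻¹ ≤ D * ‖e.basis n‖⁻¹ := by
          rw [← div_eq_mul_inv, inv_eq_one_div, div_le_div_iff₀ (pos j) (pos n)]
          linarith
        linarith
    have h1 : ‖e.basis i‖ * ‖e.basis j‖⁻¹ ≤ _ :=
      mul_le_mul hi hj (by positivity) ((norm_nonneg _).trans hi)
    have h2 := mul_le_mul_of_nonneg_right h1 (norm_nonneg (e.basis j))
    rw [inv_mul_cancel_right₀ (pos j).ne'] at h2
    exact absurd h2 (not_le.2 hij)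
  refine not_forall_exists_hump he fun n φ ψ hφ hψ ε hε ↦ ?_
  obtain ⟨i, j, hi, hj, hij⟩ := far (max (φ n) (ψ n)) (1 / ε)
  refine ⟨n + 1, splice φ (fun l ↦ i + l) n, splice ψ (fun l ↦ j + l) n,
    fun _ ↦ ((‖e.basis i‖⁻¹ : ℝ) : 𝕜), Nat.lt_succ_self n,
    strictMono_splice hφ (fun _ _ h ↦ by simpa using h) (by simpa using (le_max_left _ _).trans hi),
    strictMono_splice hψ (fun _ _ h ↦ by simpa using h) (by simpa using (le_max_right _ _).trans hj),
    fun l hl ↦ splice_of_lt hl, fun l hl ↦ splice_of_lt hl, ?_, ?_⟩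
  · simp [splice_of_le le_rfl, norm_smul, inv_mul_cancel₀ (pos i).ne']
  · simp only [Nat.Ico_succ_singleton, Finset.sum_singleton, splice_of_le le_rfl, norm_smul]
    rw [RCLike.norm_ofReal, abs_of_pos (inv_pos.2 (pos i)), Nat.sub_self, add_zero,
      inv_mul_le_iff₀ (pos i)]
    rw [one_div, inv_mul_le_iff₀ hε] at hij
    linarith

/-- A subsymmetric basis is uniformly equivalent to its subsequences. -/
theorem IsSubsymmetric.exists_norm_sum_comp_le [CompleteSpace S] {e : SchauderBasis 𝕜 S}
    (he : IsSubsymmetric e) : ∃ R : ℝ, ∀ (φ ψ : ℕ → ℕ), StrictMono φ → StrictMono ψ →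
      ∀ (N : ℕ) (a : ℕ → 𝕜), ‖∑ j ∈ Finset.range N, a j • e.basis (φ j)‖ ≤
        R * ‖∑ j ∈ Finset.range N, a j • e.basis (ψ j)‖ := by
  obtain ⟨K, hK1, hK⟩ := he.1.exists_norm_sum_le
  obtain ⟨D, hD⟩ := he.exists_norm_basis_le
  have hD0 : 0 ≤ D := by
    by_contra! h
    have h1 := hD 0 0
    have h2 := norm_pos_iff.2 (basis_ne_zero e 0)
    nlinarith
  by_contra! hR
  refine not_forall_exists_hump he fun n φ ψ hφ hψ ε hε ↦ ?_
  -- The hump must start beyond φ n and ψ n, so the first m = φ n + ψ n terms are discarded. Each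
  -- has norm at most D K B along φ₀; the second summand pays for them, and K / ε remains for the
  -- tail.
  obtain ⟨φ₀, ψ₀, hφ₀, hψ₀, N, a, ha⟩ := hR (K / ε + ↑(φ n + ψ n) * (D * K))
  set m := φ n + ψ n with hm
  set B := ‖∑ j ∈ Finset.range N, a j • e.basis (ψ₀ j)‖ with hB
  have hB0 : 0 ≤ B := norm_nonneg _
  set T := ‖∑ j ∈ Finset.Ico m N, a j • e.basis (φ₀ j)‖ with hT
  have coef : ∀ j < N, ‖a j • e.basis (φ₀ j)‖ ≤ D * K * B := by
    intro j hj
    have h1 := norm_sum_comp_subset_le hK hψ₀.injective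
      (Finset.singleton_subset_iff.2 (Finset.mem_range.2 hj)) a
    rw [Finset.sum_singleton, ← hB] at h1
    rw [norm_smul] at h1 ⊢
    calc ‖a j‖ * ‖e.basis (φ₀ j)‖ ≤ ‖a j‖ * (D * ‖e.basis (ψ₀ j)‖) := by gcongr; exact hD _ _
      _ = D * (‖a j‖ * ‖e.basis (ψ₀ j)‖) := by ring
      _ ≤ D * (K * B) := by gcongr
      _ = _ := by ring
  have hmN : m < N := by
    by_contra! h
    have h1 : ‖∑ j ∈ Finset.range N, a j • e.basis (φ₀ j)‖ ≤ N * (D * K * B) := by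
      refine (norm_sum_le_of_le _ (fun j hj ↦ coef j (Finset.mem_range.1 hj))).trans (le_of_eq ?_)
      simp
    have h2 : (N : ℝ) * (D * K * B) ≤ m * (D * K * B) := by gcongr
    have h3 : 0 ≤ K / ε * B := by positivity
    nlinarith
  have hhead : ‖∑ j ∈ Finset.range m, a j • e.basis (φ₀ j)‖ ≤ m * (D * K * B) := by
    refine (norm_sum_le_of_le _
      (fun j hj ↦ coef j ((Finset.mem_range.1 hj).trans hmN))).trans (le_of_eq ?_)
    simp
  have hTB : K / ε * B < T := by
    rw [← Finset.sum_range_add_sum_Ico _ hmN.le] at ha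
    have := ha.trans_le (norm_add_le _ _)
    nlinarith
  have hTpos : 0 < T := lt_of_le_of_lt (by positivity) hTB
  have htail : ‖∑ j ∈ Finset.Ico m N, a j • e.basis (ψ₀ j)‖ ≤ ε * T := by
    refine (norm_sum_comp_subset_le hK hψ₀.injective (B := Finset.range N) (fun j hj ↦
      Finset.mem_range.2 (Finset.mem_Ico.1 hj).2) a).trans ?_
    rw [div_mul_eq_mul_div, div_lt_iff₀ hε] at hTB
    linarith
  have reindex : ∀ χ χ₀ : ℕ → ℕ, ∑ j ∈ Finset.Ico n (n + (N - m)),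
      (((T⁻¹ : ℝ) : 𝕜) * a (j - n + m)) • e.basis (splice χ (fun l ↦ χ₀ (l + m)) n j)
      = ((T⁻¹ : ℝ) : 𝕜) • ∑ j ∈ Finset.Ico m N, a j • e.basis (χ₀ j) := by
    intro χ χ₀
    rw [Finset.sum_Ico_eq_sum_range, Finset.sum_Ico_eq_sum_range, Finset.smul_sum,
      Nat.add_sub_cancel_left]
    refine Finset.sum_congr rfl fun j _ ↦ ?_
    rw [splice_of_le (Nat.le_add_right n j), Nat.add_sub_cancel_left, add_comm j m, mul_smul]
  refine ⟨n + (N - m), splice φ (fun l ↦ φ₀ (l + m)) n, splice ψ (fun l ↦ ψ₀ (l + m)) n,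
    fun j ↦ ((T⁻¹ : ℝ) : 𝕜) * a (j - n + m), by omega,
    strictMono_splice hφ (fun _ _ h ↦ hφ₀ (by omega)) ?_,
    strictMono_splice hψ (fun _ _ h ↦ hψ₀ (by omega)) ?_,
    fun l hl ↦ splice_of_lt hl, fun l hl ↦ splice_of_lt hl, ?_, ?_⟩
  · rw [zero_add]; exact (Nat.le_add_right _ _).trans (hφ₀.id_le m)
  · rw [zero_add]; exact (Nat.le_add_left _ _).trans (hψ₀.id_le m)
  · rw [reindex, norm_smul, RCLike.norm_ofReal, abs_of_pos (inv_pos.2 hTpos), ← hT,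
      inv_mul_cancel₀ hTpos.ne']
  · rw [reindex, norm_smul, RCLike.norm_ofReal, abs_of_pos (inv_pos.2 hTpos),
      inv_mul_le_iff₀ hTpos]
    linarith

end GlidingHump

/-! ### Uniform subsymmetry and its consequences for sums of basis vectors -/

section Quantitative

variable {𝕜 : Type*} [RCLike 𝕜]
variable {S : Type*} [NormedAddCommGroup S] [NormedSpace 𝕜 S]

/-- Every strictly increasing function on a finite set of indices is, up to the increasing
enumeration of the set, the restriction of a strictly increasing sequence. -/
theorem exists_strictMono_eq_of_strictMonoOn (A : Finset ℕ) :
    ∃ g : ℕ → ℕ, A = (Finset.range A.card).image g ∧ Set.InjOn g (Finset.range A.card) ∧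
      ∀ φ : ℕ → ℕ, StrictMonoOn φ A →
        ∃ χ : ℕ → ℕ, StrictMono χ ∧ ∀ i < A.card, χ i = φ (g i) := by
  classical
  let E := A.orderEmbOfFin rfl
  let g : ℕ → ℕ := fun i ↦ if h : i < A.card then E ⟨i, h⟩ else 0
  have hg : ∀ i (h : i < A.card), g i = E ⟨i, h⟩ := fun i h ↦ dif_pos h
  have hmem : ∀ i < A.card, g i ∈ A := fun i h ↦ by
    rw [hg i h]; exact A.orderEmbOfFin_mem rfl _
  have hmono : ∀ i j, i < j → j < A.card → g i < g j := fun i j hij hj ↦ by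
    rw [hg i (hij.trans hj), hg j hj]
    exact E.strictMono hij
  refine ⟨g, ?_, ?_, fun φ hφ ↦ ?_⟩
  · ext x
    simp only [Finset.mem_image, Finset.mem_range]
    constructor
    · intro hx
      have : x ∈ Set.range E := by
        rw [Finset.range_orderEmbOfFin]; exact hx
      obtain ⟨i, rfl⟩ := this
      exact ⟨i, i.2, hg i i.2⟩
    · rintro ⟨i, hi, rfl⟩
      exact hmem i hi
  · intro i hi j hj hij
    simp only [Finset.coe_range, Set.mem_Iio] at hi hj
    rcases lt_trichotomy i j with h | h | h
    · exact absurd hij (hmono i j h hj).ne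
    · exact h
    · exact absurd hij (hmono j i h hi).ne'
  · let M := ∑ i ∈ Finset.range A.card, φ (g i)
    -- M bounds all prescribed values, so the values M + 1 + i continue the sequence increasingly.
    refine ⟨fun i ↦ if i < A.card then φ (g i) else M + 1 + i, ?_, fun i hi ↦ if_pos hi⟩
    intro i j hij
    dsimp only
    split_ifs with h1 h2 h2
    · exact hφ (hmem i h1) (hmem j h2) (hmono i j hij h2)
    · have : φ (g i) ≤ M := Finset.single_le_sum (f := fun i ↦ φ (g i))
        (fun _ _ ↦ Nat.zero_le _) (Finset.mem_range.2 h1)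
      omega
    · omega
    · omega

/-- Quantitative form of subsymmetry for a sequence of vectors. -/
structure IsSubsymmetricWith (𝕜 : Type*) [RCLike 𝕜] {S : Type*} [NormedAddCommGroup S]
    [NormedSpace 𝕜 S] (e : ℕ → S) (K : ℝ) : Prop where
  one_le : 1 ≤ K
  ne_zero : e 0 ≠ 0
  norm_sum_le : ∀ (A : Finset ℕ) (a c : ℕ → 𝕜), (∀ j ∈ A, ‖a j‖ ≤ ‖c j‖) →
    ‖∑ j ∈ A, a j • e j‖ ≤ K * ‖∑ j ∈ A, c j • e j‖
  norm_sum_comp_le : ∀ (A : Finset ℕ) (φ ψ : ℕ → ℕ), StrictMonoOn φ A → StrictMonoOn ψ A →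
    ∀ a : ℕ → 𝕜, ‖∑ j ∈ A, a j • e (φ j)‖ ≤ K * ‖∑ j ∈ A, a j • e (ψ j)‖

theorem IsSubsymmetric.exists_isSubsymmetricWith [CompleteSpace S] {e : SchauderBasis 𝕜 S}
    (he : IsSubsymmetric e) : ∃ K, IsSubsymmetricWith 𝕜 e.basis K := by
  obtain ⟨K, hK1, hK⟩ := he.1.exists_norm_sum_le
  obtain ⟨R, hR⟩ := he.exists_norm_sum_comp_le
  refine ⟨max K R, hK1.trans (le_max_left _ _), basis_ne_zero e 0, fun A a c h ↦
    (hK A a c h).trans (by gcongr; exact le_max_left _ _), fun A φ ψ hφ hψ a ↦ ?_⟩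
  obtain ⟨g, hA, hinj, hg⟩ := exists_strictMono_eq_of_strictMonoOn A
  obtain ⟨φ', hφ', hφg⟩ := hg φ hφ
  obtain ⟨ψ', hψ', hψg⟩ := hg ψ hψ
  have key : ∀ χ χ' : ℕ → ℕ, (∀ i < A.card, χ' i = χ (g i)) → ∑ j ∈ A, a j • e.basis (χ j)
      = ∑ i ∈ Finset.range A.card, a (g i) • e.basis (χ' i) := by
    intro χ χ' h
    conv_lhs => rw [hA]
    rw [Finset.sum_image hinj]
    exact Finset.sum_congr rfl fun i hi ↦ by rw [h i (Finset.mem_range.1 hi)]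
  rw [key φ φ' hφg, key ψ ψ' hψg]
  exact (hR φ' ψ' hφ' hψ' A.card _).trans (by gcongr; exact le_max_right _ _)

/-- The norm of the sum of the first `m` vectors of a sequence. -/
def initialNorm (e : ℕ → S) (m : ℕ) : ℝ := ‖∑ j ∈ Finset.range m, e j‖

theorem initialNorm_nonneg (e : ℕ → S) (m : ℕ) : 0 ≤ initialNorm e m := norm_nonneg _

namespace IsSubsymmetricWith

variable {e : ℕ → S} {K : ℝ}

theorem pos (he : IsSubsymmetricWith 𝕜 e K) : 0 < K := zero_lt_one.trans_le he.one_le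

theorem norm_sum_subset_le (he : IsSubsymmetricWith 𝕜 e K) {A B : Finset ℕ} (hAB : A ⊆ B)
    (c : ℕ → 𝕜) : ‖∑ j ∈ A, c j • e j‖ ≤ K * ‖∑ j ∈ B, c j • e j‖ := by
  have := he.norm_sum_le B (fun j ↦ if j ∈ A then c j else 0) c (fun j _ ↦ by
    split_ifs <;> simp)
  refine le_trans (le_of_eq ?_) this
  congr 1
  simp only [ite_smul, zero_smul]
  rw [Finset.sum_ite_mem, Finset.inter_eq_right.2 hAB]

theorem initialNorm_mono (he : IsSubsymmetricWith 𝕜 e K) {m n : ℕ} (h : m ≤ n) :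
    initialNorm e m ≤ K * initialNorm e n := by
  have := he.norm_sum_subset_le (Finset.range_subset_range.2 h) (fun _ ↦ 1)
  simpa [initialNorm] using this

theorem initialNorm_pos (he : IsSubsymmetricWith 𝕜 e K) {m : ℕ} (h : 1 ≤ m) :
    0 < initialNorm e m := by
  have h1 := he.initialNorm_mono h
  have h2 : 0 < initialNorm e 1 := by simpa [initialNorm] using he.ne_zero
  have := he.pos
  by_contra! h3
  nlinarith

theorem norm_sum_indicator_le (he : IsSubsymmetricWith 𝕜 e K) (A : Finset ℕ) :
    ‖∑ j ∈ A, e j‖ ≤ K * initialNorm e A.card := by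
  obtain ⟨g, hA, hinj, hg⟩ := exists_strictMono_eq_of_strictMonoOn A
  obtain ⟨χ, hχ, hχg⟩ := hg id strictMonoOn_id
  have h := he.norm_sum_comp_le (Finset.range A.card) χ id (hχ.strictMonoOn _)
    strictMonoOn_id (fun _ ↦ 1)
  simp only [one_smul, id] at h
  conv_lhs => rw [hA]
  rw [Finset.sum_image hinj]
  refine le_trans (le_of_eq ?_) h
  congr 1
  exact Finset.sum_congr rfl fun i hi ↦ by rw [hχg i (Finset.mem_range.1 hi)]; rfl

theorem initialNorm_card_le (he : IsSubsymmetricWith 𝕜 e K) (A : Finset ℕ) :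
    initialNorm e A.card ≤ K * ‖∑ j ∈ A, e j‖ := by
  obtain ⟨g, hA, hinj, hg⟩ := exists_strictMono_eq_of_strictMonoOn A
  obtain ⟨χ, hχ, hχg⟩ := hg id strictMonoOn_id
  have h := he.norm_sum_comp_le (Finset.range A.card) id χ strictMonoOn_id (hχ.strictMonoOn _)
    (fun _ ↦ 1)
  simp only [one_smul, id] at h
  have e1 : ∑ j ∈ A, e j = ∑ i ∈ Finset.range A.card, e (χ i) := by
    conv_lhs => rw [hA]
    rw [Finset.sum_image hinj]
    exact Finset.sum_congr rfl fun i hi ↦ by rw [hχg i (Finset.mem_range.1 hi)]; rfl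
  rw [e1]
  exact h

theorem norm_sum_le_initialNorm (he : IsSubsymmetricWith 𝕜 e K) {A : Finset ℕ} {k : ℕ}
    (hA : A.card ≤ k) {a : ℕ → 𝕜} {t : ℝ} (ht : 0 ≤ t) (ha : ∀ j ∈ A, ‖a j‖ ≤ t) :
    ‖∑ j ∈ A, a j • e j‖ ≤ K ^ 3 * t * initialNorm e k := by
  have h1 := he.norm_sum_le A a (fun _ ↦ (t : 𝕜)) (fun j hj ↦ by
    rw [RCLike.norm_ofReal, abs_of_nonneg ht]; exact ha j hj)
  rw [← Finset.smul_sum, norm_smul, RCLike.norm_ofReal, abs_of_nonneg ht] at h1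
  have h2 := he.norm_sum_indicator_le A
  have h3 := he.initialNorm_mono hA
  have hK := he.pos
  calc _ ≤ _ := h1
    _ ≤ K * (t * (K * (K * initialNorm e k))) := by
      gcongr; exact h2.trans (by gcongr)
    _ = _ := by ring

theorem initialNorm_le_norm_sum (he : IsSubsymmetricWith 𝕜 e K) {A : Finset ℕ} {k : ℕ}
    (hA : k ≤ A.card) {a : ℕ → 𝕜} {t : ℝ} (ht : 0 ≤ t) (ha : ∀ j ∈ A, t ≤ ‖a j‖) :
    t * initialNorm e k ≤ K ^ 3 * ‖∑ j ∈ A, a j • e j‖ := by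
  have h1 := he.norm_sum_le A (fun _ ↦ (t : 𝕜)) a (fun j hj ↦ by
    rw [RCLike.norm_ofReal, abs_of_nonneg ht]; exact ha j hj)
  rw [← Finset.smul_sum, norm_smul, RCLike.norm_ofReal, abs_of_nonneg ht] at h1
  have h2 := he.initialNorm_card_le A
  have h3 := he.initialNorm_mono hA
  have hK := he.pos
  calc t * initialNorm e k ≤ t * (K * (K * ‖∑ j ∈ A, e j‖)) := by
        gcongr; exact h3.trans (by gcongr)
    _ = K ^ 2 * (t * ‖∑ j ∈ A, e j‖) := by ring
    _ ≤ K ^ 2 * (K * ‖∑ j ∈ A, a j • e j‖) := by gcongr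
    _ = _ := by ring

/-- A rearrangement which is increasing on a set and on its complement is bounded. -/
theorem norm_sum_comp_le_of_strictMonoOn_filter (he : IsSubsymmetricWith 𝕜 e K) (A : Finset ℕ)
    (p : ℕ → Prop) [DecidablePred p] (ρ : ℕ → ℕ) (h1 : StrictMonoOn ρ (A.filter p))
    (h2 : StrictMonoOn ρ (A.filter fun j ↦ ¬ p j)) (a : ℕ → 𝕜) :
    ‖∑ j ∈ A, a j • e (ρ j)‖ ≤ 2 * K ^ 2 * ‖∑ j ∈ A, a j • e j‖ := by
  have hK := he.pos
  rw [← Finset.sum_filter_add_sum_filter_not A p]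
  have k1 := he.norm_sum_comp_le _ ρ id h1 strictMonoOn_id a
  have k2 := he.norm_sum_comp_le _ ρ id h2 strictMonoOn_id a
  have l1 := he.norm_sum_subset_le (Finset.filter_subset p A) a
  have l2 := he.norm_sum_subset_le (Finset.filter_subset (fun j ↦ ¬ p j) A) a
  simp only [id] at k1 k2
  calc _ ≤ _ := norm_add_le _ _
    _ ≤ K * (K * ‖∑ j ∈ A, a j • e j‖) + K * (K * ‖∑ j ∈ A, a j • e j‖) :=
      add_le_add (k1.trans (by gcongr)) (k2.trans (by gcongr))
    _ = _ := by ring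

end IsSubsymmetricWith

/-- The residues of q * s consecutive integers run q times through all classes, whatever the offset.
This evaluates averages over cyclic shifts. -/
theorem sum_range_mul_mod {M : Type*} [AddCommMonoid M] (F : ℕ → M) (s q c : ℕ) (hs : 0 < s) :
    ∑ k ∈ Finset.range (q * s), F ((c + k) % s) = q • ∑ r ∈ Finset.range s, F r := by
  have one : ∀ c, ∑ k ∈ Finset.range s, F ((c + k) % s) = ∑ r ∈ Finset.range s, F r := by
    intro c
    induction c with
    | zero =>
      refine Finset.sum_congr rfl fun k hk ↦ ?_
      rw [zero_add, Nat.mod_eq_of_lt (Finset.mem_range.1 hk)]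
    | succ c ih =>
      rw [← ih]
      obtain ⟨s, rfl⟩ : ∃ t, s = t + 1 := ⟨s - 1, by omega⟩
      rw [Finset.sum_range_succ, Finset.sum_range_succ' (fun k ↦ F ((c + k) % (s + 1)))]
      congr 1
      · exact Finset.sum_congr rfl fun k _ ↦ by rw [show c + 1 + k = c + (k + 1) by ring]
      · rw [show c + 1 + s = c + 0 + (s + 1) by ring, Nat.add_mod_right]
  induction q with
  | zero => simp
  | succ q ih =>
    rw [Nat.succ_mul, Finset.sum_range_add, ih, succ_nsmul]
    congr 1
    rw [← one (c + q * s)]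
    exact Finset.sum_congr rfl fun k _ ↦ by rw [add_assoc]

namespace IsSubsymmetricWith

variable {e : ℕ → S} {K : ℝ}

/-- Average over the k cyclic rotations of the indices: each is increasing on two pieces, so it
costs 2K², while their sum replaces every e_j by e_0 + … + e_(k-1). -/
theorem norm_sum_mul_initialNorm_range_le (he : IsSubsymmetricWith 𝕜 e K) {k : ℕ} (hk : 1 ≤ k)
    (a : ℕ → 𝕜) : ‖∑ j ∈ Finset.range k, a j‖ * initialNorm e k ≤
      2 * K ^ 2 * k * ‖∑ j ∈ Finset.range k, a j • e j‖ := by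
  have rot : ∀ r ∈ Finset.range k, ‖∑ j ∈ Finset.range k, a j • e ((j + r) % k)‖
      ≤ 2 * K ^ 2 * ‖∑ j ∈ Finset.range k, a j • e j‖ := by
    intro r hr
    rw [Finset.mem_range] at hr
    refine he.norm_sum_comp_le_of_strictMonoOn_filter (Finset.range k) (fun j ↦ j + r < k)
      (fun j ↦ (j + r) % k) ?_ ?_ a
    · intro i hi j hj hij
      simp only [Finset.coe_filter, Finset.mem_range, Set.mem_ofPred_eq] at hi hj
      simp only
      rw [Nat.mod_eq_of_lt hi.2, Nat.mod_eq_of_lt hj.2]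
      omega
    · intro i hi j hj hij
      simp only [Finset.coe_filter, Finset.mem_range, Set.mem_ofPred_eq] at hi hj
      have h : ∀ i, i < k ∧ ¬ i + r < k → (i + r) % k = i + r - k := by
        intro i hi
        rw [Nat.mod_eq_sub_mod (by omega), Nat.mod_eq_of_lt (by omega)]
      simp only
      rw [h i hi, h j hj]
      omega
  have sum : ∑ r ∈ Finset.range k, ∑ j ∈ Finset.range k, a j • e ((j + r) % k)
      = (∑ j ∈ Finset.range k, a j) • ∑ j ∈ Finset.range k, e j := by
    rw [Finset.sum_comm, Finset.sum_smul]
    refine Finset.sum_congr rfl fun j _ ↦ ?_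
    rw [← Finset.smul_sum]
    have := sum_range_mul_mod e k 1 j hk
    rw [one_mul, one_smul] at this
    rw [this]
  have h := norm_sum_le_of_le _ rot
  rw [sum, norm_smul, Finset.sum_const, Finset.card_range, nsmul_eq_mul] at h
  calc _ ≤ _ := h
    _ = _ := by ring

/-- The rotation bound after moving A to an initial segment and replacing coefficients by their
moduli; each of these costs one factor K. It controls the ℓ₁ norm of k coefficients by k / Λ(k)
times the norm in S. -/
theorem sum_norm_mul_initialNorm_le (he : IsSubsymmetricWith 𝕜 e K) {A : Finset ℕ} {k : ℕ}
    (hk : 1 ≤ k) (hA : A.card ≤ k) (a : ℕ → 𝕜) :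
    (∑ j ∈ A, ‖a j‖) * initialNorm e k ≤ 2 * K ^ 4 * k * ‖∑ j ∈ A, a j • e j‖ := by
  have hK := he.pos
  obtain ⟨g, hAg, hinj, hg⟩ := exists_strictMono_eq_of_strictMonoOn A
  obtain ⟨χ, hχ, hχg⟩ := hg id strictMonoOn_id
  have h1 := he.norm_sum_mul_initialNorm_range_le hk
    (fun i ↦ if i < A.card then ((‖a (g i)‖ : ℝ) : 𝕜) else 0)
  have sub : (Finset.range k).filter (fun i ↦ i < A.card) = Finset.range A.card := by
    ext i; simp only [Finset.mem_filter, Finset.mem_range]; omega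
  have s1 : ∑ i ∈ Finset.range k, (if i < A.card then ((‖a (g i)‖ : ℝ) : 𝕜) else 0)
      = ((∑ j ∈ A, ‖a j‖ : ℝ) : 𝕜) := by
    rw [← Finset.sum_filter, sub]
    conv_rhs => rw [hAg]
    rw [Finset.sum_image hinj]
    push_cast
    rfl
  have s2 : ∑ i ∈ Finset.range k, (if i < A.card then ((‖a (g i)‖ : ℝ) : 𝕜) else 0) • e i
      = ∑ i ∈ Finset.range A.card, ((‖a (g i)‖ : ℝ) : 𝕜) • e i := by
    simp only [ite_smul, zero_smul]
    rw [← Finset.sum_filter, sub]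
  have s3 : ∑ j ∈ A, a j • e j = ∑ i ∈ Finset.range A.card, a (g i) • e (χ i) := by
    conv_lhs => rw [hAg]
    rw [Finset.sum_image hinj]
    exact Finset.sum_congr rfl fun i hi ↦ by rw [hχg i (Finset.mem_range.1 hi)]; rfl
  rw [s1, s2, RCLike.norm_ofReal, abs_of_nonneg (Finset.sum_nonneg fun _ _ ↦ norm_nonneg _)] at h1
  have h2 := he.norm_sum_le (Finset.range A.card) (fun i ↦ ((‖a (g i)‖ : ℝ) : 𝕜))
    (fun i ↦ a (g i)) (fun i _ ↦ by simp)
  have h3 := he.norm_sum_comp_le (Finset.range A.card) id χ strictMonoOn_id (hχ.strictMonoOn _)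
    (fun i ↦ a (g i))
  rw [s3]
  simp only [id] at h3
  calc _ ≤ _ := h1
    _ ≤ 2 * K ^ 2 * k * (K * (K * ‖∑ i ∈ Finset.range A.card, a (g i) • e (χ i)‖)) := by
      gcongr; exact h2.trans (by gcongr)
    _ = _ := by ring

end IsSubsymmetricWith

end Quantitative

/-! ### Operators determined by their values on a basis -/

section Operators

variable {𝕜 : Type*} [RCLike 𝕜]
variable {S : Type*} [NormedAddCommGroup S] [NormedSpace 𝕜 S]
variable {Y : Type*} [NormedAddCommGroup Y] [NormedSpace 𝕜 Y]

theorem clm_ext_basis (b : SchauderBasis 𝕜 S) {T U : S →L[𝕜] Y}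
    (h : ∀ j, T (b.basis j) = U (b.basis j)) : T = U := by
  ext f
  have h1 := (T.continuous.tendsto f).comp (tendsto_sum_range b f)
  have h2 := (U.continuous.tendsto f).comp (tendsto_sum_range b f)
  refine tendsto_nhds_unique h1 (h2.congr fun n ↦ ?_)
  simp [map_sum, h]

theorem exists_clm_of_norm_sum_le [CompleteSpace S] [CompleteSpace Y] (b : SchauderBasis 𝕜 S)
    (y : ℕ → Y) (M : ℝ) (h : ∀ (A : Finset ℕ) (a : ℕ → 𝕜),
      ‖∑ j ∈ A, a j • y j‖ ≤ M * ‖∑ j ∈ A, a j • b.basis j‖) :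
    ∃ T : S →L[𝕜] Y, ∀ j, T (b.basis j) = y j := by
  let T : ℕ → S →L[𝕜] Y := fun N ↦ ∑ j ∈ Finset.range N, (b.coord j).smulRight (y j)
  have hT : ∀ N f, T N f = ∑ j ∈ Finset.range N, b.coord j f • y j := fun N f ↦ by
    simp [T]
  have hM : 0 ≤ M := by
    have h1 := h {0} (fun _ ↦ 1)
    have h2 := norm_pos_iff.2 (basis_ne_zero b 0)
    simp only [one_smul, Finset.sum_singleton] at h1
    by_contra! h3
    nlinarith [norm_nonneg (y 0)]
  have hc : ∀ f, CauchySeq fun N ↦ T N f := by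
    intro f
    have h1 := (tendsto_sum_range b f).cauchySeq
    rw [Metric.cauchySeq_iff'] at h1 ⊢
    intro ε hε
    obtain ⟨N, hN⟩ := h1 (ε / (M + 1)) (by positivity)
    refine ⟨N, fun n hn ↦ ?_⟩
    have h2 := hN n hn
    rw [dist_eq_norm, ← Finset.sum_Ico_eq_sub _ hn] at h2
    rw [dist_eq_norm, hT, hT, ← Finset.sum_Ico_eq_sub _ hn]
    rw [lt_div_iff₀ (by positivity)] at h2
    have h3 := h (Finset.Ico N n) (fun j ↦ b.coord j f)
    nlinarith [norm_nonneg (∑ j ∈ Finset.Ico N n, b.coord j f • b.basis j)]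
  choose L hL using fun f ↦ cauchySeq_tendsto_of_complete (hc f)
  refine ⟨continuousLinearMapOfTendsto T (f := L) (tendsto_pi_nhds.2 hL), fun j ↦ ?_⟩
  refine tendsto_nhds_unique (hL (b.basis j)) (tendsto_const_nhds.congr' ?_)
  filter_upwards [eventually_gt_atTop j] with N hN
  rw [hT]
  simp [coord_basis, hN]

end Operators

/-! ### Blocks of geometrically growing size and shifts inside them -/

section Blocks

/-- The `n`-th block of the partition of `ℕ` into consecutive blocks of size `(b - 1) * b ^ n`. -/
def block (b n : ℕ) : Finset ℕ := Finset.Ico (b ^ n - 1) (b ^ (n + 1) - 1)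

/-- The index of the block to which `j` belongs. -/
def blockIndex (b j : ℕ) : ℕ := Nat.log b (j + 1)

/-- The size of the `n`-th block. -/
def blockSize (b n : ℕ) : ℕ := (b - 1) * b ^ n

variable {b : ℕ}

theorem blockSize_pos (hb : 2 ≤ b) (n : ℕ) : 0 < blockSize b n :=
  Nat.mul_pos (by omega) (by positivity)

theorem pow_add_blockSize (hb : 2 ≤ b) (n : ℕ) : b ^ n + blockSize b n = b ^ (n + 1) := by
  obtain ⟨c, rfl⟩ : ∃ c, b = c + 1 := ⟨b - 1, by omega⟩
  simp [blockSize, pow_succ]; ring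

theorem blockSize_add (n k : ℕ) : blockSize b (n + k) = b ^ k * blockSize b n := by
  simp [blockSize, pow_add]; ring

theorem mem_block_iff (hb : 2 ≤ b) {n j : ℕ} : j ∈ block b n ↔ blockIndex b j = n := by
  have h : 0 < b ^ n := by positivity
  have h' : 0 < b ^ (n + 1) := by positivity
  rw [block, Finset.mem_Ico, blockIndex, Nat.log_eq_iff (Or.inr ⟨by omega, by omega⟩)]
  omega

theorem mem_block_iff_le (hb : 2 ≤ b) {n j : ℕ} :
    j ∈ block b n ↔ b ^ n ≤ j + 1 ∧ j + 1 < b ^ n + blockSize b n := by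
  have h : 0 < b ^ n := by positivity
  have h' : 0 < b ^ (n + 1) := by positivity
  rw [pow_add_blockSize hb, block, Finset.mem_Ico]
  omega

theorem mem_block_blockIndex (hb : 2 ≤ b) (j : ℕ) : j ∈ block b (blockIndex b j) :=
  (mem_block_iff hb).2 rfl

theorem card_block (hb : 2 ≤ b) (n : ℕ) : (block b n).card = blockSize b n := by
  have := pow_add_blockSize hb n
  have h : 0 < b ^ n := by positivity
  rw [block, Nat.card_Ico]; omega

theorem blockIndex_mono {i j : ℕ} (h : i ≤ j) : blockIndex b i ≤ blockIndex b j :=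
  Nat.log_mono_right (by omega)

theorem blockIndex_lt_iff (hb : 2 ≤ b) {j N : ℕ} : blockIndex b j < N ↔ j < b ^ N - 1 := by
  rw [blockIndex, Nat.log_lt_iff_lt_pow (by omega) (by omega)]
  omega

theorem sum_range_pow_sub_one {M : Type*} [AddCommMonoid M] (hb : 2 ≤ b) (F : ℕ → M) (N : ℕ) :
    ∑ j ∈ Finset.range (b ^ N - 1), F j = ∑ n ∈ Finset.range N, ∑ j ∈ block b n, F j := by
  induction N with
  | zero => simp
  | succ N ih =>
    rw [Finset.sum_range_succ, ← ih, block, Finset.sum_range_add_sum_Ico]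
    exact Nat.sub_le_sub_right (Nat.pow_le_pow_right (by omega) (Nat.le_succ N)) 1

theorem sum_block {M : Type*} [AddCommMonoid M] (hb : 2 ≤ b) (F : ℕ → M) (n : ℕ) :
    ∑ j ∈ block b n, F j = ∑ r ∈ Finset.range (blockSize b n), F (b ^ n - 1 + r) := by
  have := pow_add_blockSize hb n
  have h : 0 < b ^ n := by positivity
  rw [block, Finset.sum_Ico_eq_sum_range]
  congr 2
  omega

/-- Cyclic shift by `k` within each block. -/
def blockRotation (b k j : ℕ) : ℕ :=
  b ^ blockIndex b j - 1 +
    (j + 1 - b ^ blockIndex b j + k) % blockSize b (blockIndex b j)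

theorem blockRotation_mem (hb : 2 ≤ b) (k j : ℕ) :
    blockRotation b k j ∈ block b (blockIndex b j) := by
  have h : 0 < b ^ blockIndex b j := by positivity
  have := Nat.mod_lt (j + 1 - b ^ blockIndex b j + k) (blockSize_pos hb (blockIndex b j))
  rw [mem_block_iff_le hb, blockRotation]
  omega

theorem blockRotation_lt_of_blockIndex_lt (hb : 2 ≤ b) {k i j : ℕ}
    (h : blockIndex b i < blockIndex b j) : blockRotation b k i < blockRotation b k j := by
  have h1 := (mem_block_iff hb).1 (blockRotation_mem hb k i)
  have h2 := (mem_block_iff hb).1 (blockRotation_mem hb k j)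
  by_contra! h3
  have := blockIndex_mono (b := b) h3
  omega

end Blocks

/-! ### Boundedness of averaging over blocks -/

namespace IsSubsymmetricWith

variable {𝕜 : Type*} [RCLike 𝕜]
variable {S : Type*} [NormedAddCommGroup S] [NormedSpace 𝕜 S]
variable {e : ℕ → S} {K : ℝ} {b : ℕ}

/-- The indices that do not wrap around inside their block, and those that do, form two sets on each
of which the shift is increasing, across blocks as well as within them. -/
theorem norm_sum_blockRotation_le (he : IsSubsymmetricWith 𝕜 e K) (hb : 2 ≤ b) (k : ℕ)
    (A : Finset ℕ) (a : ℕ → 𝕜) :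
    ‖∑ j ∈ A, a j • e (blockRotation b k j)‖ ≤ 2 * K ^ 2 * ‖∑ j ∈ A, a j • e j‖ := by
  have rot1 : ∀ j, j + 1 - b ^ blockIndex b j + k % blockSize b (blockIndex b j)
      < blockSize b (blockIndex b j) →
      blockRotation b k j = j + k % blockSize b (blockIndex b j) := by
    intro j hj
    have h := (mem_block_iff_le hb).1 (mem_block_blockIndex hb j)
    have h0 : 0 < b ^ blockIndex b j := by positivity
    rw [blockRotation, ← Nat.add_mod_mod, Nat.mod_eq_of_lt hj]
    omega
  have rot2 : ∀ j, ¬ j + 1 - b ^ blockIndex b j + k % blockSize b (blockIndex b j)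
      < blockSize b (blockIndex b j) →
      blockRotation b k j + blockSize b (blockIndex b j)
        = j + k % blockSize b (blockIndex b j) := by
    intro j hj
    have h := (mem_block_iff_le hb).1 (mem_block_blockIndex hb j)
    have h0 : 0 < b ^ blockIndex b j := by positivity
    have h1 := Nat.mod_lt k (blockSize_pos hb (blockIndex b j))
    rw [blockRotation, ← Nat.add_mod_mod, Nat.mod_eq_sub_mod (by omega),
      Nat.mod_eq_of_lt (by omega)]
    omega
  refine he.norm_sum_comp_le_of_strictMonoOn_filter A
    (fun j ↦ j + 1 - b ^ blockIndex b j + k % blockSize b (blockIndex b j)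
      < blockSize b (blockIndex b j)) (blockRotation b k) ?_ ?_ a
  · intro i hi j hj hij
    simp only [Finset.coe_filter, Set.mem_ofPred_eq] at hi hj
    rcases (blockIndex_mono (b := b) hij.le).lt_or_eq with h | h
    · exact blockRotation_lt_of_blockIndex_lt hb h
    · rw [rot1 i hi.2, rot1 j hj.2, h]
      omega
  · intro i hi j hj hij
    simp only [Finset.coe_filter, Set.mem_ofPred_eq] at hi hj
    rcases (blockIndex_mono (b := b) hij.le).lt_or_eq with h | h
    · exact blockRotation_lt_of_blockIndex_lt hb h
    · have h1 := rot2 i hi.2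
      have h2 := rot2 j hj.2
      rw [h] at h1
      omega

/-- Averaging is the mean of the simultaneous block rotations over as many shifts as the last block
involved has elements. This works because every smaller block size divides that number, so each
block is covered evenly. -/
theorem norm_sum_average_le (he : IsSubsymmetricWith 𝕜 e K) (hb : 2 ≤ b)
    (A : Finset ℕ) (a : ℕ → 𝕜) :
    ‖∑ j ∈ A, a j • ((blockSize b (blockIndex b j) : 𝕜)⁻¹ • ∑ i ∈ block b (blockIndex b j), e i)‖
      ≤ 2 * K ^ 2 * ‖∑ j ∈ A, a j • e j‖ := by
  set N := A.sup (blockIndex b) with hN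
  have hjN : ∀ j ∈ A, blockIndex b j ≤ N := fun j hj ↦ Finset.le_sup (f := blockIndex b) hj
  have hs : ∀ n, (blockSize b n : 𝕜) ≠ 0 := fun n ↦
    Nat.cast_ne_zero.2 (blockSize_pos hb n).ne'
  have sum : ∑ k ∈ Finset.range (blockSize b N), ∑ j ∈ A, a j • e (blockRotation b k j)
      = (blockSize b N : 𝕜) • ∑ j ∈ A, a j • ((blockSize b (blockIndex b j) : 𝕜)⁻¹ •
        ∑ i ∈ block b (blockIndex b j), e i) := by
    rw [Finset.sum_comm, Finset.smul_sum]
    refine Finset.sum_congr rfl fun j hj ↦ ?_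
    rw [← Finset.smul_sum, smul_comm (blockSize b N : 𝕜)]
    congr 1
    obtain ⟨q, hq⟩ : ∃ q, N = blockIndex b j + q := ⟨N - blockIndex b j, by have := hjN j hj; omega⟩
    rw [hq, blockSize_add]
    have := sum_range_mul_mod (fun r ↦ e (b ^ blockIndex b j - 1 + r))
      (blockSize b (blockIndex b j)) (b ^ q) (j + 1 - b ^ blockIndex b j) (blockSize_pos hb _)
    rw [← sum_block hb] at this
    rw [show ∑ k ∈ Finset.range (b ^ q * blockSize b (blockIndex b j)), e (blockRotation b k j)
      = _ from this, smul_smul, Nat.cast_mul, mul_assoc, mul_inv_cancel₀ (hs _), mul_one,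
      ← Nat.cast_smul_eq_nsmul 𝕜]
  have h := norm_sum_le_of_le (Finset.range (blockSize b N))
    (fun k _ ↦ he.norm_sum_blockRotation_le hb k A a)
  rw [sum, norm_smul, Finset.sum_const, Finset.card_range, nsmul_eq_mul] at h
  rw [RCLike.norm_natCast] at h
  exact le_of_mul_le_mul_left h (Nat.cast_pos.2 (blockSize_pos hb N))

end IsSubsymmetricWith

/-! ### The averaging projection -/

section Average

variable {𝕜 : Type*} [RCLike 𝕜]
variable {S : Type*} [NormedAddCommGroup S] [NormedSpace 𝕜 S]

/-- The averaging projection with respect to the blocks. -/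
theorem exists_average [CompleteSpace S] {e : SchauderBasis 𝕜 S} {K : ℝ} (he : IsSubsymmetricWith 𝕜 e.basis K)
    {b : ℕ} (hb : 2 ≤ b) : ∃ P : S →L[𝕜] S, ∀ j, P (e.basis j) =
      (blockSize b (blockIndex b j) : 𝕜)⁻¹ • ∑ i ∈ block b (blockIndex b j), e.basis i :=
  exists_clm_of_norm_sum_le e _ _ fun A a ↦ he.norm_sum_average_le hb A a

variable {e : SchauderBasis 𝕜 S} {b : ℕ} {P : S →L[𝕜] S}

theorem average_sum_block (hb : 2 ≤ b) (hP : ∀ j, P (e.basis j) =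
      (blockSize b (blockIndex b j) : 𝕜)⁻¹ • ∑ i ∈ block b (blockIndex b j), e.basis i) (n : ℕ) :
    P (∑ i ∈ block b n, e.basis i) = ∑ i ∈ block b n, e.basis i := by
  have hs : (blockSize b n : 𝕜) ≠ 0 := Nat.cast_ne_zero.2 (blockSize_pos hb n).ne'
  rw [map_sum, Finset.sum_congr rfl (g := fun _ ↦ (blockSize b n : 𝕜)⁻¹ •
    ∑ i ∈ block b n, e.basis i) (fun j hj ↦ by rw [hP, (mem_block_iff hb).1 hj]),
    Finset.sum_const, card_block hb, ← Nat.cast_smul_eq_nsmul 𝕜, smul_smul, mul_inv_cancel₀ hs,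
    one_smul]

theorem average_comp_self (hb : 2 ≤ b) (hP : ∀ j, P (e.basis j) =
      (blockSize b (blockIndex b j) : 𝕜)⁻¹ • ∑ i ∈ block b (blockIndex b j), e.basis i) (f : S) :
    P (P f) = P f := by
  have : P ∘L P = P := clm_ext_basis e fun j ↦ by
    rw [ContinuousLinearMap.comp_apply, hP, map_smul, average_sum_block hb hP]
  exact congrArg (fun T ↦ T f) this

theorem coord_average (hb : 2 ≤ b) (hP : ∀ j, P (e.basis j) =
      (blockSize b (blockIndex b j) : 𝕜)⁻¹ • ∑ i ∈ block b (blockIndex b j), e.basis i)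
    (f : S) (j : ℕ) : e.coord j (P f) = (blockSize b (blockIndex b j) : 𝕜)⁻¹ *
      ∑ i ∈ block b (blockIndex b j), e.coord i f := by
  have : e.coord j ∘L P = (blockSize b (blockIndex b j) : 𝕜)⁻¹ •
      ∑ i ∈ block b (blockIndex b j), e.coord i := clm_ext_basis e fun l ↦ by
    have h1 : e.coord j (∑ i ∈ block b (blockIndex b l), e.basis i)
        = if blockIndex b j = blockIndex b l then 1 else 0 := by
      simp only [← mem_block_iff hb]
      have := coord_sum_smul e (block b (blockIndex b l)) (fun _ ↦ 1) j
      simpa using this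
    have h2 : (∑ i ∈ block b (blockIndex b j), e.coord i) (e.basis l)
        = if blockIndex b l = blockIndex b j then 1 else 0 := by
      simp only [← mem_block_iff hb]
      simp [coord_basis]
    rw [ContinuousLinearMap.comp_apply, hP, map_smul, h1, smul_apply, h2]
    by_cases h : blockIndex b j = blockIndex b l
    · simp [h]
    · simp [h, Ne.symm h]
  have := congrArg (fun T ↦ T f) this
  simpa using this

end Average

/-! ### Nontrivial type and regularity of the fundamental function -/

section NontrivialType

/-- Type p bounds a mean over signs by C n^(1/p) M, and n^(1/p) = o(n) as p > 1. In effect, long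
families cannot behave like the unit vectors of ℓ₁. -/
theorem HasNontrivialType.exists_le_mul {S : Type*} [NormedAddCommGroup S]
    (hS : HasNontrivialType S) {δ : ℝ} (hδ : 0 < δ) :
    ∃ n₀ : ℕ, 1 ≤ n₀ ∧ ∀ n, n₀ ≤ n → ∀ (x : Fin n → S) (D M : ℝ),
      (∀ ε : Fin n → ℤˣ, D ≤ ‖∑ i, (ε i : ℤ) • x i‖) → (∀ i, ‖x i‖ ≤ M) → D ≤ δ * n * M := by
  obtain ⟨p, hp1, -, C, hC⟩ := hS
  have hp0 : 0 < p := by linarith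
  have hexp : 0 < 1 - 1 / p := by
    rw [sub_pos, div_lt_one hp0]; exact hp1
  have hlim : Tendsto (fun n : ℕ ↦ |C| * (n : ℝ) ^ (-(1 - 1 / p))) atTop (𝓝 (|C| * 0)) :=
    ((tendsto_rpow_neg_atTop hexp).comp tendsto_natCast_atTop_atTop).const_mul _
  rw [mul_zero] at hlim
  obtain ⟨n₁, hn₁⟩ := eventually_atTop.1 (hlim.eventually (gt_mem_nhds hδ))
  refine ⟨max n₁ 1, le_max_right _ _, fun n hn x D M hD hM ↦ ?_⟩
  have hn1 : 1 ≤ n := (le_max_right _ _).trans hn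
  have hn0 : (0 : ℝ) < n := by exact_mod_cast hn1
  have hM0 : 0 ≤ M := (norm_nonneg _).trans (hM ⟨0, hn1⟩)
  rcases lt_or_ge D 0 with hD0 | hD0
  · exact hD0.le.trans (by positivity)
  have h1 := hC n x
  have h2 : D ≤ ((2 ^ n : ℝ)⁻¹ * ∑ ε : Fin n → ℤˣ, ‖∑ i, (ε i : ℤ) • x i‖ ^ p) ^ (1 / p) := by
    have h3 : D ^ p ≤ (2 ^ n : ℝ)⁻¹ * ∑ ε : Fin n → ℤˣ, ‖∑ i, (ε i : ℤ) • x i‖ ^ p := by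
      have h4 : ∑ ε : Fin n → ℤˣ, D ^ p ≤ ∑ ε : Fin n → ℤˣ, ‖∑ i, (ε i : ℤ) • x i‖ ^ p :=
        Finset.sum_le_sum fun ε _ ↦ Real.rpow_le_rpow hD0 (hD ε) hp0.le
      rw [Finset.sum_const, Finset.card_univ, Fintype.card_fun, Fintype.card_units_int,
        Fintype.card_fin, nsmul_eq_mul] at h4
      push_cast at h4
      rw [le_inv_mul_iff₀ (by positivity)]
      exact h4
    calc D = (D ^ p) ^ (1 / p) := by
          rw [← Real.rpow_mul hD0, mul_one_div_cancel hp0.ne', Real.rpow_one]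
      _ ≤ _ := Real.rpow_le_rpow (by positivity) h3 (by positivity)
  have h3 : (∑ i, ‖x i‖ ^ p) ^ (1 / p) ≤ (n : ℝ) ^ (1 / p) * M := by
    have h4 : ∑ i, ‖x i‖ ^ p ≤ n * M ^ p := by
      refine (Finset.sum_le_sum (g := fun _ ↦ M ^ p) fun i _ ↦
        Real.rpow_le_rpow (norm_nonneg _) (hM i) hp0.le).trans (le_of_eq ?_)
      simp
    calc (∑ i, ‖x i‖ ^ p) ^ (1 / p) ≤ (n * M ^ p) ^ (1 / p) :=
          Real.rpow_le_rpow (Finset.sum_nonneg fun i _ ↦ by positivity) h4 (by positivity)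
      _ = _ := by
          rw [Real.mul_rpow (by positivity) (by positivity), ← Real.rpow_mul hM0,
            mul_one_div_cancel hp0.ne', Real.rpow_one]
  have h4 : |C| * (n : ℝ) ^ (1 / p) ≤ δ * n := by
    have h5 := (hn₁ n ((le_max_left _ _).trans hn)).le
    calc |C| * (n : ℝ) ^ (1 / p) = |C| * (n : ℝ) ^ (-(1 - 1 / p)) * n := by
          rw [mul_assoc, ← Real.rpow_add_one hn0.ne']
          congr 2; ring
      _ ≤ _ := by gcongr
  calc D ≤ _ := h2
    _ ≤ C * (∑ i, ‖x i‖ ^ p) ^ (1 / p) := h1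
    _ ≤ |C| * ((n : ℝ) ^ (1 / p) * M) := by
      refine mul_le_mul (le_abs_self C) h3 ?_ (abs_nonneg _)
      exact Real.rpow_nonneg (Finset.sum_nonneg fun i _ ↦ by positivity) _
    _ = |C| * (n : ℝ) ^ (1 / p) * M := by ring
    _ ≤ _ := by gcongr

end NontrivialType

namespace IsSubsymmetricWith

variable {𝕜 : Type*} [RCLike 𝕜]
variable {S : Type*} [NormedAddCommGroup S] [NormedSpace 𝕜 S]
variable {e : ℕ → S} {K : ℝ}

theorem sum_range_mul_div {M : Type*} [AddCommMonoid M] (n m : ℕ) (F : ℕ → ℕ → M) :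
    ∑ j ∈ Finset.range (n * m), F (j / m) j
      = ∑ i ∈ Finset.range n, ∑ j ∈ Finset.range m, F i (i * m + j) := by
  induction n with
  | zero => simp
  | succ n ih =>
    rw [Nat.succ_mul, Finset.sum_range_add, ih, Finset.sum_range_succ]
    congr 1
    refine Finset.sum_congr rfl fun j hj ↦ ?_
    rw [Finset.mem_range] at hj
    rw [show (n * m + j) / m = n by
      rw [Nat.mul_comm, Nat.mul_add_div (by omega), Nat.div_eq_of_lt hj, add_zero]]

/-- Apply the type estimate to b consecutive sums of m basis vectors. By unconditionality every
choice of signs yields a norm at least Λ(bm)/K, while each summand has norm at most KΛ(m). -/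
theorem exists_initialNorm_mul_le (he : IsSubsymmetricWith 𝕜 e K) (hS : HasNontrivialType S) :
    ∃ n₀ : ℕ, ∀ b, n₀ ≤ b → ∀ m, initialNorm e (b * m) ≤ b / 2 * initialNorm e m := by
  have hK := he.pos
  obtain ⟨n₀, -, hn⟩ := hS.exists_le_mul (δ := 1 / (2 * K ^ 2)) (by positivity)
  refine ⟨n₀, fun b hb m ↦ ?_⟩
  have h := hn b hb (fun i ↦ ∑ j ∈ Finset.range m, e (i * m + j)) (initialNorm e (b * m) / K)
    (K * initialNorm e m) ?_ ?_
  · rw [div_le_iff₀ hK] at h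
    refine h.trans (le_of_eq ?_)
    field_simp
  · intro ε
    -- The value 1 beyond b only keeps all moduli equal to 1; those indices do not occur in the
    -- sums.
    let ε' : ℕ → 𝕜 := fun i ↦ if h : i < b then ((ε ⟨i, h⟩ : ℤ) : 𝕜) else 1
    have hε : ∀ i, ‖ε' i‖ = 1 := by
      intro i
      by_cases h : i < b
      · rcases Int.units_eq_one_or (ε ⟨i, h⟩) with h' | h' <;> simp [ε', h, h']
      · simp [ε', h]
    have key : ∑ i : Fin b, (ε i : ℤ) • ∑ j ∈ Finset.range m, e (i * m + j)
        = ∑ j ∈ Finset.range (b * m), ε' (j / m) • e j := by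
      rw [sum_range_mul_div b m (fun i j ↦ ε' i • e j), ← Fin.sum_univ_eq_sum_range
        (fun i ↦ ∑ j ∈ Finset.range m, ε' i • e (i * m + j))]
      refine Finset.sum_congr rfl fun i _ ↦ ?_
      rw [← Finset.smul_sum, ← Int.cast_smul_eq_zsmul 𝕜]
      simp [ε']
    rw [key, div_le_iff₀ hK]
    have := he.norm_sum_le (Finset.range (b * m)) (fun _ ↦ 1) (fun j ↦ ε' (j / m))
      (fun j _ ↦ by rw [hε]; simp)
    simp only [one_smul] at this
    exact this.trans_eq (mul_comm _ _)
  · intro i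
    have := he.norm_sum_indicator_le ((Finset.range m).image fun j ↦ i * m + j)
    rw [Finset.card_image_of_injective _ (fun _ _ h ↦ by simpa using h), Finset.card_range,
      Finset.sum_image (fun _ _ _ _ h ↦ by simpa using h)] at this
    exact this

/-- If Λ(bm) < 2Λ(m) with b ≥ 2^n, take n Rademacher-type vectors on 2^n consecutive groups of m
indices. Each has norm at most 2K²Λ(m), but every signed sum of them has coefficient n on a whole
group and so norm at least nΛ(m)/K². Type forbids this for large n. -/
theorem exists_two_mul_initialNorm_le (he : IsSubsymmetricWith 𝕜 e K) (hS : HasNontrivialType S) :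
    ∃ n₀ : ℕ, ∀ b, n₀ ≤ b → ∀ m, 2 * initialNorm e m ≤ initialNorm e (b * m) := by
  have hK := he.pos
  obtain ⟨n, hn1, hn⟩ := hS.exists_le_mul (δ := 1 / (4 * K ^ 4)) (by positivity)
  refine ⟨2 ^ n, fun b hb m ↦ ?_⟩
  by_contra! hlt
  have hm : 1 ≤ m := by
    by_contra! h
    obtain rfl : m = 0 := by omega
    simp [initialNorm] at hlt
  have hΛ := he.initialNorm_pos hm
  have hcard : Fintype.card (Fin n → ℤˣ) = 2 ^ n := by
    rw [Fintype.card_fun, Fintype.card_units_int, Fintype.card_fin]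
  -- `E` numbers the sign patterns, and s l i is the i-th sign of pattern l, used on group l.
  let E : (Fin n → ℤˣ) ≃ Fin (2 ^ n) := Fintype.equivFinOfCardEq hcard
  let s : ℕ → Fin n → 𝕜 := fun l i ↦
    if h : l < 2 ^ n then ((E.symm ⟨l, h⟩ i : ℤ) : 𝕜) else 1
  have hs : ∀ l i, ‖s l i‖ = 1 := by
    intro l i
    by_cases h : l < 2 ^ n
    · rcases Int.units_eq_one_or (E.symm ⟨l, h⟩ i) with h' | h' <;> simp [s, h, h']
    · simp [s, h]
  have h := hn n le_rfl
    (fun i ↦ ∑ j ∈ Finset.range (2 ^ n * m), s (j / m) i • e j)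
    (n * initialNorm e m / K ^ 2) (2 * K ^ 2 * initialNorm e m) ?_ ?_
  · rw [div_le_iff₀ (by positivity)] at h
    have hn0 : (0 : ℝ) < n := by exact_mod_cast hn1
    have h' : 1 / (4 * K ^ 4) * n * (2 * K ^ 2 * initialNorm e m) * K ^ 2
        = n * initialNorm e m / 2 := by
      field_simp; ring
    rw [h'] at h
    have : 0 < n * initialNorm e m := by positivity
    linarith
  · intro θ
    have key : ∑ i, (θ i : ℤ) • ∑ j ∈ Finset.range (2 ^ n * m), s (j / m) i • e j
        = ∑ j ∈ Finset.range (2 ^ n * m), (∑ i, ((θ i : ℤ) : 𝕜) * s (j / m) i) • e j := by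
      simp only [Finset.sum_smul, Finset.smul_sum, ← Int.cast_smul_eq_zsmul 𝕜, smul_smul]
      rw [Finset.sum_comm]
    -- On the group whose pattern is θ itself, all n products of signs are 1.
    have hB : ∀ j ∈ (Finset.range m).image (fun j ↦ (E θ : ℕ) * m + j),
        ∑ i, ((θ i : ℤ) : 𝕜) * s (j / m) i = n := by
      intro j hj
      obtain ⟨r, hr, rfl⟩ := Finset.mem_image.1 hj
      rw [Finset.mem_range] at hr
      have e1 : ((E θ : ℕ) * m + r) / m = E θ := by
        rw [Nat.mul_comm, Nat.mul_add_div (by omega), Nat.div_eq_of_lt hr, add_zero]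
      have e2 : ∀ i, s (E θ : ℕ) i = ((θ i : ℤ) : 𝕜) := fun i ↦ by
        simp [s]
      have e3 : ∀ i, ((θ i : ℤ) : 𝕜) * ((θ i : ℤ) : 𝕜) = 1 := fun i ↦ by
        rcases Int.units_eq_one_or (θ i) with h' | h' <;> simp [h']
      simp [e1, e2, e3]
    have hsub : (Finset.range m).image (fun j ↦ (E θ : ℕ) * m + j) ⊆ Finset.range (2 ^ n * m) := by
      intro j hj
      obtain ⟨r, hr, rfl⟩ := Finset.mem_image.1 hj
      rw [Finset.mem_range] at hr ⊢
      calc (E θ : ℕ) * m + r < (E θ : ℕ) * m + m := by omega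
        _ = (E θ + 1) * m := by ring
        _ ≤ _ := Nat.mul_le_mul_right _ (E θ).2
    have k1 := he.norm_sum_subset_le hsub (fun j ↦ ∑ i, ((θ i : ℤ) : 𝕜) * s (j / m) i)
    rw [Finset.sum_congr rfl (fun j hj ↦ by rw [hB j hj]), ← Finset.smul_sum, norm_smul,
      RCLike.norm_natCast] at k1
    have k2 := he.initialNorm_card_le ((Finset.range m).image (fun j ↦ (E θ : ℕ) * m + j))
    rw [Finset.card_image_of_injective _ (fun _ _ h ↦ by simpa using h), Finset.card_range] at k2
    rw [key, div_le_iff₀ (by positivity)]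
    calc n * initialNorm e m ≤ n * (K * ‖∑ j ∈ (Finset.range m).image
          (fun j ↦ (E θ : ℕ) * m + j), e j‖) := by gcongr
      _ = K * (n * ‖∑ j ∈ (Finset.range m).image (fun j ↦ (E θ : ℕ) * m + j), e j‖) := by ring
      _ ≤ K * _ := mul_le_mul_of_nonneg_left k1 hK.le
      _ = _ := by ring
  · intro i
    have h1 := he.norm_sum_le (Finset.range (2 ^ n * m)) (fun j ↦ s (j / m) i) (fun _ ↦ 1)
      (fun j _ ↦ by rw [hs]; simp)
    simp only [one_smul] at h1
    have h2 : initialNorm e (2 ^ n * m) ≤ K * initialNorm e (b * m) :=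
      he.initialNorm_mono (Nat.mul_le_mul_right _ hb)
    calc _ ≤ _ := h1
      _ ≤ K * (K * (2 * initialNorm e m)) := by
        gcongr
        exact h2.trans (by gcongr)
      _ = _ := by ring

/-- The only place where nontrivial type is needed. The left inequality makes sums of Λ over block
sizes comparable with the last term; the right one makes the weights of the blocks decrease. -/
theorem exists_regular (he : IsSubsymmetricWith 𝕜 e K) (hS : HasNontrivialType S) :
    ∃ b : ℕ, 2 ≤ b ∧ ∀ m, 2 * initialNorm e m ≤ initialNorm e (b * m) ∧
      initialNorm e (b * m) ≤ b / 2 * initialNorm e m := by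
  obtain ⟨n₁, h₁⟩ := he.exists_two_mul_initialNorm_le hS
  obtain ⟨n₂, h₂⟩ := he.exists_initialNorm_mul_le hS
  exact ⟨max 2 (max n₁ n₂), le_max_left _ _, fun m ↦
    ⟨h₁ _ ((le_max_left _ _).trans (le_max_right _ _)) m,
      h₂ _ ((le_max_right _ _).trans (le_max_right _ _)) m⟩⟩

end IsSubsymmetricWith

namespace IsSubsymmetricWith

variable {𝕜 : Type*} [RCLike 𝕜]
variable {S : Type*} [NormedAddCommGroup S] [NormedSpace 𝕜 S]

theorem norm_proj_le {e : SchauderBasis 𝕜 S} {K : ℝ} (he : IsSubsymmetricWith 𝕜 e.basis K)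
    (A : Finset ℕ) (f : S) : ‖∑ j ∈ A, e.coord j f • e.basis j‖ ≤ K * ‖f‖ := by
  refine ge_of_tendsto ((tendsto_sum_range e f).norm.const_mul K) ?_
  filter_upwards [eventually_gt_atTop (A.sup id)] with N hN
  refine he.norm_sum_subset_le (fun j hj ↦ ?_) _
  rw [Finset.mem_range]
  exact (Finset.le_sup (f := id) hj).trans_lt hN

end IsSubsymmetricWith

/-! ### The averaging construction: biorthogonality and two-sided bounds by Λ -/

/-- The data of the construction of Dilworth, Kalton and Kutzarova: a subsymmetric basis `e` whose
fundamental function is regular with respect to the factor `b`, the averaging projection `P`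
on the blocks, a space `Q` isomorphic to its kernel, and a normalized basis `z` of a space `Z`. -/
structure AveragingData (𝕜 S Q Z : Type*) [RCLike 𝕜]
    [NormedAddCommGroup S] [NormedSpace 𝕜 S] [NormedAddCommGroup Q] [NormedSpace 𝕜 Q]
    [NormedAddCommGroup Z] [NormedSpace 𝕜 Z] where
  e : SchauderBasis 𝕜 S
  K : ℝ
  he : IsSubsymmetricWith 𝕜 e.basis K
  b : ℕ
  hb : 2 ≤ b
  two_mul_le : ∀ m, 2 * initialNorm e.basis m ≤ initialNorm e.basis (b * m)
  mul_le : ∀ m, initialNorm e.basis (b * m) ≤ b / 2 * initialNorm e.basis m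
  P : S →L[𝕜] S
  hP : ∀ j, P (e.basis j) =
    (blockSize b (blockIndex b j) : 𝕜)⁻¹ • ∑ i ∈ block b (blockIndex b j), e.basis i
  ι : Q →L[𝕜] S
  π : S →L[𝕜] Q
  π_ι : ∀ q, π (ι q) = q
  ι_π : ∀ f, ι (π f) = f - P f
  z : SchauderBasis 𝕜 Z
  norm_z : ∀ n, ‖z.basis n‖ = 1
  D : ℝ
  norm_sum_z_le : ∀ N x, ‖∑ n ∈ Finset.range N, z.coord n x • z.basis n‖ ≤ D * ‖x‖
  norm_coord_z_le : ∀ n x, ‖z.coord n x‖ ≤ D * ‖x‖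

namespace AveragingData

variable {𝕜 S Q Z : Type*} [RCLike 𝕜]
  [NormedAddCommGroup S] [NormedSpace 𝕜 S] [NormedAddCommGroup Q] [NormedSpace 𝕜 Q]
  [NormedAddCommGroup Z] [NormedSpace 𝕜 Z] (d : AveragingData 𝕜 S Q Z)

/-- The fundamental function at the size of the `n`-th block. -/
def lam (n : ℕ) : ℝ := initialNorm d.e.basis (blockSize d.b n)

/-- The weight of an element of the `n`-th block. -/
def weight (n : ℕ) : ℝ := d.lam n / blockSize d.b n

theorem D_nonneg : 0 ≤ d.D := by
  have h := d.norm_coord_z_le 0 (d.z.basis 0)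
  rw [d.norm_z, mul_one] at h
  exact (norm_nonneg _).trans h

theorem lam_pos (n : ℕ) : 0 < d.lam n := d.he.initialNorm_pos (blockSize_pos d.hb n)

theorem blockSize_cast_pos (n : ℕ) : (0 : ℝ) < blockSize d.b n :=
  Nat.cast_pos.2 (blockSize_pos d.hb n)

theorem weight_pos (n : ℕ) : 0 < d.weight n := div_pos (d.lam_pos n) (d.blockSize_cast_pos n)

theorem lam_succ (n : ℕ) : d.lam (n + 1) = initialNorm d.e.basis (d.b * blockSize d.b n) := by
  rw [lam, blockSize_add, pow_one]

theorem two_mul_lam_le (n : ℕ) : 2 * d.lam n ≤ d.lam (n + 1) := by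
  rw [lam_succ]; exact d.two_mul_le _

theorem lam_mono : Monotone d.lam := monotone_nat_of_le_succ fun n ↦ by
  linarith [d.two_mul_lam_le n, d.lam_pos n]

theorem weight_antitone : Antitone d.weight := antitone_nat_of_succ_le fun n ↦ by
  have h := d.mul_le (blockSize d.b n)
  rw [← lam_succ] at h
  have hs := d.blockSize_cast_pos n
  have hb : (0 : ℝ) < d.b := Nat.cast_pos.2 (by have := d.hb; omega)
  have hl := d.lam_pos n
  rw [weight, weight, div_le_div_iff₀ (d.blockSize_cast_pos _) hs, blockSize_add, pow_one,
    Nat.cast_mul]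
  change d.lam (n + 1) ≤ d.b / 2 * d.lam n at h
  calc d.lam (n + 1) * blockSize d.b n ≤ d.b / 2 * d.lam n * blockSize d.b n := by gcongr
    _ = (d.lam n * (d.b * blockSize d.b n)) / 2 := by ring
    _ ≤ _ := by
      have : 0 ≤ d.lam n * (d.b * blockSize d.b n) := by positivity
      linarith

theorem sum_lam_le (N : ℕ) : ∑ n ∈ Finset.range N, d.lam n ≤ d.lam N := by
  induction N with
  | zero => simpa using (d.lam_pos 0).le
  | succ N ih =>
    rw [Finset.sum_range_succ]
    linarith [d.two_mul_lam_le N]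

/-- Block number log_b k has size comparable with k, so Λ(k) is interchangeable with `lam` there, up
to constants; this is one direction. -/
theorem lam_log_le {k : ℕ} (hk : 1 ≤ k) :
    d.lam (Nat.log d.b k) ≤ d.K * d.b / 2 * initialNorm d.e.basis k := by
  have h1 : blockSize d.b (Nat.log d.b k) ≤ d.b * k :=
    Nat.mul_le_mul (Nat.sub_le _ _) (Nat.pow_log_le_self _ (by omega))
  have hK := d.he.pos
  calc _ ≤ _ := d.he.initialNorm_mono h1
    _ ≤ d.K * (d.b / 2 * initialNorm d.e.basis k) := by gcongr; exact d.mul_le k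
    _ = _ := by ring

theorem pow_le_blockSize (n : ℕ) : d.b ^ n ≤ blockSize d.b n :=
  Nat.le_mul_of_pos_left _ (by have := d.hb; omega)

theorem initialNorm_le_lam_log {k : ℕ} :
    initialNorm d.e.basis k ≤ d.K ^ 2 * d.b / 2 * d.lam (Nat.log d.b k) := by
  have h1 : k ≤ d.b * blockSize d.b (Nat.log d.b k) := by
    have h2 := Nat.lt_pow_succ_log_self (b := d.b) (by have := d.hb; omega) k
    have h3 := Nat.mul_le_mul_left d.b (d.pow_le_blockSize (Nat.log d.b k))
    rw [Nat.succ_eq_add_one, pow_succ] at h2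
    linarith
  have hK := d.he.pos
  have hK1 := d.he.one_le
  calc _ ≤ _ := d.he.initialNorm_mono h1
    _ ≤ d.K * (d.b / 2 * d.lam (Nat.log d.b k)) := by gcongr; exact d.mul_le _
    _ = d.K * d.b / 2 * d.lam (Nat.log d.b k) := by ring
    _ ≤ _ := by
      have := (d.lam_pos (Nat.log d.b k)).le
      gcongr
      nlinarith

theorem weight_log_mul_le {k : ℕ} (hk : 1 ≤ k) :
    d.weight (Nat.log d.b k) * k ≤ d.b * (d.K * d.b / 2 * initialNorm d.e.basis k) := by
  have h1 : (k : ℝ) ≤ d.b * blockSize d.b (Nat.log d.b k) := by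
    have h2 := Nat.lt_pow_succ_log_self (b := d.b) (by have := d.hb; omega) k
    have h3 := Nat.mul_le_mul_left d.b (d.pow_le_blockSize (Nat.log d.b k))
    rw [Nat.succ_eq_add_one, pow_succ] at h2
    exact_mod_cast (by linarith : k ≤ d.b * blockSize d.b (Nat.log d.b k))
  have hw := (d.weight_pos (Nat.log d.b k)).le
  calc _ ≤ d.weight (Nat.log d.b k) * (d.b * blockSize d.b (Nat.log d.b k)) := by gcongr
    _ = d.b * d.lam (Nat.log d.b k) := by
      rw [weight]; field_simp [(d.blockSize_cast_pos (Nat.log d.b k)).ne']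
    _ ≤ _ := by gcongr; exact d.lam_log_le hk

/-- The vectors of the basis of `Q × Z`. -/
def vec (j : ℕ) : Q × Z :=
  (d.π (d.e.basis j), (d.weight (blockIndex d.b j) : 𝕜) • d.z.basis (blockIndex d.b j))

/-- The coordinate functionals of the basis of `Q × Z`. -/
def coord (j : ℕ) : StrongDual 𝕜 (Q × Z) :=
  (d.e.coord j ∘L d.ι) ∘L ContinuousLinearMap.fst 𝕜 Q Z +
    ((d.lam (blockIndex d.b j) : 𝕜)⁻¹ • d.z.coord (blockIndex d.b j)) ∘L
      ContinuousLinearMap.snd 𝕜 Q Z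

theorem coord_apply (j : ℕ) (h : Q × Z) : d.coord j h = d.e.coord j (d.ι h.1) +
    (d.lam (blockIndex d.b j) : 𝕜)⁻¹ * d.z.coord (blockIndex d.b j) h.2 := by
  simp [coord]

theorem P_ι (q : Q) : d.P (d.ι q) = 0 := by
  have h := d.ι_π (d.ι q)
  rw [d.π_ι] at h
  exact sub_eq_self.1 h.symm

/-- Vectors in the kernel of the averaging projection have mean zero on every block. -/
theorem sum_block_coord_ι (q : Q) (n : ℕ) : ∑ i ∈ block d.b n, d.e.coord i (d.ι q) = 0 := by
  have hn : blockIndex d.b (d.b ^ n - 1) = n := by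
    have hp : 0 < d.b ^ n := by have := d.hb; positivity
    have := blockSize_pos d.hb n
    rw [← mem_block_iff d.hb, mem_block_iff_le d.hb]
    omega
  have h := coord_average d.hb d.hP (d.ι q) (d.b ^ n - 1)
  rw [d.P_ι, map_zero, hn] at h
  have hs : (blockSize d.b n : 𝕜) ≠ 0 := Nat.cast_ne_zero.2 (blockSize_pos d.hb n).ne'
  exact (mul_eq_zero.1 h.symm).resolve_left (inv_ne_zero hs)

theorem π_sum_block (n : ℕ) : d.π (∑ i ∈ block d.b n, d.e.basis i) = 0 := by
  have h := d.ι_π (∑ i ∈ block d.b n, d.e.basis i)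
  rw [average_sum_block d.hb d.hP, sub_self] at h
  rw [← d.π_ι (d.π (∑ i ∈ block d.b n, d.e.basis i)), h, map_zero]

theorem lam_cast_ne_zero (n : ℕ) : (d.lam n : 𝕜) ≠ 0 :=
  RCLike.ofReal_ne_zero.2 (d.lam_pos n).ne'

theorem coord_vec (i j : ℕ) : d.coord i (d.vec j) = if i = j then 1 else 0 := by
  have hs : ∀ n, (blockSize d.b n : 𝕜) ≠ 0 := fun n ↦
    Nat.cast_ne_zero.2 (blockSize_pos d.hb n).ne'
  have h1 : d.e.coord i (∑ l ∈ block d.b (blockIndex d.b j), d.e.basis l)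
      = if blockIndex d.b i = blockIndex d.b j then 1 else 0 := by
    simp only [← mem_block_iff d.hb]
    have := coord_sum_smul d.e (block d.b (blockIndex d.b j)) (fun _ ↦ 1) i
    simpa using this
  rw [coord_apply, vec, d.ι_π, map_sub, d.hP, map_smul, map_smul, h1, coord_basis, coord_basis]
  by_cases h : blockIndex d.b i = blockIndex d.b j
  · have hl := d.lam_cast_ne_zero (blockIndex d.b j)
    have := hs (blockIndex d.b j)
    simp only [h, if_true, smul_eq_mul, mul_one, weight]
    push_cast
    field_simp
    ring
  · have h' : i ≠ j := fun hij ↦ h (by rw [hij])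
    simp [h, h']

/-- In Z a crude triangle inequality is enough: the weights are chosen so that it already gives the
right order, independently of the basis z. -/
theorem norm_sum_vec_le (A : Finset ℕ) (a : ℕ → 𝕜) : ‖∑ j ∈ A, a j • d.vec j‖ ≤
    ‖d.π‖ * ‖∑ j ∈ A, a j • d.e.basis j‖ + ∑ j ∈ A, d.weight (blockIndex d.b j) * ‖a j‖ := by
  have h1 : (∑ j ∈ A, a j • d.vec j).1 = d.π (∑ j ∈ A, a j • d.e.basis j) := by
    simp [Prod.fst_sum, vec]
  have h2 : ‖(∑ j ∈ A, a j • d.vec j).2‖ ≤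
      ∑ j ∈ A, d.weight (blockIndex d.b j) * ‖a j‖ := by
    rw [Prod.snd_sum]
    refine norm_sum_le_of_le _ fun j _ ↦ ?_
    simp only [vec, Prod.smul_snd, norm_smul, d.norm_z, RCLike.norm_ofReal,
      abs_of_pos (d.weight_pos _), mul_one]
    rw [mul_comm]
  have h3 := d.π.le_opNorm (∑ j ∈ A, a j • d.e.basis j)
  rw [← h1] at h3
  have h4 : 0 ≤ ∑ j ∈ A, d.weight (blockIndex d.b j) * ‖a j‖ :=
    Finset.sum_nonneg fun j _ ↦ mul_nonneg (d.weight_pos _).le (norm_nonneg _)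
  have h5 : 0 ≤ ‖d.π‖ * ‖∑ j ∈ A, a j • d.e.basis j‖ := by positivity
  rw [Prod.norm_def]
  exact max_le (by linarith) (by linarith)

/-- Split at block N = log_b k. The blocks before N contribute the sum of `lam n` for n < N, at most
`lam N`; the rest has at most k weights, each at most `weight N`. Both are of order Λ(k). -/
theorem sum_weight_le {A : Finset ℕ} {k : ℕ} (hk : 1 ≤ k) (hA : A.card ≤ k) :
    ∑ j ∈ A, d.weight (blockIndex d.b j) ≤
      (1 + d.b) * (d.K * d.b / 2) * initialNorm d.e.basis k := by
  set N := Nat.log d.b k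
  rw [← Finset.sum_filter_add_sum_filter_not A (fun j ↦ blockIndex d.b j < N)]
  have h1 : ∑ j ∈ A with blockIndex d.b j < N, d.weight (blockIndex d.b j)
      ≤ d.K * d.b / 2 * initialNorm d.e.basis k := by
    calc _ ≤ ∑ j ∈ Finset.range (d.b ^ N - 1), d.weight (blockIndex d.b j) := by
          refine Finset.sum_le_sum_of_subset_of_nonneg (fun j hj ↦ ?_)
            (fun j _ _ ↦ (d.weight_pos _).le)
          rw [Finset.mem_range, ← blockIndex_lt_iff d.hb]
          exact (Finset.mem_filter.1 hj).2
      _ = ∑ n ∈ Finset.range N, d.lam n := by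
          rw [sum_range_pow_sub_one d.hb]
          refine Finset.sum_congr rfl fun n _ ↦ ?_
          rw [Finset.sum_congr rfl (g := fun _ ↦ d.weight n)
            (fun j hj ↦ by rw [(mem_block_iff d.hb).1 hj]), Finset.sum_const, card_block d.hb,
            nsmul_eq_mul, weight, mul_div_cancel₀ _ (d.blockSize_cast_pos n).ne']
      _ ≤ _ := (d.sum_lam_le N).trans (d.lam_log_le hk)
  have h2 : ∑ j ∈ A with ¬ blockIndex d.b j < N, d.weight (blockIndex d.b j)
      ≤ d.b * (d.K * d.b / 2 * initialNorm d.e.basis k) := by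
    refine le_trans ?_ (d.weight_log_mul_le hk)
    refine (Finset.sum_le_card_nsmul _ _ (d.weight N) fun j hj ↦ ?_).trans ?_
    · exact d.weight_antitone (not_lt.1 (Finset.mem_filter.1 hj).2)
    · rw [nsmul_eq_mul, mul_comm]
      have := (d.weight_pos N).le
      have h3 : ((A.filter fun j ↦ ¬ blockIndex d.b j < N).card : ℝ) ≤ k :=
        Nat.cast_le.2 ((Finset.card_filter_le _ _).trans hA)
      gcongr
  linarith

theorem exists_norm_sum_vec_le_initialNorm : ∃ C : ℝ, 0 ≤ C ∧ ∀ (A : Finset ℕ) (k : ℕ)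
    (a : ℕ → 𝕜) (t : ℝ), 1 ≤ k → A.card ≤ k → 0 ≤ t → (∀ j ∈ A, ‖a j‖ ≤ t) →
    ‖∑ j ∈ A, a j • d.vec j‖ ≤ C * t * initialNorm d.e.basis k := by
  have hK := d.he.pos
  refine ⟨‖d.π‖ * d.K ^ 3 + (1 + d.b) * (d.K * d.b / 2), by positivity,
    fun A k a t hk hA ht ha ↦ ?_⟩
  have h1 := d.he.norm_sum_le_initialNorm hA ht ha
  have h2 := d.sum_weight_le hk hA
  have h3 : ∑ j ∈ A, d.weight (blockIndex d.b j) * ‖a j‖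
      ≤ (∑ j ∈ A, d.weight (blockIndex d.b j)) * t := by
    rw [Finset.sum_mul]
    refine Finset.sum_le_sum fun j hj ↦ ?_
    have := (d.weight_pos (blockIndex d.b j)).le
    gcongr
    exact ha j hj
  calc _ ≤ _ := d.norm_sum_vec_le A a
    _ ≤ ‖d.π‖ * (d.K ^ 3 * t * initialNorm d.e.basis k) +
        (1 + d.b) * (d.K * d.b / 2) * initialNorm d.e.basis k * t := by
      gcongr
      exact h3.trans (by gcongr)
    _ = _ := by ring

theorem norm_ι_le (h : Q × Z) : ‖d.ι h.1‖ ≤ ‖d.ι‖ * ‖h‖ :=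
  (d.ι.le_opNorm _).trans (by gcongr; exact norm_fst_le h)

theorem norm_coord_z_snd_le (n : ℕ) (h : Q × Z) : ‖d.z.coord n h.2‖ ≤ d.D * ‖h‖ :=
  (d.norm_coord_z_le n h.2).trans
    (mul_le_mul_of_nonneg_left (norm_snd_le h) d.D_nonneg)

/-- A coordinate of size t has its S part or its Z part at least t / 2. If the first happens for
half of B, unconditionality in S concludes. Otherwise an index far enough out has a large Z part,
and a single coordinate functional of z, amplified by `lam`, suffices. -/
theorem exists_initialNorm_le_norm : ∃ C : ℝ, 0 ≤ C ∧ ∀ (h : Q × Z) (B : Finset ℕ) (k : ℕ) (t : ℝ),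
    k ≤ B.card → 0 ≤ t → (∀ j ∈ B, t ≤ ‖d.coord j h‖) →
    t * initialNorm d.e.basis k ≤ C * ‖h‖ := by
  have hK := d.he.pos
  have hD := d.D_nonneg
  refine ⟨d.K ^ 2 * d.b / 2 * (2 * d.K ^ 4 * ‖d.ι‖ + d.K ^ 2 * d.b / 2 * (2 * d.D)),
    by positivity, fun h B k t hB ht hBt ↦ ?_⟩
  set l := (k + 1) / 2 with hl
  have hkl : initialNorm d.e.basis k ≤ d.K ^ 2 * d.b / 2 * initialNorm d.e.basis l := by
    have h1 : k ≤ 2 * l := by omega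
    have h2 : 2 * l ≤ d.b * l := Nat.mul_le_mul_right _ d.hb
    calc _ ≤ _ := d.he.initialNorm_mono h1
      _ ≤ d.K * (d.K * (d.b / 2 * initialNorm d.e.basis l)) := by
        gcongr
        exact (d.he.initialNorm_mono h2).trans (by gcongr; exact d.mul_le l)
      _ = _ := by ring
  suffices h : t * initialNorm d.e.basis l ≤
      (2 * d.K ^ 4 * ‖d.ι‖ + d.K ^ 2 * d.b / 2 * (2 * d.D)) * ‖h‖ by
    calc _ ≤ t * (d.K ^ 2 * d.b / 2 * initialNorm d.e.basis l) := by gcongr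
      _ = d.K ^ 2 * d.b / 2 * (t * initialNorm d.e.basis l) := by ring
      _ ≤ _ := by rw [mul_assoc]; gcongr
  have hcard := Finset.card_filter_add_card_filter_not (s := B)
    (fun j ↦ t / 2 ≤ ‖d.e.coord j (d.ι h.1)‖)
  have h0 : 0 ≤ d.K ^ 2 * d.b / 2 * (2 * d.D) * ‖h‖ := by positivity
  have h0' : 0 ≤ 2 * d.K ^ 4 * ‖d.ι‖ * ‖h‖ := by positivity
  by_cases hcase : l ≤ (B.filter fun j ↦ t / 2 ≤ ‖d.e.coord j (d.ι h.1)‖).card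
  · have h1 := d.he.initialNorm_le_norm_sum hcase (by positivity)
      (a := fun j ↦ d.e.coord j (d.ι h.1)) (fun j hj ↦ (Finset.mem_filter.1 hj).2)
    have h2 := d.he.norm_proj_le (B.filter fun j ↦ t / 2 ≤ ‖d.e.coord j (d.ι h.1)‖) (d.ι h.1)
    have h3 : t / 2 * initialNorm d.e.basis l ≤ d.K ^ 3 * (d.K * (‖d.ι‖ * ‖h‖)) := by
      refine h1.trans ?_
      gcongr
      exact h2.trans (by gcongr; exact d.norm_ι_le h)
    linarith
  -- At least l indices remain and they cannot all be below l - 1; one of them lies in a block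
  -- numbered at least log_b l.
  · have hne : ∃ j ∈ B.filter (fun j ↦ ¬ t / 2 ≤ ‖d.e.coord j (d.ι h.1)‖), l ≤ j + 1 := by
      by_contra! hcon
      have h1 : B.filter (fun j ↦ ¬ t / 2 ≤ ‖d.e.coord j (d.ι h.1)‖) ⊆ Finset.range (l - 1) := by
        intro j hj
        have := hcon j (by simpa using hj)
        rw [Finset.mem_range]; omega
      have h2 := Finset.card_le_card h1
      rw [Finset.card_range] at h2
      omega
    obtain ⟨j, hj, hlj⟩ := hne
    obtain ⟨hjB, hj2⟩ := Finset.mem_filter.1 hj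
    have h1 := hBt j hjB
    rw [coord_apply] at h1
    have h2 := h1.trans (norm_add_le _ _)
    rw [norm_mul, norm_inv, RCLike.norm_ofReal, abs_of_pos (d.lam_pos _)] at h2
    have h3 : t / 2 ≤ (d.lam (blockIndex d.b j))⁻¹ * ‖d.z.coord (blockIndex d.b j) h.2‖ := by
      linarith
    rw [le_inv_mul_iff₀ (d.lam_pos _)] at h3
    have h4 : d.lam (Nat.log d.b l) ≤ d.lam (blockIndex d.b j) :=
      d.lam_mono (Nat.log_mono_right hlj)
    have h5 := d.norm_coord_z_snd_le (blockIndex d.b j) h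
    have h6 : t * d.lam (Nat.log d.b l) ≤ 2 * d.D * ‖h‖ := by
      calc t * d.lam (Nat.log d.b l) ≤ t * d.lam (blockIndex d.b j) := by gcongr
        _ = 2 * (d.lam (blockIndex d.b j) * (t / 2)) := by ring
        _ ≤ _ := by linarith
    have h7 := d.initialNorm_le_lam_log (k := l)
    calc t * initialNorm d.e.basis l ≤ t * (d.K ^ 2 * d.b / 2 * d.lam (Nat.log d.b l)) := by gcongr
      _ = d.K ^ 2 * d.b / 2 * (t * d.lam (Nat.log d.b l)) := by ring
      _ ≤ d.K ^ 2 * d.b / 2 * (2 * d.D * ‖h‖) := by gcongr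
      _ ≤ _ := by linarith

end AveragingData

/-! ### The averaging construction: basis property, greedy projections, conditionality -/

namespace AveragingData

variable {𝕜 S Q Z : Type*} [RCLike 𝕜]
  [NormedAddCommGroup S] [NormedSpace 𝕜 S] [NormedAddCommGroup Q] [NormedSpace 𝕜 Q]
  [NormedAddCommGroup Z] [NormedSpace 𝕜 Z] (d : AveragingData 𝕜 S Q Z)

theorem sum_inter_add_sum_sdiff {M : Type*} [AddCommMonoid M] (A B : Finset ℕ) (F : ℕ → M) :
    ∑ j ∈ A ∩ B, F j + ∑ j ∈ A \ B, F j = ∑ j ∈ A, F j := by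
  rw [← Finset.sum_union (Finset.disjoint_sdiff_inter A B).symm, Finset.union_comm,
    Finset.sdiff_union_inter]

/-- Over a whole block both cross terms vanish: π kills the sum of the block, and the S coordinates
coming from Q add up to zero on it. -/
theorem sum_block_coord_smul_vec (h : Q × Z) (n : ℕ) :
    ∑ j ∈ block d.b n, d.coord j h • d.vec j =
      (d.π (∑ j ∈ block d.b n, d.e.coord j (d.ι h.1) • d.e.basis j),
        d.z.coord n h.2 • d.z.basis n) := by
  have hs : (blockSize d.b n : 𝕜) ≠ 0 := Nat.cast_ne_zero.2 (blockSize_pos d.hb n).ne'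
  have hl := d.lam_cast_ne_zero n
  have h1 : ∑ j ∈ block d.b n, d.coord j h • d.vec j = ∑ j ∈ block d.b n,
      (d.e.coord j (d.ι h.1) + (d.lam n : 𝕜)⁻¹ * d.z.coord n h.2) •
        ((d.π (d.e.basis j), (d.weight n : 𝕜) • d.z.basis n) : Q × Z) :=
    Finset.sum_congr rfl fun j hj ↦ by
      rw [coord_apply, vec, (mem_block_iff d.hb).1 hj]
  rw [h1]
  refine Prod.ext ?_ ?_
  · rw [Prod.fst_sum]
    simp only [Prod.smul_fst]
    simp only [add_smul]
    rw [Finset.sum_add_distrib, ← Finset.smul_sum, ← map_sum, d.π_sum_block, smul_zero, add_zero,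
      map_sum]
    simp
  · rw [Prod.snd_sum]
    simp only [Prod.smul_snd]
    rw [← Finset.sum_smul, Finset.sum_add_distrib, d.sum_block_coord_ι, zero_add, Finset.sum_const,
      card_block d.hb, smul_smul, ← Nat.cast_smul_eq_nsmul 𝕜, weight]
    congr 1
    push_cast
    rw [smul_eq_mul]
    field_simp

theorem sum_range_coord_smul_vec (h : Q × Z) (N : ℕ) :
    ∑ j ∈ Finset.range (d.b ^ N - 1), d.coord j h • d.vec j =
      (d.π (∑ j ∈ Finset.range (d.b ^ N - 1), d.e.coord j (d.ι h.1) • d.e.basis j),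
        ∑ n ∈ Finset.range N, d.z.coord n h.2 • d.z.basis n) := by
  rw [sum_range_pow_sub_one d.hb, sum_range_pow_sub_one d.hb]
  refine Prod.ext ?_ ?_
  · simp only [d.sum_block_coord_smul_vec, Prod.fst_sum, map_sum]
  · simp only [d.sum_block_coord_smul_vec, Prod.snd_sum]

theorem exists_norm_sum_range_le : ∃ C : ℝ, 0 ≤ C ∧ ∀ (h : Q × Z) (N : ℕ),
    ‖∑ j ∈ Finset.range (d.b ^ N - 1), d.coord j h • d.vec j‖ ≤ C * ‖h‖ := by
  have hK := d.he.pos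
  have hD := d.D_nonneg
  refine ⟨‖d.π‖ * (d.K * ‖d.ι‖) + d.D, by positivity, fun h N ↦ ?_⟩
  rw [d.sum_range_coord_smul_vec, Prod.norm_def]
  have h1 : ‖d.π (∑ j ∈ Finset.range (d.b ^ N - 1), d.e.coord j (d.ι h.1) • d.e.basis j)‖
      ≤ ‖d.π‖ * (d.K * (‖d.ι‖ * ‖h‖)) := by
    refine (d.π.le_opNorm _).trans ?_
    gcongr
    exact (d.he.norm_proj_le _ _).trans (by gcongr; exact d.norm_ι_le h)
  have h2 : ‖∑ n ∈ Finset.range N, d.z.coord n h.2 • d.z.basis n‖ ≤ d.D * ‖h‖ :=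
    (d.norm_sum_z_le N h.2).trans (by gcongr; exact norm_snd_le h)
  have h3 : 0 ≤ ‖d.π‖ * (d.K * (‖d.ι‖ * ‖h‖)) := by positivity
  have h4 : 0 ≤ d.D * ‖h‖ := by positivity
  exact max_le (h1.trans (by linarith)) (h2.trans (by linarith))

/-- Inside one block the Z part is a multiple of a single vector, so no conditionality of z is felt.
The mixed term is bounded by the ℓ₁ estimate `sum_norm_mul_initialNorm_le`. -/
theorem exists_norm_sum_subset_block_le : ∃ C : ℝ, 0 ≤ C ∧ ∀ (h : Q × Z) (n : ℕ) (A : Finset ℕ),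
    A ⊆ block d.b n → ‖∑ j ∈ A, d.coord j h • d.vec j‖ ≤
      C * (‖∑ j ∈ block d.b n, d.e.coord j (d.ι h.1) • d.e.basis j‖ + ‖d.z.coord n h.2‖) := by
  have hK := d.he.pos
  refine ⟨‖d.π‖ * d.K + ‖d.π‖ * d.K ^ 3 + 2 * d.K ^ 4 + 1, by positivity, fun h n A hA ↦ ?_⟩
  set G := ‖∑ j ∈ block d.b n, d.e.coord j (d.ι h.1) • d.e.basis j‖ with hG
  set x := ‖d.z.coord n h.2‖ with hx
  have hG0 : 0 ≤ G := norm_nonneg _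
  have hx0 : 0 ≤ x := norm_nonneg _
  have hl := d.lam_pos n
  have hw := d.weight_pos n
  have hs := d.blockSize_cast_pos n
  have hc : ‖(d.lam n : 𝕜)⁻¹ * d.z.coord n h.2‖ = (d.lam n)⁻¹ * x := by
    rw [norm_mul, norm_inv, RCLike.norm_ofReal, abs_of_pos hl]
  have hco : ∀ j ∈ A, d.coord j h = d.e.coord j (d.ι h.1) + (d.lam n : 𝕜)⁻¹ * d.z.coord n h.2 :=
    fun j hj ↦ by rw [coord_apply, (mem_block_iff d.hb).1 (hA hj)]
  have hcard : A.card ≤ blockSize d.b n := by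
    rw [← card_block d.hb]; exact Finset.card_le_card hA
  have h1 : ‖∑ j ∈ A, d.coord j h • d.e.basis j‖ ≤ d.K * G + d.K ^ 3 * x := by
    rw [Finset.sum_congr rfl fun j hj ↦ by rw [hco j hj, add_smul], Finset.sum_add_distrib]
    refine (norm_add_le _ _).trans (add_le_add (d.he.norm_sum_subset_le hA _) ?_)
    refine (d.he.norm_sum_le_initialNorm (a := fun _ ↦ (d.lam n : 𝕜)⁻¹ * d.z.coord n h.2)
      hcard (norm_nonneg _) (fun _ _ ↦ le_rfl)).trans (le_of_eq ?_)
    rw [hc]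
    change _ * d.lam n = _
    field_simp
  have h2 : ∑ j ∈ A, d.weight (blockIndex d.b j) * ‖d.coord j h‖ ≤ 2 * d.K ^ 4 * G + x := by
    have h3 := d.he.sum_norm_mul_initialNorm_le (blockSize_pos d.hb n) (card_block d.hb n).le
      (fun j ↦ d.e.coord j (d.ι h.1))
    rw [← hG] at h3
    change _ * d.lam n ≤ _ at h3
    calc _ ≤ ∑ j ∈ A, d.weight n * (‖d.e.coord j (d.ι h.1)‖ + (d.lam n)⁻¹ * x) := by
          refine Finset.sum_le_sum fun j hj ↦ ?_
          rw [(mem_block_iff d.hb).1 (hA hj), hco j hj, ← hc]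
          gcongr
          exact norm_add_le _ _
      _ ≤ ∑ j ∈ block d.b n, d.weight n * (‖d.e.coord j (d.ι h.1)‖ + (d.lam n)⁻¹ * x) :=
          Finset.sum_le_sum_of_subset_of_nonneg hA fun j _ _ ↦ by positivity
      _ = ((∑ j ∈ block d.b n, ‖d.e.coord j (d.ι h.1)‖) * d.lam n) / blockSize d.b n + x := by
          rw [← Finset.mul_sum, Finset.sum_add_distrib, Finset.sum_const, card_block d.hb,
            nsmul_eq_mul, weight]
          field_simp
      _ ≤ (2 * d.K ^ 4 * blockSize d.b n * G) / blockSize d.b n + x := by gcongr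
      _ = _ := by field_simp
  calc _ ≤ _ := d.norm_sum_vec_le A _
    _ ≤ ‖d.π‖ * (d.K * G + d.K ^ 3 * x) + (2 * d.K ^ 4 * G + x) := by gcongr
    _ ≤ _ := by
      have e1 : 0 ≤ ‖d.π‖ * d.K * x := by positivity
      have e2 : 0 ≤ ‖d.π‖ * d.K ^ 3 * G := by positivity
      have e3 : 0 ≤ d.K ^ 4 * x := by positivity
      nlinarith

theorem tendsto_pow_sub_one : Tendsto (fun N ↦ d.b ^ N - 1) atTop atTop :=
  (tendsto_sub_atTop_nat 1).comp (tendsto_pow_atTop_atTop_of_one_lt (by have := d.hb; omega))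

theorem tendsto_log : Tendsto (fun m ↦ Nat.log d.b (m + 1)) atTop atTop := by
  refine tendsto_atTop.2 fun N ↦ ?_
  filter_upwards [eventually_ge_atTop (d.b ^ N)] with m hm
  exact Nat.le_log_of_pow_le (by have := d.hb; omega) (by omega)

/-- Partial sums ending at full blocks converge by decoupling. What remains lies in one block, where
its norm is controlled by block pieces of convergent expansions in S and Z. -/
theorem tendsto_sum_coord_smul_vec (h : Q × Z) :
    Tendsto (fun m ↦ ∑ j ∈ Finset.range m, d.coord j h • d.vec j) atTop (𝓝 h) := by
  obtain ⟨C, hC0, hC⟩ := d.exists_norm_sum_subset_block_le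
  have hg := (tendsto_sum_range d.e (d.ι h.1)).comp d.tendsto_pow_sub_one
  have hz := tendsto_sum_range d.z h.2
  have hF : Tendsto (fun N ↦ ∑ j ∈ Finset.range (d.b ^ N - 1), d.coord j h • d.vec j)
      atTop (𝓝 h) := by
    simp only [d.sum_range_coord_smul_vec]
    have h1 := (d.π.continuous.tendsto _).comp hg
    rw [d.π_ι] at h1
    exact h1.prodMk_nhds hz
  have hG : Tendsto (fun n ↦ C * (‖∑ j ∈ block d.b n, d.e.coord j (d.ι h.1) • d.e.basis j‖ +
      ‖d.z.coord n h.2‖)) atTop (𝓝 0) := by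
    have h1 : Tendsto (fun n ↦ ‖∑ j ∈ block d.b n, d.e.coord j (d.ι h.1) • d.e.basis j‖)
        atTop (𝓝 0) := by
      have := ((hg.comp (tendsto_add_atTop_nat 1)).sub hg).norm
      rw [sub_self, norm_zero] at this
      refine this.congr fun n ↦ ?_
      simp only [Function.comp_apply]
      rw [block, Finset.sum_Ico_eq_sub _
        (Nat.sub_le_sub_right (Nat.pow_le_pow_right (by have := d.hb; omega) (Nat.le_succ n)) 1)]
    have h2 : Tendsto (fun n ↦ ‖d.z.coord n h.2‖) atTop (𝓝 0) := by
      have := ((hz.comp (tendsto_add_atTop_nat 1)).sub hz).norm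
      rw [sub_self, norm_zero] at this
      refine this.congr fun n ↦ ?_
      simp [Finset.sum_range_succ, norm_smul, d.norm_z]
    simpa using (h1.add h2).const_mul C
  have hrest : Tendsto (fun m ↦ ∑ j ∈ Finset.Ico (d.b ^ Nat.log d.b (m + 1) - 1) m,
      d.coord j h • d.vec j) atTop (𝓝 0) := by
    refine squeeze_zero_norm (fun m ↦ hC h (Nat.log d.b (m + 1)) _ fun j hj ↦ ?_)
      (hG.comp d.tendsto_log)
    have h1 := Nat.lt_pow_succ_log_self (b := d.b) (by have := d.hb; omega) (m + 1)
    rw [Nat.succ_eq_add_one] at h1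
    rw [Finset.mem_Ico] at hj
    rw [block, Finset.mem_Ico]
    omega
  have := (hF.comp d.tendsto_log).add hrest
  rw [add_zero] at this
  refine this.congr fun m ↦ ?_
  have h1 := Nat.pow_log_le_self d.b (x := m + 1) (by omega)
  simp only [Function.comp_apply]
  rw [Finset.sum_range_add_sum_Ico _ (by omega)]

/-- The basis of `Q × Z`. -/
def basis : SchauderBasis 𝕜 (Q × Z) where
  basis := d.vec
  coord := d.coord
  ortho i j := by rw [d.coord_vec]; simp [Pi.single_apply]
  expansion h := by
    rw [HasSum, SummationFilter.conditional_filter_eq_map_range, tendsto_map'_iff]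
    exact d.tendsto_sum_coord_smul_vec h

/-- Split the greedy set A, of size k, at block log_b k. The early part is a bounded full projection
minus a sum with at most k coefficients not exceeding the minimum over A. In the late part the
weights and the Z coordinates are small enough to be treated separately, without any greediness. -/
theorem exists_norm_sum_greedy_le : ∃ C : ℝ, 0 ≤ C ∧ ∀ (h : Q × Z) (A : Finset ℕ),
    (∀ j, j ∉ A → ∀ k ∈ A, ‖d.coord j h‖ ≤ ‖d.coord k h‖) →
    ‖∑ j ∈ A, d.coord j h • d.vec j‖ ≤ C * ‖h‖ := by
  have hK := d.he.pos
  have hD := d.D_nonneg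
  obtain ⟨C₁, hC₁, hU⟩ := d.exists_norm_sum_vec_le_initialNorm
  obtain ⟨C₂, hC₂, hL⟩ := d.exists_initialNorm_le_norm
  obtain ⟨C₃, hC₃, hR⟩ := d.exists_norm_sum_range_le
  refine ⟨C₃ + C₁ * C₂ + (‖d.π‖ * (d.K * ‖d.ι‖) +
    d.b * (d.K * d.b / 2) * (2 * d.K ^ 4) * (d.K * ‖d.ι‖)) +
    C₁ * (d.D * (d.K ^ 2 * d.b / 2)), by positivity, fun h A hA ↦ ?_⟩
  rcases A.eq_empty_or_nonempty with rfl | hne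
  · simp only [Finset.sum_empty, norm_zero]; positivity
  obtain ⟨k₀, hk₀, hmin⟩ := A.exists_min_image (fun j ↦ ‖d.coord j h‖) hne
  set t := ‖d.coord k₀ h‖ with ht
  have ht0 : 0 ≤ t := norm_nonneg _
  set k := A.card with hk
  have hk1 : 1 ≤ k := hne.card_pos
  set N := Nat.log d.b k with hN
  set Λ := initialNorm d.e.basis k with hΛ
  have hΛ0 : 0 < Λ := d.he.initialNorm_pos hk1
  have hLA : t * Λ ≤ C₂ * ‖h‖ := hL h A k t le_rfl ht0 hmin
  set g : ℕ → 𝕜 := fun j ↦ d.e.coord j (d.ι h.1) with hg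
  set c : ℕ → 𝕜 := fun j ↦ (d.lam (blockIndex d.b j) : 𝕜)⁻¹ * d.z.coord (blockIndex d.b j) h.2
    with hc
  have small : ‖∑ j ∈ A with blockIndex d.b j < N, d.coord j h • d.vec j‖
      ≤ C₃ * ‖h‖ + C₁ * (C₂ * ‖h‖) := by
    have e1 : A.filter (fun j ↦ blockIndex d.b j < N) = (Finset.range (d.b ^ N - 1)) ∩ A := by
      ext j
      rw [Finset.mem_filter, blockIndex_lt_iff d.hb, Finset.mem_inter, Finset.mem_range, and_comm]
    have e2 := sum_inter_add_sum_sdiff (Finset.range (d.b ^ N - 1)) A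
      (fun j ↦ d.coord j h • d.vec j)
    rw [e1, eq_sub_of_add_eq e2]
    refine (norm_sub_le _ _).trans (add_le_add (hR h N) ?_)
    have hcard : (Finset.range (d.b ^ N - 1) \ A).card ≤ k := by
      refine (Finset.card_le_card Finset.sdiff_subset).trans ?_
      rw [Finset.card_range]
      exact (Nat.sub_le _ _).trans (Nat.pow_log_le_self _ (by omega))
    have := hU _ k (fun j ↦ d.coord j h) t hk1 hcard ht0 (fun j hj ↦
      hA j (Finset.mem_sdiff.1 hj).2 k₀ hk₀)
    refine this.trans ?_
    rw [mul_assoc]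
    gcongr
  have hcard : (A.filter fun j ↦ ¬ blockIndex d.b j < N).card ≤ k := Finset.card_filter_le _ _
  have hgn : ‖∑ j ∈ A with ¬ blockIndex d.b j < N, g j • d.e.basis j‖ ≤ d.K * (‖d.ι‖ * ‖h‖) :=
    (d.he.norm_proj_le _ _).trans (by gcongr; exact d.norm_ι_le h)
  -- The ℓ₁ norm of g costs a factor k / Λ(k), which is compensated by `weight N` * k ≲ Λ(k).
  have large₁ : ‖∑ j ∈ A with ¬ blockIndex d.b j < N, g j • d.vec j‖ ≤
      ‖d.π‖ * (d.K * (‖d.ι‖ * ‖h‖)) +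
        d.b * (d.K * d.b / 2) * (2 * d.K ^ 4) * (d.K * (‖d.ι‖ * ‖h‖)) := by
    refine (d.norm_sum_vec_le _ _).trans (add_le_add (by gcongr) ?_)
    have h1 : ∑ j ∈ A with ¬ blockIndex d.b j < N, d.weight (blockIndex d.b j) * ‖g j‖
        ≤ d.weight N * ∑ j ∈ A with ¬ blockIndex d.b j < N, ‖g j‖ := by
      rw [Finset.mul_sum]
      refine Finset.sum_le_sum fun j hj ↦ ?_
      gcongr
      exact d.weight_antitone (not_lt.1 (Finset.mem_filter.1 hj).2)
    have h2 := d.he.sum_norm_mul_initialNorm_le hk1 hcard g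
    have h3 := d.weight_log_mul_le hk1
    have hw := (d.weight_pos N).le
    refine h1.trans ?_
    refine le_of_mul_le_mul_right ?_ hΛ0
    calc d.weight N * (∑ j ∈ A with ¬ blockIndex d.b j < N, ‖g j‖) * Λ
        = d.weight N * ((∑ j ∈ A with ¬ blockIndex d.b j < N, ‖g j‖) * Λ) := by ring
      _ ≤ d.weight N * (2 * d.K ^ 4 * k * (d.K * (‖d.ι‖ * ‖h‖))) := by
        refine mul_le_mul_of_nonneg_left (h2.trans ?_) hw
        gcongr
      _ = d.weight N * k * (2 * d.K ^ 4 * (d.K * (‖d.ι‖ * ‖h‖))) := by ring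
      _ ≤ d.b * (d.K * d.b / 2 * Λ) * (2 * d.K ^ 4 * (d.K * (‖d.ι‖ * ‖h‖))) := by gcongr
      _ = _ := by ring
  -- From block N on, |c j| is at most D‖h‖ / `lam N`, and at most k vectors with such coefficients
  -- give norm of order ‖h‖, since Λ(k) ≲ `lam N`.
  have large₂ : ‖∑ j ∈ A with ¬ blockIndex d.b j < N, c j • d.vec j‖ ≤
      C₁ * (d.D * (d.K ^ 2 * d.b / 2)) * ‖h‖ := by
    have hlN := d.lam_pos N
    have h1 := hU _ k c ((d.lam N)⁻¹ * (d.D * ‖h‖)) hk1 hcard (by positivity) (fun j hj ↦ by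
      have hlj := d.lam_pos (blockIndex d.b j)
      simp only [hc, norm_mul, norm_inv, RCLike.norm_ofReal, abs_of_pos hlj]
      gcongr
      · exact d.lam_mono (not_lt.1 (Finset.mem_filter.1 hj).2)
      · exact d.norm_coord_z_snd_le _ h)
    have h2 := d.initialNorm_le_lam_log (k := k)
    calc _ ≤ _ := h1
      _ ≤ C₁ * ((d.lam N)⁻¹ * (d.D * ‖h‖)) * (d.K ^ 2 * d.b / 2 * d.lam N) := by gcongr
      _ = _ := by field_simp
  have split : ∑ j ∈ A, d.coord j h • d.vec j =
      ∑ j ∈ A with blockIndex d.b j < N, d.coord j h • d.vec j +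
      (∑ j ∈ A with ¬ blockIndex d.b j < N, g j • d.vec j +
        ∑ j ∈ A with ¬ blockIndex d.b j < N, c j • d.vec j) := by
    rw [← Finset.sum_add_distrib, ← Finset.sum_filter_add_sum_filter_not A
      (fun j ↦ blockIndex d.b j < N)]
    congr 1
    exact Finset.sum_congr rfl fun j _ ↦ by rw [coord_apply, add_smul]
  rw [split]
  have := (norm_add_le _ _).trans (add_le_add small
    ((norm_add_le _ _).trans (add_le_add large₁ large₂)))
  refine this.trans (le_of_eq ?_)
  ring

theorem coord_sub_sum (h : Q × Z) (A : Finset ℕ) (j : ℕ) :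
    d.coord j (h - ∑ i ∈ A, d.coord i h • d.vec i) = if j ∈ A then 0 else d.coord j h := by
  have h1 : d.coord j (∑ i ∈ A, d.coord i h • d.vec i) = if j ∈ A then d.coord j h else 0 :=
    coord_sum_smul d.basis A (fun i ↦ d.coord i h) j
  rw [map_sub, h1]
  split_ifs <;> simp

/-- With h = f - S_A f one has f - S_F f = h + S_(A \ F) f - S_(F \ A) h. The set F \ A is greedy
for h, and the coefficients on A \ F are no more numerous and no larger than those of h on F \ A, so
the two-sided bounds by Λ apply. -/
theorem exists_almostGreedy : ∃ C : ℝ, 0 ≤ C ∧ ∀ (f : Q × Z) (A F : Finset ℕ), A.card ≤ F.card →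
    (∀ j, j ∉ F → ∀ k ∈ F, ‖d.coord j f‖ ≤ ‖d.coord k f‖) →
    ‖f - ∑ j ∈ F, d.coord j f • d.vec j‖ ≤ C * ‖f - ∑ j ∈ A, d.coord j f • d.vec j‖ := by
  obtain ⟨C₁, hC₁, hU⟩ := d.exists_norm_sum_vec_le_initialNorm
  obtain ⟨C₂, hC₂, hL⟩ := d.exists_initialNorm_le_norm
  obtain ⟨C₃, hC₃, hG⟩ := d.exists_norm_sum_greedy_le
  refine ⟨1 + C₁ * C₂ + C₃, by positivity, fun f A F hAF hF ↦ ?_⟩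
  set h := f - ∑ j ∈ A, d.coord j f • d.vec j with hh
  have hco : ∀ j, d.coord j h = if j ∈ A then 0 else d.coord j f := d.coord_sub_sum f A
  have hcard : (A \ F).card ≤ (F \ A).card := by
    have h1 := Finset.card_sdiff_add_card_inter A F
    have h2 := Finset.card_sdiff_add_card_inter F A
    rw [Finset.inter_comm] at h2
    omega
  have split : f - ∑ j ∈ F, d.coord j f • d.vec j = h + ∑ j ∈ A \ F, d.coord j f • d.vec j
      - ∑ j ∈ F \ A, d.coord j h • d.vec j := by
    have h1 := sum_inter_add_sum_sdiff A F (fun j ↦ d.coord j f • d.vec j)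
    have h2 := sum_inter_add_sum_sdiff F A (fun j ↦ d.coord j f • d.vec j)
    rw [Finset.inter_comm] at h2
    have h3 : ∑ j ∈ F \ A, d.coord j h • d.vec j = ∑ j ∈ F \ A, d.coord j f • d.vec j :=
      Finset.sum_congr rfl fun j hj ↦ by rw [hco, if_neg (Finset.mem_sdiff.1 hj).2]
    rw [h3, hh, ← h1, ← h2]
    abel
  have greedy : ‖∑ j ∈ F \ A, d.coord j h • d.vec j‖ ≤ C₃ * ‖h‖ := by
    refine hG h _ fun j hj k hk ↦ ?_
    obtain ⟨hkF, hkA⟩ := Finset.mem_sdiff.1 hk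
    rw [hco, hco, if_neg hkA]
    split_ifs with hjA
    · simp
    · exact hF j (fun hjF ↦ hj (Finset.mem_sdiff.2 ⟨hjF, hjA⟩)) k hkF
  have other : ‖∑ j ∈ A \ F, d.coord j f • d.vec j‖ ≤ C₁ * (C₂ * ‖h‖) := by
    rcases (F \ A).eq_empty_or_nonempty with hE | hne
    · rw [hE, Finset.card_empty, Nat.le_zero, Finset.card_eq_zero] at hcard
      rw [hcard, Finset.sum_empty, norm_zero]
      positivity
    obtain ⟨k₀, hk₀, hmin⟩ := (F \ A).exists_min_image (fun j ↦ ‖d.coord j f‖) hne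
    have h1 := hU (A \ F) (F \ A).card (fun j ↦ d.coord j f) ‖d.coord k₀ f‖ hne.card_pos hcard
      (norm_nonneg _)
      (fun j hj ↦ hF j (Finset.mem_sdiff.1 hj).2 k₀ (Finset.mem_sdiff.1 hk₀).1)
    have h2 := hL h (F \ A) (F \ A).card ‖d.coord k₀ f‖ le_rfl (norm_nonneg _) (fun j hj ↦ by
      rw [hco, if_neg (Finset.mem_sdiff.1 hj).2]; exact hmin j hj)
    refine h1.trans ?_
    rw [mul_assoc]
    gcongr
  rw [split]
  refine (norm_sub_le _ _).trans ((add_le_add ((norm_add_le _ _).trans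
    (add_le_add le_rfl other)) greedy).trans (le_of_eq ?_))
  ring

/-- The first m indices meet at most log_b m + 1 blocks, and each block contributes a bounded
amount. -/
theorem exists_norm_sum_le_log : ∃ C : ℝ, 0 ≤ C ∧ ∀ (m : ℕ), 2 ≤ m → ∀ (f : Q × Z)
    (A : Finset ℕ), (∀ j, m ≤ j → d.coord j f = 0) →
    ‖∑ j ∈ A, d.coord j f • d.vec j‖ ≤ C * Real.log m * ‖f‖ := by
  have hK := d.he.pos
  have hD := d.D_nonneg
  obtain ⟨C, hC, hB⟩ := d.exists_norm_sum_subset_block_le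
  have hb1 : (1 : ℝ) < d.b := by exact_mod_cast (by have := d.hb; omega : 1 < d.b)
  have hlb := Real.log_pos hb1
  have hl2 : 0 < Real.log 2 := Real.log_pos (by norm_num)
  refine ⟨C * (d.K * ‖d.ι‖ + d.D) * ((Real.log d.b)⁻¹ + (Real.log 2)⁻¹), by positivity,
    fun m hm f A hf ↦ ?_⟩
  set N := Nat.log d.b m + 1 with hN
  have e1 : ∑ j ∈ A, d.coord j f • d.vec j
      = ∑ n ∈ Finset.range N, ∑ j ∈ A.filter (fun j ↦ j < m ∧ blockIndex d.b j = n),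
        d.coord j f • d.vec j := by
    have h1 : ∑ j ∈ A, d.coord j f • d.vec j
        = ∑ j ∈ A.filter (fun j ↦ j < m), d.coord j f • d.vec j := by
      symm
      refine Finset.sum_subset (Finset.filter_subset _ _) fun j hjA hj ↦ ?_
      have : ¬ j < m := fun h ↦ hj (Finset.mem_filter.2 ⟨hjA, h⟩)
      rw [hf j (not_lt.1 this), zero_smul]
    rw [h1, ← Finset.sum_fiberwise_of_maps_to (t := Finset.range N) (g := blockIndex d.b)]
    · simp only [Finset.filter_filter]
    · intro j hj
      rw [Finset.mem_range, hN, Nat.lt_succ_iff]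
      exact Nat.log_mono_right (Finset.mem_filter.1 hj).2
  have e2 : ‖∑ j ∈ A, d.coord j f • d.vec j‖ ≤ N * (C * (d.K * (‖d.ι‖ * ‖f‖) + d.D * ‖f‖)) := by
    rw [e1]
    refine (norm_sum_le_of_le (f := fun n ↦ ∑ j ∈ A.filter (fun j ↦ j < m ∧ blockIndex d.b j = n),
      d.coord j f • d.vec j) (n := fun _ ↦ C * (d.K * (‖d.ι‖ * ‖f‖) + d.D * ‖f‖)) _
      (fun n _ ↦ ?_)).trans (le_of_eq ?_)
    · refine (hB f n _ fun j hj ↦ (mem_block_iff d.hb).2 (Finset.mem_filter.1 hj).2.2).trans ?_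
      gcongr
      · exact (d.he.norm_proj_le _ _).trans (by gcongr; exact d.norm_ι_le f)
      · exact d.norm_coord_z_snd_le n f
    · simp
  -- The extra block is absorbed by log m ≥ log 2, whence the term (log 2)⁻¹.
  have e3 : (N : ℝ) ≤ ((Real.log d.b)⁻¹ + (Real.log 2)⁻¹) * Real.log m := by
    have h1 : (d.b : ℝ) ^ Nat.log d.b m ≤ m := by
      exact_mod_cast Nat.pow_log_le_self d.b (by omega : m ≠ 0)
    have h2 := Real.log_le_log (by positivity) h1
    rw [Real.log_pow] at h2
    have h3 : Real.log 2 ≤ Real.log m := Real.log_le_log (by norm_num) (by exact_mod_cast hm)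
    rw [hN, Nat.cast_add, Nat.cast_one, add_mul]
    refine add_le_add ?_ ?_
    · rw [le_inv_mul_iff₀ hlb]; linarith
    · rw [le_inv_mul_iff₀ hl2]; linarith
  calc _ ≤ _ := e2
    _ ≤ (((Real.log d.b)⁻¹ + (Real.log 2)⁻¹) * Real.log m) *
        (C * (d.K * (‖d.ι‖ * ‖f‖) + d.D * ‖f‖)) := by gcongr
    _ = _ := by ring

/-- If the basis `z` is as conditional as possible, then the conditionality constants of the basis
of `Q × Z` grow at least logarithmically. -/
theorem exists_log_le_norm_sum {c : ℝ} (hc : 0 < c) (hz : ∀ N, 1 ≤ N → ∃ (x : Z) (B : Finset ℕ),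
      x ≠ 0 ∧ (∀ n, N ≤ n → d.z.coord n x = 0) ∧
      c * N * ‖x‖ ≤ ‖∑ n ∈ B, d.z.coord n x • d.z.basis n‖) :
    ∃ c' : ℝ, 0 < c' ∧ ∀ m, 2 ≤ m → ∃ (f : Q × Z) (A : Finset ℕ), f ≠ 0 ∧
      (∀ j, m ≤ j → d.coord j f = 0) ∧
      c' * Real.log m * ‖f‖ ≤ ‖∑ j ∈ A, d.coord j f • d.vec j‖ := by
  have hb1 : (1 : ℝ) < d.b := by exact_mod_cast (by have := d.hb; omega : 1 < d.b)
  have hlb := Real.log_pos hb1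
  -- The 1 serves the case N = 0, where a single vector is used; c / 2 serves N ≥ 1, where N + 1 ≤
  -- 2N.
  refine ⟨min 1 (c / 2) / Real.log d.b, by positivity, fun m hm ↦ ?_⟩
  set N := Nat.log d.b m with hN
  have hlog : Real.log m ≤ (N + 1) * Real.log d.b := by
    have h1 : (m : ℝ) ≤ (d.b : ℝ) ^ (N + 1) := by
      exact_mod_cast (Nat.lt_pow_succ_log_self (by have := d.hb; omega) m).le
    have h2 := Real.log_le_log (by positivity) h1
    rw [Real.log_pow] at h2
    exact_mod_cast h2
  have hmin : min 1 (c / 2) / Real.log d.b * Real.log m ≤ min 1 (c / 2) * (N + 1) := by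
    rw [div_mul_eq_mul_div, div_le_iff₀ hlb, mul_assoc]
    gcongr
  rcases Nat.eq_zero_or_pos N with h0 | hpos
  · refine ⟨d.vec 0, {0}, basis_ne_zero d.basis 0, fun j hj ↦ ?_, ?_⟩
    · rw [d.coord_vec, if_neg (by omega)]
    · rw [Finset.sum_singleton, d.coord_vec, if_pos rfl, one_smul]
      rw [h0, Nat.cast_zero, zero_add, mul_one] at hmin
      exact mul_le_of_le_one_left (norm_nonneg _) (hmin.trans (min_le_left _ _))
  · obtain ⟨x, B, hx, hxN, hB⟩ := hz N hpos
    set A := B.biUnion (block d.b) with hA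
    have hcoord : ∀ j, d.coord j (0, x) =
        (d.lam (blockIndex d.b j) : 𝕜)⁻¹ * d.z.coord (blockIndex d.b j) x := fun j ↦ by
      rw [coord_apply]; simp
    have hdisj : Set.PairwiseDisjoint (B : Set ℕ) (block d.b) := by
      intro i _ j _ hij
      rw [Function.onFun, Finset.disjoint_left]
      intro l hl hl'
      exact hij (((mem_block_iff d.hb).1 hl).symm.trans ((mem_block_iff d.hb).1 hl'))
    refine ⟨(0, x), A, fun h ↦ hx (congrArg Prod.snd h), fun j hj ↦ ?_, ?_⟩
    · have h1 : N ≤ blockIndex d.b j := Nat.log_mono_right (by omega)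
      rw [hcoord, hxN _ h1, mul_zero]
    · have h1 : (∑ j ∈ A, d.coord j ((0, x) : Q × Z) • d.vec j).2
          = ∑ n ∈ B, d.z.coord n x • d.z.basis n := by
        rw [hA, Finset.sum_biUnion hdisj]
        simp only [d.sum_block_coord_smul_vec, Prod.snd_sum]
      have h2 : ‖∑ n ∈ B, d.z.coord n x • d.z.basis n‖
          ≤ ‖∑ j ∈ A, d.coord j ((0, x) : Q × Z) • d.vec j‖ := by
        rw [← h1]; exact norm_snd_le _
      have h3 : ‖((0, x) : Q × Z)‖ = ‖x‖ := by simp [Prod.norm_def]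
      rw [h3]
      have h4 : (1 : ℝ) ≤ N := by exact_mod_cast hpos
      calc _ ≤ min 1 (c / 2) * (N + 1) * ‖x‖ := by gcongr
        _ ≤ c / 2 * (N + N) * ‖x‖ := by
          gcongr
          exact min_le_right _ _
        _ = c * N * ‖x‖ := by ring
        _ ≤ _ := hB.trans h2

end AveragingData

/-! ### Images, normalizations and interlacings of bases -/

section Constructions

variable {𝕜 : Type*} [RCLike 𝕜]
variable {X : Type*} [NormedAddCommGroup X] [NormedSpace 𝕜 X]
variable {Y : Type*} [NormedAddCommGroup Y] [NormedSpace 𝕜 Y]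

/-- A Schauder basis from a biorthogonal system with convergent expansions. -/
def basisOfTendsto (x : ℕ → X) (f : ℕ → StrongDual 𝕜 X)
    (h : ∀ i j, f i (x j) = if i = j then 1 else 0)
    (ht : ∀ y, Tendsto (fun N ↦ ∑ n ∈ Finset.range N, f n y • x n) atTop (𝓝 y)) :
    SchauderBasis 𝕜 X where
  basis := x
  coord := f
  ortho i j := by rw [h]; simp [Pi.single_apply]
  expansion y := by
    rw [HasSum, SummationFilter.conditional_filter_eq_map_range, tendsto_map'_iff]
    exact ht y

/-- The image of a basis by an isomorphism. -/
def mapBasis (b : SchauderBasis 𝕜 X) (Φ : X ≃L[𝕜] Y) : SchauderBasis 𝕜 Y :=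
  basisOfTendsto (fun n ↦ Φ (b.basis n)) (fun n ↦ b.coord n ∘L (Φ.symm : Y →L[𝕜] X))
    (fun i j ↦ by simp [coord_basis])
    (fun y ↦ by
      have := (Φ.continuous.tendsto _).comp (tendsto_sum_range b (Φ.symm y))
      rw [Φ.apply_symm_apply] at this
      refine this.congr fun N ↦ ?_
      simp [map_sum])

/-- The normalization of a basis. -/
def normalizeBasis (b : SchauderBasis 𝕜 X) : SchauderBasis 𝕜 X :=
  basisOfTendsto (fun n ↦ (‖b.basis n‖ : 𝕜)⁻¹ • b.basis n) (fun n ↦ (‖b.basis n‖ : 𝕜) • b.coord n)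
    (fun i j ↦ by
      have h : ‖b.basis j‖ ≠ 0 := norm_ne_zero_iff.2 (basis_ne_zero b j)
      by_cases hij : i = j
      · subst hij; simp [coord_basis, h]
      · simp [coord_basis, hij])
    (fun y ↦ by
      refine (tendsto_sum_range b y).congr fun N ↦ Finset.sum_congr rfl fun n _ ↦ ?_
      have h : (‖b.basis n‖ : 𝕜) ≠ 0 :=
        RCLike.ofReal_ne_zero.2 (norm_ne_zero_iff.2 (basis_ne_zero b n))
      rw [smul_smul, smul_apply, smul_eq_mul, mul_comm, inv_mul_cancel_left₀ h])

theorem norm_normalizeBasis (b : SchauderBasis 𝕜 X) (n : ℕ) : ‖(normalizeBasis b).basis n‖ = 1 := by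
  have h : ‖b.basis n‖ ≠ 0 := norm_ne_zero_iff.2 (basis_ne_zero b n)
  change ‖(‖b.basis n‖ : 𝕜)⁻¹ • b.basis n‖ = 1
  rw [norm_smul, norm_inv, RCLike.norm_ofReal, abs_norm, inv_mul_cancel₀ h]

theorem coord_normalizeBasis (b : SchauderBasis 𝕜 X) (n : ℕ) (x : X) :
    (normalizeBasis b).coord n x = (‖b.basis n‖ : 𝕜) * b.coord n x := rfl

theorem coord_smul_normalizeBasis (b : SchauderBasis 𝕜 X) (n : ℕ) (x : X) :
    (normalizeBasis b).coord n x • (normalizeBasis b).basis n = b.coord n x • b.basis n := by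
  have h : (‖b.basis n‖ : 𝕜) ≠ 0 :=
    RCLike.ofReal_ne_zero.2 (norm_ne_zero_iff.2 (basis_ne_zero b n))
  rw [coord_normalizeBasis]
  change _ • ((‖b.basis n‖ : 𝕜)⁻¹ • b.basis n) = _
  rw [smul_smul, mul_comm, inv_mul_cancel_left₀ h]

/-- Interlacing of two sequences of vectors in a product. -/
def interlace (x : ℕ → X) (y : ℕ → Y) (n : ℕ) : X × Y :=
  if n % 2 = 0 then (x (n / 2), 0) else (0, y (n / 2))

/-- Interlacing of two sequences of functionals on a product. -/
def interlaceCoord (f : ℕ → StrongDual 𝕜 X) (g : ℕ → StrongDual 𝕜 Y) (n : ℕ) :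
    StrongDual 𝕜 (X × Y) :=
  if n % 2 = 0 then f (n / 2) ∘L ContinuousLinearMap.fst 𝕜 X Y
  else g (n / 2) ∘L ContinuousLinearMap.snd 𝕜 X Y

theorem sum_interlace (f : ℕ → StrongDual 𝕜 X) (g : ℕ → StrongDual 𝕜 Y) (x : ℕ → X) (y : ℕ → Y)
    (w : X × Y) (N : ℕ) :
    ∑ n ∈ Finset.range N, interlaceCoord f g n w • interlace x y n =
      (∑ n ∈ Finset.range ((N + 1) / 2), f n w.1 • x n,
        ∑ n ∈ Finset.range (N / 2), g n w.2 • y n) := by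
  induction N with
  | zero => simp; rfl
  | succ N ih =>
    rw [Finset.sum_range_succ, ih, interlaceCoord, interlace]
    rcases Nat.mod_two_eq_zero_or_one N with h | h
    · rw [if_pos h, if_pos h, show (N + 1 + 1) / 2 = N / 2 + 1 by omega,
        show (N + 1) / 2 = N / 2 by omega, Finset.sum_range_succ]
      simp
    · rw [if_neg (by omega), if_neg (by omega), show (N + 1 + 1) / 2 = (N + 1) / 2 by omega,
        show (N + 1) / 2 = N / 2 + 1 by omega, Finset.sum_range_succ (n := N / 2)]
      simp [Finset.sum_range_succ]

/-- Interlacing of two bases. -/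
def prodBasis (b : SchauderBasis 𝕜 X) (b' : SchauderBasis 𝕜 Y) : SchauderBasis 𝕜 (X × Y) :=
  basisOfTendsto (interlace b.basis b'.basis) (interlaceCoord b.coord b'.coord)
    (fun i j ↦ by
      rw [interlaceCoord, interlace]
      by_cases hi : i % 2 = 0 <;> by_cases hj : j % 2 = 0
      · have : i / 2 = j / 2 ↔ i = j := by omega
        simp [hi, hj, coord_basis, this]
      · have : i ≠ j := fun h ↦ hj (h ▸ hi)
        simp [hi, hj, this]
      · have : i ≠ j := fun h ↦ hi (h ▸ hj)
        simp [hi, hj, this]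
      · have : i / 2 = j / 2 ↔ i = j := by omega
        simp [hi, hj, coord_basis, this])
    (fun w ↦ by
      simp only [sum_interlace]
      refine Tendsto.prodMk_nhds ((tendsto_sum_range b w.1).comp ?_)
        ((tendsto_sum_range b' w.2).comp ?_)
      · exact tendsto_atTop.2 fun m ↦ by
          filter_upwards [eventually_ge_atTop (2 * m)] with n hn
          omega
      · exact tendsto_atTop.2 fun m ↦ by
          filter_upwards [eventually_ge_atTop (2 * m)] with n hn
          omega)

/-- The conditionality constants of the basis grow linearly, i.e. as fast as possible. -/
def IsMaximallyConditional (b : SchauderBasis 𝕜 X) : Prop :=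
  ∃ c : ℝ, 0 < c ∧ ∀ N : ℕ, 1 ≤ N → ∃ (x : X) (B : Finset ℕ), x ≠ 0 ∧
    (∀ n, N ≤ n → b.coord n x = 0) ∧ c * N * ‖x‖ ≤ ‖∑ n ∈ B, b.coord n x • b.basis n‖

theorem IsMaximallyConditional.normalizeBasis {b : SchauderBasis 𝕜 X}
    (hb : IsMaximallyConditional b) : IsMaximallyConditional (normalizeBasis b) := by
  obtain ⟨c, hc, h⟩ := hb
  refine ⟨c, hc, fun N hN ↦ ?_⟩
  obtain ⟨x, B, hx, hxN, hB⟩ := h N hN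
  refine ⟨x, B, hx, fun n hn ↦ by rw [coord_normalizeBasis, hxN n hn, mul_zero], ?_⟩
  simp only [coord_smul_normalizeBasis]
  exact hB

theorem IsMaximallyConditional.prodBasis {b : SchauderBasis 𝕜 X}
    (hb : IsMaximallyConditional b) (b' : SchauderBasis 𝕜 Y) :
    IsMaximallyConditional (prodBasis b b') := by
  obtain ⟨c, hc, h⟩ := hb
  refine ⟨c / 2, by positivity, fun N hN ↦ ?_⟩
  -- Among the first N positions the even ones, (N + 1) / 2 in number, belong to b; this is where
  -- half of the constant is lost.
  obtain ⟨x, B, hx, hxN, hB⟩ := h ((N + 1) / 2) (by omega)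
  refine ⟨(x, 0), B.image (fun n ↦ 2 * n), fun h ↦ hx (congrArg Prod.fst h), fun n hn ↦ ?_, ?_⟩
  · change interlaceCoord b.coord b'.coord n (x, 0) = 0
    rw [interlaceCoord]
    split_ifs with h2
    · simpa using hxN (n / 2) (by omega)
    · simp
  · have e : ∑ n ∈ B.image (fun n ↦ 2 * n),
        (GreedyBases.prodBasis b b').coord n (x, 0) • (GreedyBases.prodBasis b b').basis n
        = (∑ n ∈ B, b.coord n x • b.basis n, 0) := by
      rw [Finset.sum_image (fun _ _ _ _ h ↦ by simpa using h)]
      have : ∀ n, (GreedyBases.prodBasis b b').coord (2 * n) (x, 0) •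
          (GreedyBases.prodBasis b b').basis (2 * n) = (b.coord n x • b.basis n, 0) := by
        intro n
        change interlaceCoord b.coord b'.coord (2 * n) (x, 0) •
          interlace b.basis b'.basis (2 * n) = _
        rw [interlaceCoord, interlace, if_pos (by omega), if_pos (by omega),
          show 2 * n / 2 = n by omega]
        simp
      simp only [this]
      exact Prod.ext (by simp [Prod.fst_sum]) (by simp [Prod.snd_sum])
    rw [e]
    have h1 : ‖((∑ n ∈ B, b.coord n x • b.basis n, 0) : X × Y)‖
        = ‖∑ n ∈ B, b.coord n x • b.basis n‖ := by simp [Prod.norm_def]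
    have h2 : ‖((x, 0) : X × Y)‖ = ‖x‖ := by simp [Prod.norm_def]
    rw [h1, h2]
    refine le_trans ?_ hB
    have h3 : (N : ℝ) ≤ 2 * ((N + 1) / 2 : ℕ) := by
      exact_mod_cast (by omega : N ≤ 2 * ((N + 1) / 2))
    calc c / 2 * N * ‖x‖ ≤ c / 2 * (2 * ((N + 1) / 2 : ℕ)) * ‖x‖ := by gcongr
      _ = _ := by ring

theorem exists_norm_sum_range_le_of_basis [CompleteSpace X] (b : SchauderBasis 𝕜 X)
    (hb : ∀ n, ‖b.basis n‖ = 1) : ∃ D : ℝ,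
      (∀ N x, ‖∑ n ∈ Finset.range N, b.coord n x • b.basis n‖ ≤ D * ‖x‖) ∧
      ∀ n x, ‖b.coord n x‖ ≤ D * ‖x‖ := by
  obtain ⟨C, hC⟩ := SchauderBasis.exists_norm_proj_le b
  have hC0 : 0 ≤ C := (norm_nonneg _).trans (hC 0)
  have h : ∀ N x, ‖∑ n ∈ Finset.range N, b.coord n x • b.basis n‖ ≤ C * ‖x‖ := fun N x ↦ by
    rw [← SchauderBasis.proj_apply]
    exact (SchauderBasis.proj b N).le_of_opNorm_le (hC N) x
  refine ⟨2 * C, fun N x ↦ (h N x).trans ?_, fun n x ↦ ?_⟩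
  · have : 0 ≤ C * ‖x‖ := by positivity
    linarith
  · have e : b.coord n x • b.basis n = ∑ n ∈ Finset.range (n + 1), b.coord n x • b.basis n -
        ∑ n ∈ Finset.range n, b.coord n x • b.basis n := by
      rw [Finset.sum_range_succ, add_sub_cancel_left]
    have e2 : ‖b.coord n x‖ = ‖b.coord n x • b.basis n‖ := by rw [norm_smul, hb, mul_one]
    rw [e2, e]
    refine (norm_sub_le _ _).trans ?_
    linarith [h (n + 1) x, h n x]

end Constructions

/-! ### From inequalities to the required properties, and invariance under isomorphism -/

section Transport

variable {𝕜 : Type*} [RCLike 𝕜]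
variable {X : Type*} [NormedAddCommGroup X] [NormedSpace 𝕜 X]
variable {Y : Type*} [NormedAddCommGroup Y] [NormedSpace 𝕜 Y]

/-- An almost greedy basis with fundamental function equivalent to `Λ` and with conditionality
constants of logarithmic growth, in terms of inequalities. -/
structure IsAlmostGreedyWith (b : SchauderBasis 𝕜 X) (Λ : ℕ → ℝ) : Prop where
  semiNormalized : IsSemiNormalized b.basis
  almostGreedy : ∃ C : ℝ, 0 ≤ C ∧ ∀ (f : X) (A F : Finset ℕ), A.card ≤ F.card →
    (∀ j, j ∉ F → ∀ k ∈ F, ‖b.coord j f‖ ≤ ‖b.coord k f‖) →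
    ‖f - ∑ j ∈ F, b.coord j f • b.basis j‖ ≤ C * ‖f - ∑ j ∈ A, b.coord j f • b.basis j‖
  norm_sum_le : ∃ C : ℝ, 0 < C ∧ ∀ (A : Finset ℕ) (m : ℕ), 1 ≤ m → A.card ≤ m →
    ‖∑ j ∈ A, b.basis j‖ ≤ C * Λ m
  le_norm_sum : ∃ c : ℝ, 0 < c ∧ ∀ m : ℕ, 1 ≤ m →
    c * Λ m ≤ ‖∑ j ∈ Finset.range m, b.basis j‖
  norm_proj_le : ∃ C : ℝ, 0 < C ∧ ∀ (m : ℕ), 2 ≤ m → ∀ (f : X) (A : Finset ℕ),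
    (∀ j, m ≤ j → b.coord j f = 0) → ‖∑ j ∈ A, b.coord j f • b.basis j‖ ≤ C * Real.log m * ‖f‖
  le_norm_proj : ∃ c : ℝ, 0 < c ∧ ∀ (m : ℕ), 2 ≤ m → ∃ (f : X) (A : Finset ℕ), f ≠ 0 ∧
    (∀ j, m ≤ j → b.coord j f = 0) ∧ c * Real.log m * ‖f‖ ≤ ‖∑ j ∈ A, b.coord j f • b.basis j‖

theorem IsAlmostGreedyWith.isAlmostGreedy {b : SchauderBasis 𝕜 X} {Λ : ℕ → ℝ}
    (hb : IsAlmostGreedyWith b Λ) : IsAlmostGreedy b := by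
  obtain ⟨C, -, hC⟩ := hb.almostGreedy
  refine ⟨hb.semiNormalized, C, fun f A F h hF ↦ ?_⟩
  rw [GeneralSchauderBasis.proj_apply, GeneralSchauderBasis.proj_apply]
  exact hC f A F h hF

theorem IsAlmostGreedyWith.equivalentFrom_fundamentalFunction {b : SchauderBasis 𝕜 X} {Λ : ℕ → ℝ}
    (hb : IsAlmostGreedyWith b Λ) : EquivalentFrom 1 (fundamentalFunction b) Λ := by
  obtain ⟨C, hC0, hC⟩ := hb.norm_sum_le
  obtain ⟨c, hc0, hc⟩ := hb.le_norm_sum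
  refine ⟨c, C, hc0, hC0, fun m hm ↦ ⟨?_, ?_⟩⟩
  · refine (hc m hm).trans (le_csSup ⟨C * Λ m, ?_⟩ ⟨Finset.range m, by simp, rfl⟩)
    rintro _ ⟨A, hA, rfl⟩
    exact hC A m hm hA
  · refine csSup_le ⟨_, ∅, by simp, rfl⟩ ?_
    rintro _ ⟨A, hA, rfl⟩
    exact hC A m hm hA

theorem IsAlmostGreedyWith.equivalentFrom_conditionalityConstant {b : SchauderBasis 𝕜 X}
    {Λ : ℕ → ℝ} (hb : IsAlmostGreedyWith b Λ) :
    EquivalentFrom 2 (conditionalityConstant b) (fun m ↦ Real.log m) := by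
  obtain ⟨C, hC0, hC⟩ := hb.norm_proj_le
  obtain ⟨c, hc0, hc⟩ := hb.le_norm_proj
  have key : ∀ m, 2 ≤ m → ∀ r ∈ {r : ℝ | ∃ (f : X) (A : Finset ℕ), f ≠ 0 ∧
      (∀ j, m ≤ j → b.coord j f = 0) ∧ r = ‖GeneralSchauderBasis.proj b A f‖ / ‖f‖},
      r ≤ C * Real.log m := by
    rintro m hm _ ⟨f, A, hf, hfm, rfl⟩
    rw [div_le_iff₀ (norm_pos_iff.2 hf), GeneralSchauderBasis.proj_apply]
    exact hC m hm f A hfm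
  refine ⟨c, C, hc0, hC0, fun m hm ↦ ?_⟩
  obtain ⟨f, A, hf, hfm, h⟩ := hc m hm
  have hmem : ‖GeneralSchauderBasis.proj b A f‖ / ‖f‖ ∈ {r : ℝ | ∃ (f : X) (A : Finset ℕ), f ≠ 0 ∧
      (∀ j, m ≤ j → b.coord j f = 0) ∧ r = ‖GeneralSchauderBasis.proj b A f‖ / ‖f‖} :=
    ⟨f, A, hf, hfm, rfl⟩
  refine ⟨le_trans ?_ (le_csSup ⟨_, key m hm⟩ hmem), csSup_le ⟨_, hmem⟩ (key m hm)⟩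
  rw [le_div_iff₀ (norm_pos_iff.2 hf), GeneralSchauderBasis.proj_apply]
  exact h

theorem IsAlmostGreedyWith.mapBasis {b : SchauderBasis 𝕜 X} {Λ : ℕ → ℝ}
    (hb : IsAlmostGreedyWith b Λ) (Φ : X ≃L[𝕜] Y) : IsAlmostGreedyWith (mapBasis b Φ) Λ := by
  have hcoord : ∀ j y, (GreedyBases.mapBasis b Φ).coord j y = b.coord j (Φ.symm y) :=
    fun _ _ ↦ rfl
  have hbasis : ∀ j, (GreedyBases.mapBasis b Φ).basis j = Φ (b.basis j) := fun _ ↦ rfl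
  have hsum : ∀ (A : Finset ℕ) (y : Y), ∑ j ∈ A, (GreedyBases.mapBasis b Φ).coord j y •
      (GreedyBases.mapBasis b Φ).basis j
      = Φ (∑ j ∈ A, b.coord j (Φ.symm y) • b.basis j) := fun A y ↦ by
    simp [hcoord, hbasis, map_sum]
  have hind : ∀ (A : Finset ℕ), ∑ j ∈ A, (GreedyBases.mapBasis b Φ).basis j
      = Φ (∑ j ∈ A, b.basis j) := fun A ↦ by simp [hbasis, map_sum]
  set U := ‖(Φ : X →L[𝕜] Y)‖ + 1 with hU
  set V := ‖(Φ.symm : Y →L[𝕜] X)‖ + 1 with hV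
  have hU0 : 0 < U := by positivity
  have hV0 : 0 < V := by positivity
  have up : ∀ x, ‖Φ x‖ ≤ U * ‖x‖ := fun x ↦
    ((Φ : X →L[𝕜] Y).le_opNorm x).trans (by rw [hU]; gcongr; linarith)
  have down : ∀ x, ‖x‖ ≤ V * ‖Φ x‖ := fun x ↦ by
    have := (Φ.symm : Y →L[𝕜] X).le_opNorm (Φ x)
    rw [ContinuousLinearEquiv.coe_coe, Φ.symm_apply_apply] at this
    exact this.trans (by rw [hV]; gcongr; linarith)
  refine ⟨?_, ?_, ?_, ?_, ?_, ?_⟩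
  · obtain ⟨c, C, hc, h⟩ := hb.semiNormalized
    refine ⟨V⁻¹ * c, U * C, by positivity, fun j ↦ ⟨?_, ?_⟩⟩
    · rw [hbasis, inv_mul_le_iff₀ hV0]
      exact (h j).1.trans (down _)
    · rw [hbasis]
      exact (up _).trans (by gcongr; exact (h j).2)
  · obtain ⟨C, hC0, hC⟩ := hb.almostGreedy
    refine ⟨U * (C * V), by positivity, fun f A F hAF hF ↦ ?_⟩
    have e : ∀ A : Finset ℕ, f - Φ (∑ j ∈ A, b.coord j (Φ.symm f) • b.basis j)
        = Φ (Φ.symm f - ∑ j ∈ A, b.coord j (Φ.symm f) • b.basis j) := fun A ↦ by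
      rw [map_sub, Φ.apply_symm_apply]
    rw [hsum, hsum, e, e]
    calc _ ≤ _ := up _
      _ ≤ U * (C * (V * _)) := by
        gcongr
        exact (hC (Φ.symm f) A F hAF hF).trans (by gcongr; exact down _)
      _ = _ := by ring
  · obtain ⟨C, hC0, hC⟩ := hb.norm_sum_le
    refine ⟨U * C, by positivity, fun A m hm hA ↦ ?_⟩
    rw [hind, mul_assoc]
    exact (up _).trans (by gcongr; exact hC A m hm hA)
  · obtain ⟨c, hc0, hc⟩ := hb.le_norm_sum
    refine ⟨V⁻¹ * c, by positivity, fun m hm ↦ ?_⟩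
    rw [hind, mul_assoc, inv_mul_le_iff₀ hV0]
    exact (hc m hm).trans (down _)
  · obtain ⟨C, hC0, hC⟩ := hb.norm_proj_le
    refine ⟨U * C * V, by positivity, fun m hm f A hf ↦ ?_⟩
    have hlog : 0 ≤ Real.log m := Real.log_natCast_nonneg m
    have h1 := down (Φ.symm f)
    rw [Φ.apply_symm_apply] at h1
    rw [hsum]
    calc _ ≤ _ := up _
      _ ≤ U * (C * Real.log m * (V * ‖f‖)) := by
        gcongr
        exact (hC m hm (Φ.symm f) A hf).trans (by gcongr)
      _ = _ := by ring
  · obtain ⟨c, hc0, hc⟩ := hb.le_norm_proj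
    refine ⟨V⁻¹ * c * U⁻¹, by positivity, fun m hm ↦ ?_⟩
    obtain ⟨f, A, hf, hfm, h⟩ := hc m hm
    have hlog : 0 ≤ Real.log m := Real.log_natCast_nonneg m
    refine ⟨Φ f, A, by simpa using hf, fun j hj ↦ ?_, ?_⟩
    · rw [hcoord, Φ.symm_apply_apply, hfm j hj]
    · rw [hsum, Φ.symm_apply_apply]
      have h2 : U⁻¹ * ‖Φ f‖ ≤ ‖f‖ := by rw [inv_mul_le_iff₀ hU0]; exact up f
      calc V⁻¹ * c * U⁻¹ * Real.log m * ‖Φ f‖ = V⁻¹ * (c * Real.log m * (U⁻¹ * ‖Φ f‖)) := by ring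
        _ ≤ V⁻¹ * (c * Real.log m * ‖f‖) := by gcongr
        _ ≤ V⁻¹ * (V * ‖Φ (∑ j ∈ A, b.coord j f • b.basis j)‖) := by
          exact mul_le_mul_of_nonneg_left (h.trans (down _)) (by positivity)
        _ = _ := by rw [inv_mul_cancel_left₀ hV0.ne']

theorem AveragingData.isAlmostGreedyWith {S Q Z : Type*}
    [NormedAddCommGroup S] [NormedSpace 𝕜 S] [NormedAddCommGroup Q] [NormedSpace 𝕜 Q]
    [NormedAddCommGroup Z] [NormedSpace 𝕜 Z] (d : AveragingData 𝕜 S Q Z)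
    (hz : IsMaximallyConditional d.z) :
    IsAlmostGreedyWith d.basis (initialNorm d.e.basis) := by
  obtain ⟨C₁, hC₁, hU⟩ := d.exists_norm_sum_vec_le_initialNorm
  obtain ⟨C₂, hC₂, hL⟩ := d.exists_initialNorm_le_norm
  have upper : ∀ (A : Finset ℕ) (m : ℕ), 1 ≤ m → A.card ≤ m →
      ‖∑ j ∈ A, d.vec j‖ ≤ (C₁ + 1) * initialNorm d.e.basis m := fun A m hm hA ↦ by
    have h := hU A m (fun _ ↦ 1) 1 hm hA zero_le_one (fun _ _ ↦ by simp)
    simp only [one_smul, mul_one] at h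
    have := initialNorm_nonneg d.e.basis m
    linarith
  -- The coordinates of the sum over A are 1 on A, so the lower estimate applies with t = 1;
  -- enlarging C₂ by 1 makes it invertible.
  have lower : ∀ A : Finset ℕ, (C₂ + 1)⁻¹ * initialNorm d.e.basis A.card ≤ ‖∑ j ∈ A, d.vec j‖ :=
    fun A ↦ by
    have h := hL (∑ j ∈ A, d.vec j) A A.card 1 le_rfl zero_le_one (fun j hj ↦ by
      have := coord_sum_smul d.basis A (fun _ ↦ 1) j
      simp only [one_smul, if_pos hj] at this
      have e : d.coord j (∑ j ∈ A, d.vec j) = 1 := this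
      rw [e]; simp)
    rw [inv_mul_le_iff₀ (by positivity)]
    have := norm_nonneg (∑ j ∈ A, d.vec j)
    linarith
  refine ⟨?_, d.exists_almostGreedy, ?_, ?_, ?_, ?_⟩
  · have h1 : 0 < initialNorm d.e.basis 1 := d.he.initialNorm_pos le_rfl
    refine ⟨(C₂ + 1)⁻¹ * initialNorm d.e.basis 1, (C₁ + 1) * initialNorm d.e.basis 1,
      by positivity, fun j ↦ ⟨?_, ?_⟩⟩
    · have := lower {j}
      rwa [Finset.card_singleton, Finset.sum_singleton] at this
    · have := upper {j} 1 le_rfl (by simp)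
      rwa [Finset.sum_singleton] at this
  · exact ⟨C₁ + 1, by positivity, upper⟩
  · refine ⟨(C₂ + 1)⁻¹, by positivity, fun m _ ↦ ?_⟩
    have := lower (Finset.range m)
    rwa [Finset.card_range] at this
  · obtain ⟨C, hC0, hC⟩ := d.exists_norm_sum_le_log
    refine ⟨C + 1, by positivity, fun m hm f A hf ↦ (hC m hm f A hf).trans ?_⟩
    have hlog : 0 ≤ Real.log m := Real.log_natCast_nonneg m
    gcongr
    linarith
  · obtain ⟨c, hc, h⟩ := hz
    exact d.exists_log_le_norm_sum hc h

end Transport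

/-! ### Isomorphisms with squares and absorption -/

section Squares

variable {𝕜 : Type*} [RCLike 𝕜]
variable {S : Type*} [NormedAddCommGroup S] [NormedSpace 𝕜 S]

/-- Unconditionality splits S into the spans of the even and the odd basis vectors, and subsymmetry
identifies each of them with S. -/
theorem IsSubsymmetricWith.nonempty_equiv_prod [CompleteSpace S] {e : SchauderBasis 𝕜 S} {K : ℝ}
    (he : IsSubsymmetricWith 𝕜 e.basis K) : Nonempty (S ≃L[𝕜] S × S) := by
  have hK := he.pos
  have down : ∀ r < 2, ∃ T : S →L[𝕜] S, ∀ j, T (e.basis j) =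
      if j % 2 = r then e.basis (j / 2) else 0 := by
    intro r hr
    refine exists_clm_of_norm_sum_le e _ (K * K) fun A a ↦ ?_
    have h1 := he.norm_sum_comp_le (A.filter fun j ↦ j % 2 = r) (fun j ↦ j / 2) id (by
      intro i hi j hj hij
      simp only [Finset.coe_filter, Set.mem_ofPred_eq] at hi hj
      simp only
      omega) strictMonoOn_id a
    have h2 := he.norm_sum_subset_le (Finset.filter_subset (fun j ↦ j % 2 = r) A) a
    simp only [smul_ite, smul_zero]
    rw [← Finset.sum_filter, mul_assoc]
    simp only [id] at h1
    exact h1.trans (by gcongr)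
  have up : ∀ r, ∃ T : S →L[𝕜] S, ∀ j, T (e.basis j) = e.basis (2 * j + r) := fun r ↦
    exists_clm_of_norm_sum_le e _ K fun A a ↦
      he.norm_sum_comp_le A (fun j ↦ 2 * j + r) id (fun i _ j _ hij ↦ by simpa using hij)
        strictMonoOn_id a
  obtain ⟨D₀, hD₀⟩ := down 0 (by omega)
  obtain ⟨D₁, hD₁⟩ := down 1 (by omega)
  obtain ⟨U₀, hU₀⟩ := up 0
  obtain ⟨U₁, hU₁⟩ := up 1
  have e00 : D₀ ∘L U₀ = ContinuousLinearMap.id 𝕜 S := clm_ext_basis e fun j ↦ by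
    simp [hU₀, hD₀]
  have e11 : D₁ ∘L U₁ = ContinuousLinearMap.id 𝕜 S := clm_ext_basis e fun j ↦ by
    have h1 : (2 * j + 1) % 2 = 1 := by omega
    have h2 : (2 * j + 1) / 2 = j := by omega
    simp [hU₁, hD₁, h2]
  have e01 : D₀ ∘L U₁ = 0 := clm_ext_basis e fun j ↦ by
    have h1 : (2 * j + 1) % 2 = 1 := by omega
    simp [hU₁, hD₀, h1]
  have e10 : D₁ ∘L U₀ = 0 := clm_ext_basis e fun j ↦ by
    simp [hU₀, hD₁]
  have esum : U₀ ∘L D₀ + U₁ ∘L D₁ = ContinuousLinearMap.id 𝕜 S := clm_ext_basis e fun j ↦ by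
    rcases Nat.mod_two_eq_zero_or_one j with h | h
    · have h2 : 2 * (j / 2) = j := by omega
      simp [hU₀, hD₀, hD₁, h, h2]
    · have h2 : 2 * (j / 2) + 1 = j := by omega
      simp [hU₁, hD₀, hD₁, h, h2]
  refine ⟨ContinuousLinearEquiv.equivOfInverse (D₀.prod D₁) (U₀.coprod U₁) (fun f ↦ ?_)
    (fun f ↦ ?_)⟩
  · exact congrArg (fun T ↦ T f) esum
  · have a00 := congrArg (fun T ↦ T f.1) e00
    have a11 := congrArg (fun T ↦ T f.2) e11
    have a01 := congrArg (fun T ↦ T f.2) e01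
    have a10 := congrArg (fun T ↦ T f.1) e10
    simp only [ContinuousLinearMap.comp_apply, ContinuousLinearMap.id_apply, zero_apply]
      at a00 a11 a01 a10
    refine Prod.ext ?_ ?_
    · simp [a00, a01]
    · simp [a11, a10]

/-- With V the kernel of the projecting map, X ≅ S × V ≅ S × S × V ≅ S × X. -/
theorem nonempty_equiv_prod_of_isComplementedIn {X : Type*} [NormedAddCommGroup X]
    [NormedSpace 𝕜 X] (hS : Nonempty (S ≃L[𝕜] S × S)) (h : IsComplementedIn 𝕜 S X) :
    Nonempty (X ≃L[𝕜] S × X) := by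
  obtain ⟨L, T, hTL⟩ := h
  obtain ⟨Ψ⟩ := hS
  let Φ : X ≃L[𝕜] S × T.ker := ContinuousLinearEquiv.equivOfRightInverse T L
    (fun x ↦ congrArg (fun U ↦ U x) hTL)
  exact ⟨Φ.trans (((Ψ.prodCongr (.refl 𝕜 _)).trans (.prodAssoc 𝕜 S S T.ker)).trans
    ((ContinuousLinearEquiv.refl 𝕜 S).prodCongr Φ.symm))⟩

end Squares

/-! ### A basis for the range of the averaging projection -/

section Average

variable {𝕜 : Type*} [RCLike 𝕜]
variable {S : Type*} [NormedAddCommGroup S] [NormedSpace 𝕜 S]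
variable {e : SchauderBasis 𝕜 S} {b : ℕ} {P : S →L[𝕜] S}

/-- The indicators of the blocks form a basis of the space of vectors fixed by the averaging
projection. -/
theorem nonempty_basis_ker_id_sub_average (hb : 2 ≤ b) (hP : ∀ j, P (e.basis j) =
      (blockSize b (blockIndex b j) : 𝕜)⁻¹ • ∑ i ∈ block b (blockIndex b j), e.basis i) :
    Nonempty (SchauderBasis 𝕜 (ContinuousLinearMap.id 𝕜 S - P).ker) := by
  have hmem : ∀ n, ∑ i ∈ block b n, e.basis i ∈ (ContinuousLinearMap.id 𝕜 S - P).ker := fun n ↦ by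
    rw [LinearMap.mem_ker]
    simp [-map_sum, average_sum_block hb hP n]
  have hfix : ∀ p : (ContinuousLinearMap.id 𝕜 S - P).ker, P (p : S) = p := fun p ↦ by
    have := p.2
    rw [LinearMap.mem_ker] at this
    exact (sub_eq_zero.1 this).symm
  have hfirst : ∀ n, blockIndex b (b ^ n - 1) = n := fun n ↦ by
    have hp : 0 < b ^ n := by positivity
    have := blockSize_pos hb n
    rw [← mem_block_iff hb, mem_block_iff_le hb]
    omega
  -- Fixed vectors have constant coordinates on each block, so the coordinate at its first index b ^
  -- n - 1 determines them there.
  have hconst : ∀ (p : (ContinuousLinearMap.id 𝕜 S - P).ker) (j n : ℕ), blockIndex b j = n →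
      e.coord j (p : S) = e.coord (b ^ n - 1) (p : S) := fun p j n h ↦ by
    rw [← hfix p, coord_average hb hP, coord_average hb hP, h, hfirst]
  refine ⟨basisOfTendsto (fun n ↦ ⟨∑ i ∈ block b n, e.basis i, hmem n⟩)
    (fun n ↦ e.coord (b ^ n - 1) ∘L Submodule.subtypeL _) (fun i j ↦ ?_) (fun p ↦ ?_)⟩
  · have := coord_sum_smul e (block b j) (fun _ ↦ 1) (b ^ i - 1)
    simp only [one_smul, mem_block_iff hb, hfirst] at this
    exact this
  · rw [tendsto_subtype_rng]
    have h1 := (tendsto_sum_range e (p : S)).comp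
      ((tendsto_sub_atTop_nat 1).comp (tendsto_pow_atTop_atTop_of_one_lt (by omega : 1 < b)))
    refine h1.congr fun N ↦ ?_
    simp only [Function.comp_apply]
    rw [sum_range_pow_sub_one hb, Submodule.coe_sum]
    refine Finset.sum_congr rfl fun n _ ↦ ?_
    simp only [Submodule.coe_smul, Finset.smul_sum]
    refine Finset.sum_congr rfl fun j hj ↦ ?_
    rw [hconst p j n ((mem_block_iff hb).1 hj)]
    rfl

end Average

/-! ### ℓ₁ and its difference basis -/

section EllOne

variable {𝕜 : Type*} [RCLike 𝕜]

theorem summable_norm_ellOne (f : SpaceEllOne 𝕜) : Summable fun k ↦ ‖f k‖ := by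
  have := (lp.memℓp f).summable (by simp)
  simpa using this

theorem norm_ellOne (f : SpaceEllOne 𝕜) : ‖f‖ = ∑' k, ‖f k‖ := by
  have := lp.norm_eq_tsum_rpow (by simp) f
  simpa using this

theorem summable_ellOne (f : SpaceEllOne 𝕜) : Summable fun k ↦ f k :=
  (summable_norm_ellOne f).of_norm

theorem sum_norm_le_ellOne (f : SpaceEllOne 𝕜) (A : Finset ℕ) : ∑ k ∈ A, ‖f k‖ ≤ ‖f‖ := by
  rw [norm_ellOne]
  exact (summable_norm_ellOne f).sum_le_tsum A fun _ _ ↦ norm_nonneg _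

/-- The unit vectors of `ℓ₁`. -/
def ellOneUnit (𝕜 : Type*) [RCLike 𝕜] (n : ℕ) : SpaceEllOne 𝕜 := lp.single 1 n (1 : 𝕜)

theorem ellOneUnit_apply (n k : ℕ) : (ellOneUnit 𝕜 n) k = if k = n then 1 else 0 := by
  rw [ellOneUnit, lp.single_apply]
  simp [Pi.single_apply]

theorem smul_ellOneUnit (n : ℕ) (c : 𝕜) : c • ellOneUnit 𝕜 n = lp.single 1 n c := by
  rw [ellOneUnit, ← lp.single_smul]
  simp

theorem norm_sum_smul_ellOneUnit (A : Finset ℕ) (a : ℕ → 𝕜) :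
    ‖∑ j ∈ A, a j • ellOneUnit 𝕜 j‖ = ∑ j ∈ A, ‖a j‖ := by
  simp only [smul_ellOneUnit]
  have := lp.norm_sum_single (E := fun _ : ℕ ↦ 𝕜) (p := 1) (by simp) a A
  simpa using this

theorem tendsto_sum_smul_ellOneUnit (f : SpaceEllOne 𝕜) :
    Tendsto (fun N ↦ ∑ n ∈ Finset.range N, f n • ellOneUnit 𝕜 n) atTop (𝓝 f) := by
  have := (lp.hasSum_single (by simp) f).tendsto_sum_nat
  simpa only [smul_ellOneUnit] using this

/-- The unit vector basis of `ℓ₁`. -/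
def ellOneUnitBasis (𝕜 : Type*) [RCLike 𝕜] : SchauderBasis 𝕜 (SpaceEllOne 𝕜) :=
  basisOfTendsto (ellOneUnit 𝕜) (fun n ↦ lp.evalCLM 𝕜 (fun _ ↦ 𝕜) 1 n)
    (fun i j ↦ ellOneUnit_apply j i) tendsto_sum_smul_ellOneUnit

theorem isSubsymmetricWith_ellOneUnitBasis :
    IsSubsymmetricWith 𝕜 (ellOneUnitBasis 𝕜).basis 1 := by
  refine ⟨le_rfl, basis_ne_zero _ 0, fun A a c h ↦ ?_, fun A φ ψ hφ hψ a ↦ ?_⟩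
  · change ‖∑ j ∈ A, a j • ellOneUnit 𝕜 j‖ ≤ 1 * ‖∑ j ∈ A, c j • ellOneUnit 𝕜 j‖
    rw [norm_sum_smul_ellOneUnit, norm_sum_smul_ellOneUnit, one_mul]
    exact Finset.sum_le_sum h
  · change ‖∑ j ∈ A, a j • ellOneUnit 𝕜 (φ j)‖ ≤ 1 * ‖∑ j ∈ A, a j • ellOneUnit 𝕜 (ψ j)‖
    have key : ∀ χ : ℕ → ℕ, StrictMonoOn χ A →
        ‖∑ j ∈ A, a j • ellOneUnit 𝕜 (χ j)‖ = ∑ j ∈ A, ‖a j‖ := by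
      intro χ hχ
      have h1 : ∀ i ∈ A, Function.invFunOn χ A (χ i) = i := fun i hi ↦
        hχ.injOn.leftInvOn_invFunOn hi
      have h2 := norm_sum_smul_ellOneUnit (A.image χ) (fun i ↦ a (Function.invFunOn χ A i))
      rw [Finset.sum_image hχ.injOn, Finset.sum_image hχ.injOn] at h2
      rw [Finset.sum_congr rfl fun i hi ↦ by rw [h1 i hi]] at h2
      rw [h2]
      exact Finset.sum_congr rfl fun i hi ↦ by rw [h1 i hi]
    rw [key φ hφ, key ψ hψ, one_mul]

/-- The coordinate functionals of the difference basis of `ℓ₁`. -/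
def ellOneTail (𝕜 : Type*) [RCLike 𝕜] (n : ℕ) : StrongDual 𝕜 (SpaceEllOne 𝕜) :=
  LinearMap.mkContinuous
    { toFun f := ∑' k, f (k + n)
      map_add' f g := by
        rw [← Summable.tsum_add ((summable_nat_add_iff n).2 (summable_ellOne f))
          ((summable_nat_add_iff n).2 (summable_ellOne g))]
        rfl
      map_smul' c f := by
        rw [RingHom.id_apply, smul_eq_mul, ← tsum_mul_left]
        rfl } 1
    (fun f ↦ by
      have h1 : Summable fun k ↦ ‖f (k + n)‖ :=
        (summable_nat_add_iff (f := fun k ↦ ‖f k‖) n).2 (summable_norm_ellOne f)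
      rw [one_mul, norm_ellOne]
      refine (norm_tsum_le_tsum_norm h1).trans ?_
      have h2 := (summable_norm_ellOne f).sum_add_tsum_nat_add n
      have h3 : 0 ≤ ∑ k ∈ Finset.range n, ‖f k‖ := Finset.sum_nonneg fun _ _ ↦ norm_nonneg _
      linarith)

theorem ellOneTail_apply (n : ℕ) (f : SpaceEllOne 𝕜) : ellOneTail 𝕜 n f = ∑' k, f (k + n) := rfl

theorem ellOneTail_eq_add (n : ℕ) (f : SpaceEllOne 𝕜) :
    ellOneTail 𝕜 n f = f n + ellOneTail 𝕜 (n + 1) f := by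
  rw [ellOneTail_apply, ellOneTail_apply,
    ((summable_nat_add_iff n).2 (summable_ellOne f)).tsum_eq_zero_add, zero_add]
  congr 1
  exact tsum_congr fun k ↦ by rw [add_assoc, add_comm 1 n]

theorem ellOneTail_unit (n j : ℕ) : ellOneTail 𝕜 n (ellOneUnit 𝕜 j) = if n ≤ j then 1 else 0 := by
  rw [ellOneTail_apply]
  simp only [ellOneUnit_apply]
  split_ifs with h
  · have : ∀ k, (k + n = j) ↔ k = j - n := fun k ↦ by omega
    simp only [this]
    exact tsum_ite_eq _ _
  · have : ∀ k, ¬ (k + n = j) := fun k ↦ by omega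
    simp [this]

/-- The difference basis of `ℓ₁`. -/
def ellOneDiff (𝕜 : Type*) [RCLike 𝕜] (n : ℕ) : SpaceEllOne 𝕜 :=
  ellOneUnit 𝕜 n - if n = 0 then 0 else ellOneUnit 𝕜 (n - 1)

/-- Summation by parts; the boundary term tends to zero with the tails of f. -/
theorem sum_smul_ellOneDiff (f : SpaceEllOne 𝕜) (N : ℕ) :
    ∑ n ∈ Finset.range (N + 1), ellOneTail 𝕜 n f • ellOneDiff 𝕜 n =
      ∑ n ∈ Finset.range N, f n • ellOneUnit 𝕜 n + ellOneTail 𝕜 N f • ellOneUnit 𝕜 N := by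
  induction N with
  | zero => simp [ellOneDiff]
  | succ N ih =>
    rw [Finset.sum_range_succ, ih, Finset.sum_range_succ, ellOneTail_eq_add N f, ellOneDiff,
      if_neg (Nat.succ_ne_zero N), Nat.add_sub_cancel]
    module

/-- The difference basis of `ℓ₁`. -/
def ellOneDiffBasis (𝕜 : Type*) [RCLike 𝕜] : SchauderBasis 𝕜 (SpaceEllOne 𝕜) :=
  basisOfTendsto (ellOneDiff 𝕜) (ellOneTail 𝕜)
    (fun i j ↦ by
      rw [ellOneDiff]
      rcases Nat.eq_zero_or_pos j with rfl | hj
      · rw [if_pos rfl, sub_zero, ellOneTail_unit]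
        simp
      · rw [if_neg hj.ne', map_sub, ellOneTail_unit, ellOneTail_unit]
        by_cases h1 : i ≤ j - 1
        · rw [if_pos h1, if_pos (by omega), if_neg (by omega), sub_self]
        · rw [if_neg h1, sub_zero]
          have : i ≤ j ↔ i = j := by omega
          simp only [this])
    (fun f ↦ by
      rw [← tendsto_add_atTop_iff_nat 1]
      simp only [sum_smul_ellOneDiff]
      have h1 : Tendsto (fun N ↦ ellOneTail 𝕜 N f • ellOneUnit 𝕜 N) atTop (𝓝 0) := by
        rw [tendsto_zero_iff_norm_tendsto_zero]
        have h2 : Tendsto (fun N ↦ ‖ellOneTail 𝕜 N f‖) atTop (𝓝 0) := by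
          have := (tendsto_sum_nat_add (fun k ↦ f k)).norm
          rwa [norm_zero] at this
        refine h2.congr fun N ↦ ?_
        have := norm_sum_smul_ellOneUnit {N} (fun n ↦ ellOneTail 𝕜 n f)
        simpa using this.symm
      simpa using (tendsto_sum_smul_ellOneUnit f).add h1)

/-- The unit vector of index N - 1 is the telescoping sum of the first N differences, whereas
keeping only the even ones leaves entry 1 at every even position below N. -/
theorem isMaximallyConditional_ellOneDiffBasis : IsMaximallyConditional (ellOneDiffBasis 𝕜) := by
  refine ⟨1 / 2, by norm_num, fun N hN ↦ ⟨ellOneUnit 𝕜 (N - 1),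
    (Finset.range ((N + 1) / 2)).image fun n ↦ 2 * n, basis_ne_zero (ellOneUnitBasis 𝕜) _,
    fun n hn ↦ ?_, ?_⟩⟩
  · change ellOneTail 𝕜 n (ellOneUnit 𝕜 (N - 1)) = 0
    rw [ellOneTail_unit, if_neg (by omega)]
  · have h1 : ‖ellOneUnit 𝕜 (N - 1)‖ = 1 := by
      have := norm_sum_smul_ellOneUnit {N - 1} (fun _ ↦ (1 : 𝕜))
      simpa using this
    set M := (N + 1) / 2 with hM
    have h2 : ∑ n ∈ (Finset.range M).image fun n ↦ 2 * n,
        (ellOneDiffBasis 𝕜).coord n (ellOneUnit 𝕜 (N - 1)) • (ellOneDiffBasis 𝕜).basis n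
        = ∑ n ∈ Finset.range M, ellOneDiff 𝕜 (2 * n) := by
      rw [Finset.sum_image (fun _ _ _ _ h ↦ by simpa using h)]
      refine Finset.sum_congr rfl fun n hn ↦ ?_
      rw [Finset.mem_range] at hn
      change ellOneTail 𝕜 (2 * n) (ellOneUnit 𝕜 (N - 1)) • ellOneDiff 𝕜 (2 * n) = _
      rw [ellOneTail_unit, if_pos (by omega), one_smul]
    have h3 : ∀ l ∈ Finset.range M,
        (∑ n ∈ Finset.range M, ellOneDiff 𝕜 (2 * n)) (2 * l) = 1 := by
      intro l hl
      have e : ∀ n, (ellOneDiff 𝕜 (2 * n)) (2 * l) = if l = n then 1 else 0 := by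
        intro n
        rw [ellOneDiff]
        rcases Nat.eq_zero_or_pos n with rfl | hn
        · simp [ellOneUnit_apply]
        · rw [if_neg (by omega), lp.coeFn_sub, Pi.sub_apply, ellOneUnit_apply, ellOneUnit_apply,
            if_neg (by omega : ¬ 2 * l = 2 * n - 1), sub_zero]
          simp
      rw [lp.coeFn_sum, Finset.sum_apply]
      simp only [e]
      rw [Finset.sum_ite_eq, if_pos hl]
    have h4 := sum_norm_le_ellOne (∑ n ∈ Finset.range M, ellOneDiff 𝕜 (2 * n))
      ((Finset.range M).image fun n ↦ 2 * n)
    rw [Finset.sum_image (fun _ _ _ _ h ↦ by simpa using h),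
      Finset.sum_congr rfl fun l hl ↦ by rw [h3 l hl]] at h4
    simp only [norm_one, Finset.sum_const, Finset.card_range, nsmul_eq_mul, mul_one] at h4
    rw [h1, h2, mul_one]
    have h5 : (N : ℝ) ≤ 2 * M := by exact_mod_cast (by omega : N ≤ 2 * M)
    linarith

end EllOne

/-! ### c₀ and its summing basis -/

section CZero

variable {𝕜 : Type*} [RCLike 𝕜]

theorem norm_apply_le_cZero (f : SpaceCZero 𝕜) (k : ℕ) : ‖f k‖ ≤ ‖f‖ :=
  f.toBCF.norm_coe_le_norm k

theorem norm_cZero_le {f : SpaceCZero 𝕜} {C : ℝ} (hC : 0 ≤ C) (h : ∀ k, ‖f k‖ ≤ C) : ‖f‖ ≤ C :=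
  (BoundedContinuousFunction.norm_le (f := f.toBCF) hC).2 h

theorem tendsto_cZero (f : SpaceCZero 𝕜) : Tendsto f atTop (𝓝 0) := by
  have := zero_at_infty f
  rwa [Filter.cocompact_eq_cofinite, Nat.cofinite_eq_atTop] at this

/-- Sequences of finite support as elements of `c₀`. -/
def cZeroOfFinset (A : Finset ℕ) (a : ℕ → 𝕜) : SpaceCZero 𝕜 where
  toFun k := if k ∈ A then a k else 0
  continuous_toFun := continuous_of_discreteTopology
  zero_at_infty' := by
    rw [Filter.cocompact_eq_cofinite, Nat.cofinite_eq_atTop]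
    refine tendsto_const_nhds.congr' ?_
    filter_upwards [eventually_gt_atTop (A.sup id)] with k hk
    rw [if_neg fun h ↦ not_lt.2 (Finset.le_sup (f := id) h) hk]

theorem cZeroOfFinset_apply (A : Finset ℕ) (a : ℕ → 𝕜) (k : ℕ) :
    cZeroOfFinset A a k = if k ∈ A then a k else 0 := rfl

/-- Evaluation functionals on `c₀`. -/
def cZeroEval (𝕜 : Type*) [RCLike 𝕜] (n : ℕ) : StrongDual 𝕜 (SpaceCZero 𝕜) :=
  LinearMap.mkContinuous
    { toFun f := f n
      map_add' _ _ := rfl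
      map_smul' _ _ := rfl } 1
    (fun f ↦ by rw [one_mul]; exact norm_apply_le_cZero f n)

theorem cZeroEval_apply (n : ℕ) (f : SpaceCZero 𝕜) : cZeroEval 𝕜 n f = f n := rfl

/-- If every coordinate of the error is dominated by an entry of f beyond N, the error is uniformly
small because the entries tend to 0. This covers both the unit vector basis and the summing basis.
-/
theorem tendsto_cZero_of_forall {F : ℕ → SpaceCZero 𝕜} {f : SpaceCZero 𝕜}
    (h : ∀ N k, ∃ l ≥ N, ‖F N k - f k‖ ≤ ‖f l‖) : Tendsto F atTop (𝓝 f) := by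
  rw [Metric.tendsto_atTop]
  intro ε hε
  obtain ⟨N, hN⟩ := (Metric.tendsto_atTop.1 (tendsto_cZero f)) (ε / 2) (half_pos hε)
  refine ⟨N, fun n hn ↦ ?_⟩
  rw [dist_eq_norm]
  refine (norm_cZero_le (half_pos hε).le fun k ↦ ?_).trans_lt (half_lt_self hε)
  obtain ⟨l, hl, h1⟩ := h n k
  have h2 := hN l (hn.trans hl)
  rw [dist_zero_right] at h2
  exact h1.trans h2.le

/-- The unit vectors of `c₀`. -/
def cZeroUnit (𝕜 : Type*) [RCLike 𝕜] (n : ℕ) : SpaceCZero 𝕜 := cZeroOfFinset {n} fun _ ↦ 1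

theorem cZeroUnit_apply (n k : ℕ) : cZeroUnit 𝕜 n k = if k = n then 1 else 0 := by
  simp [cZeroUnit, cZeroOfFinset_apply]

theorem sum_smul_cZeroUnit_apply (A : Finset ℕ) (a : ℕ → 𝕜) (k : ℕ) :
    (∑ j ∈ A, a j • cZeroUnit 𝕜 j) k = if k ∈ A then a k else 0 := by
  rw [← cZeroEval_apply, map_sum]
  simp [cZeroEval_apply, cZeroUnit_apply]

/-- The unit vector basis of `c₀`. -/
def cZeroUnitBasis (𝕜 : Type*) [RCLike 𝕜] : SchauderBasis 𝕜 (SpaceCZero 𝕜) :=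
  basisOfTendsto (cZeroUnit 𝕜) (cZeroEval 𝕜) (fun i j ↦ cZeroUnit_apply j i)
    (fun f ↦ tendsto_cZero_of_forall fun N k ↦ by
      rw [sum_smul_cZeroUnit_apply]
      split_ifs with h
      · exact ⟨N, le_rfl, by simp [cZeroEval_apply]⟩
      · exact ⟨k, not_lt.1 fun h' ↦ h (Finset.mem_range.2 h'), by simp⟩)

theorem norm_sum_smul_cZeroUnit_le {A : Finset ℕ} {φ : ℕ → ℕ} (hφ : Set.InjOn φ A) {a : ℕ → 𝕜}
    {C : ℝ} (hC : 0 ≤ C) (h : ∀ j ∈ A, ‖a j‖ ≤ C) : ‖∑ j ∈ A, a j • cZeroUnit 𝕜 (φ j)‖ ≤ C := by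
  refine norm_cZero_le hC fun k ↦ ?_
  rw [← cZeroEval_apply, map_sum]
  simp only [map_smul, cZeroEval_apply, cZeroUnit_apply, smul_eq_mul, mul_ite, mul_one, mul_zero]
  by_cases hk : ∃ j ∈ A, k = φ j
  · obtain ⟨j, hj, rfl⟩ := hk
    rw [Finset.sum_eq_single_of_mem j hj fun i hi hij ↦ if_neg fun hji ↦ hij (hφ hi hj hji.symm),
      if_pos rfl]
    exact h j hj
  · push Not at hk
    rw [Finset.sum_eq_zero fun j hj ↦ if_neg (hk j hj), norm_zero]
    exact hC

theorem norm_le_norm_sum_smul_cZeroUnit {A : Finset ℕ} {φ : ℕ → ℕ} (hφ : Set.InjOn φ A)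
    {a : ℕ → 𝕜} {j : ℕ} (hj : j ∈ A) : ‖a j‖ ≤ ‖∑ j ∈ A, a j • cZeroUnit 𝕜 (φ j)‖ := by
  refine le_trans (le_of_eq ?_) (norm_apply_le_cZero _ (φ j))
  rw [← cZeroEval_apply, map_sum]
  simp only [map_smul, cZeroEval_apply, cZeroUnit_apply, smul_eq_mul, mul_ite, mul_one, mul_zero]
  rw [Finset.sum_eq_single_of_mem j hj fun i hi hij ↦ if_neg fun hji ↦ hij (hφ hi hj hji.symm),
    if_pos rfl]

theorem isSubsymmetricWith_cZeroUnitBasis :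
    IsSubsymmetricWith 𝕜 (cZeroUnitBasis 𝕜).basis 1 := by
  refine ⟨le_rfl, basis_ne_zero _ 0, fun A a c h ↦ ?_, fun A φ ψ hφ hψ a ↦ ?_⟩
  · rw [one_mul]
    exact norm_sum_smul_cZeroUnit_le (φ := id) (Set.injOn_id _) (norm_nonneg _) fun j hj ↦
      (h j hj).trans (norm_le_norm_sum_smul_cZeroUnit (φ := id) (a := c) (Set.injOn_id _) hj)
  · rw [one_mul]
    exact norm_sum_smul_cZeroUnit_le hφ.injOn (norm_nonneg _) fun j hj ↦
      norm_le_norm_sum_smul_cZeroUnit hψ.injOn hj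

/-- The vectors of the summing basis of `c₀`. -/
def cZeroSumming (𝕜 : Type*) [RCLike 𝕜] (n : ℕ) : SpaceCZero 𝕜 :=
  cZeroOfFinset (Finset.range (n + 1)) fun _ ↦ 1

theorem cZeroSumming_apply (n k : ℕ) : cZeroSumming 𝕜 n k = if k ≤ n then 1 else 0 := by
  simp [cZeroSumming, cZeroOfFinset_apply]

theorem sum_smul_cZeroSumming_apply (f : SpaceCZero 𝕜) (N k : ℕ) :
    (∑ n ∈ Finset.range N, (cZeroEval 𝕜 n - cZeroEval 𝕜 (n + 1)) f • cZeroSumming 𝕜 n) k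
      = if k < N then f k - f N else 0 := by
  rw [← cZeroEval_apply, map_sum]
  induction N with
  | zero => simp
  | succ N ih =>
    rw [Finset.sum_range_succ, ih, map_smul, cZeroEval_apply, cZeroSumming_apply, sub_apply,
      cZeroEval_apply, cZeroEval_apply]
    rcases lt_trichotomy k N with h | rfl | h
    · rw [if_pos h, if_pos h.le, if_pos (by omega)]; simp
    · simp
    · rw [if_neg (by omega), if_neg (by omega), if_neg (by omega)]; simp

/-- The summing basis of `c₀`. -/
def cZeroSummingBasis (𝕜 : Type*) [RCLike 𝕜] : SchauderBasis 𝕜 (SpaceCZero 𝕜) :=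
  basisOfTendsto (cZeroSumming 𝕜) (fun n ↦ cZeroEval 𝕜 n - cZeroEval 𝕜 (n + 1))
    (fun i j ↦ by
      rw [sub_apply, cZeroEval_apply, cZeroEval_apply, cZeroSumming_apply, cZeroSumming_apply]
      rcases lt_trichotomy i j with h | rfl | h
      · rw [if_pos h.le, if_pos (by omega), if_neg h.ne, sub_self]
      · simp
      · rw [if_neg (by omega), if_neg (by omega), if_neg h.ne', sub_self])
    (fun f ↦ tendsto_cZero_of_forall fun N k ↦ by
      rw [sum_smul_cZeroSumming_apply]
      split_ifs with h
      · exact ⟨N, le_rfl, by simp⟩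
      · exact ⟨k, not_lt.1 h, by simp⟩)

theorem norm_sum_range_neg_one_pow_le (N k : ℕ) :
    ‖∑ n ∈ Finset.range N, (-1 : 𝕜) ^ n * if k ≤ n then 1 else 0‖ ≤ 1 := by
  have h : ∑ n ∈ Finset.range N, (-1 : 𝕜) ^ n * (if k ≤ n then 1 else 0) =
      if N ≤ k then 0 else if (N - k) % 2 = 0 then 0 else (-1) ^ k := by
    induction N with
    | zero => simp
    | succ N ih =>
      rw [Finset.sum_range_succ, ih]
      rcases lt_trichotomy N k with h | rfl | h
      · rw [if_pos h.le, if_neg (by omega), if_pos (by omega)]; simp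
      · simp
      · obtain ⟨r, rfl⟩ : ∃ r, N = k + r := ⟨N - k, by omega⟩
        have h0 : ¬ k + r ≤ k := by omega
        have h0' : ¬ k + r + 1 ≤ k := by omega
        rw [if_neg h0, if_neg h0', if_pos h.le, Nat.add_sub_cancel_left,
          show k + r + 1 - k = r + 1 by omega]
        rcases Nat.even_or_odd r with hr | hr
        · have h1 : r % 2 = 0 := Nat.even_iff.1 hr
          have h2 : ¬ (r + 1) % 2 = 0 := by omega
          rw [if_pos h1, if_neg h2, pow_add, hr.neg_one_pow]; simp
        · have h1 : ¬ r % 2 = 0 := by have := Nat.odd_iff.1 hr; omega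
          have h2 : (r + 1) % 2 = 0 := by have := Nat.odd_iff.1 hr; omega
          rw [if_neg h1, if_pos h2, pow_add, hr.neg_one_pow]; simp
  rw [h]
  split_ifs <;> simp

/-- Alternating signs keep all partial sums, hence the norm, at most 1, while the terms of even
index all have entry 1 at position 0 and add up there. -/
theorem isMaximallyConditional_cZeroSummingBasis :
    IsMaximallyConditional (cZeroSummingBasis 𝕜) := by
  refine ⟨1 / 2, by norm_num, fun N hN ↦ ?_⟩
  set x : SpaceCZero 𝕜 := ∑ n ∈ Finset.range N, (-1 : 𝕜) ^ n • (cZeroSummingBasis 𝕜).basis n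
    with hx
  have hcoord : ∀ n, (cZeroSummingBasis 𝕜).coord n x = if n ∈ Finset.range N then (-1) ^ n else 0 :=
    fun n ↦ coord_sum_smul _ _ _ _
  set M := (N + 1) / 2 with hM
  refine ⟨x, (Finset.range M).image fun n ↦ 2 * n, fun h ↦ ?_, fun n hn ↦ ?_, ?_⟩
  · have h1 := hcoord 0
    rw [h, if_pos (Finset.mem_range.2 hN)] at h1
    simp at h1
  · rw [hcoord, if_neg (by rw [Finset.mem_range]; omega)]
  · have h1 : ‖x‖ ≤ 1 := by
      refine norm_cZero_le zero_le_one fun k ↦ ?_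
      rw [hx, ← cZeroEval_apply, map_sum]
      refine le_trans (le_of_eq ?_) (norm_sum_range_neg_one_pow_le (𝕜 := 𝕜) N k)
      congr 1
      refine Finset.sum_congr rfl fun n _ ↦ ?_
      rw [map_smul, cZeroEval_apply, smul_eq_mul]
      exact congrArg _ (cZeroSumming_apply n k)
    have h2 : ∑ n ∈ (Finset.range M).image fun n ↦ 2 * n,
        (cZeroSummingBasis 𝕜).coord n x • (cZeroSummingBasis 𝕜).basis n
        = ∑ n ∈ Finset.range M, cZeroSumming 𝕜 (2 * n) := by
      rw [Finset.sum_image (fun _ _ _ _ h ↦ by simpa using h)]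
      refine Finset.sum_congr rfl fun n hn ↦ ?_
      rw [Finset.mem_range] at hn
      rw [hcoord, if_pos (by rw [Finset.mem_range]; omega), pow_mul, neg_one_sq, one_pow, one_smul]
      rfl
    have h3 : (∑ n ∈ Finset.range M, cZeroSumming 𝕜 (2 * n)) 0 = M := by
      rw [← cZeroEval_apply, map_sum]
      simp [cZeroEval_apply, cZeroSumming_apply]
    have h4 := norm_apply_le_cZero (∑ n ∈ Finset.range M, cZeroSumming 𝕜 (2 * n)) 0
    rw [h3, RCLike.norm_natCast] at h4
    rw [h2]
    have h5 : (N : ℝ) ≤ 2 * M := by exact_mod_cast (by omega : N ≤ 2 * M)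
    calc 1 / 2 * (N : ℝ) * ‖x‖ ≤ 1 / 2 * (N : ℝ) * 1 := by gcongr
      _ ≤ M := by linarith
      _ ≤ _ := h4

end CZero

/-! ### Assembling the decomposition of X -/

variable {𝕜 : Type*} [RCLike 𝕜]
variable {X : Type*} [NormedAddCommGroup X] [NormedSpace 𝕜 X] [CompleteSpace X]
variable {S : Type*} [NormedAddCommGroup S] [NormedSpace 𝕜 S] [CompleteSpace S]

/-- The main construction, for any complemented space `W` that is isomorphic to its square and has
a maximally conditional basis. -/
theorem exists_isAlmostGreedyWith {W : Type*} [NormedAddCommGroup W] [NormedSpace 𝕜 W]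
    [CompleteSpace W] (hX : Nonempty (SchauderBasis 𝕜 X)) {e : SchauderBasis 𝕜 S} {K : ℝ}
    (he : IsSubsymmetricWith 𝕜 e.basis K) (hSX : IsComplementedIn 𝕜 S X)
    (hS : HasNontrivialType S) (hWX : IsComplementedIn 𝕜 W X)
    (hW : Nonempty (W ≃L[𝕜] W × W)) {w : SchauderBasis 𝕜 W} (hw : IsMaximallyConditional w) :
    ∃ b : SchauderBasis 𝕜 X, IsAlmostGreedyWith b (initialNorm e.basis) := by
  obtain ⟨x⟩ := hX
  obtain ⟨b, hb, hreg⟩ := he.exists_regular hS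
  obtain ⟨P, hP⟩ := exists_average he hb
  obtain ⟨p⟩ := nonempty_basis_ker_id_sub_average hb hP
  have hidem := average_comp_self hb hP
  have : CompleteSpace (ContinuousLinearMap.id 𝕜 S - P).ker :=
    (ContinuousLinearMap.isClosed_ker _).completeSpace_coe
  -- The range of P is realized as the kernel of id - P, which is visibly closed.
  let P' : S →L[𝕜] (ContinuousLinearMap.id 𝕜 S - P).ker := P.codRestrict _ fun f ↦ by
    rw [LinearMap.mem_ker]
    simp [hidem]
  have hright : Function.RightInverse (Submodule.subtypeL (ContinuousLinearMap.id 𝕜 S - P).ker)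
      P' := fun q ↦ by
    refine Subtype.ext ?_
    have := q.2
    rw [LinearMap.mem_ker] at this
    exact (sub_eq_zero.1 this).symm
  -- The basis w sits on the even positions and supplies the conditionality; x and p only complete
  -- the space.
  let z₀ := prodBasis w (prodBasis x p)
  obtain ⟨D, hD1, hD2⟩ := exists_norm_sum_range_le_of_basis (normalizeBasis z₀)
    (norm_normalizeBasis z₀)
  let d : AveragingData 𝕜 S P'.ker (W × X × (ContinuousLinearMap.id 𝕜 S - P).ker) :=
    { e := e, K := K, he := he, b := b, hb := hb
      two_mul_le := fun m ↦ (hreg m).1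
      mul_le := fun m ↦ (hreg m).2
      P := P, hP := hP
      ι := P'.ker.subtypeL
      π := P'.projKerOfRightInverse _ hright
      π_ι := fun q ↦ P'.projKerOfRightInverse_apply_idem _ hright q
      ι_π := fun _ ↦ rfl
      z := normalizeBasis z₀
      norm_z := norm_normalizeBasis z₀
      D := D, norm_sum_z_le := hD1, norm_coord_z_le := hD2 }
  have hd := d.isAlmostGreedyWith (hw.prodBasis _).normalizeBasis
  obtain ⟨ΦW⟩ := nonempty_equiv_prod_of_isComplementedIn hW hWX
  obtain ⟨ΦS⟩ := nonempty_equiv_prod_of_isComplementedIn he.nonempty_equiv_prod hSX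
  let Ψ : S ≃L[𝕜] (ContinuousLinearMap.id 𝕜 S - P).ker × P'.ker :=
    ContinuousLinearEquiv.equivOfRightInverse P' _ hright
  -- The two parts of S are first reunited, then S is absorbed by X, and finally W.
  let Θ : (P'.ker × W × X × (ContinuousLinearMap.id 𝕜 S - P).ker) ≃L[𝕜] X :=
    (((ContinuousLinearEquiv.prodComm 𝕜 _ _).trans (.prodAssoc 𝕜 _ _ _)).trans
      ((ContinuousLinearEquiv.refl 𝕜 W).prodCongr
        ((ContinuousLinearEquiv.prodAssoc 𝕜 _ _ _).trans
          (((ContinuousLinearEquiv.refl 𝕜 X).prodCongr Ψ.symm).trans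
            ((ContinuousLinearEquiv.prodComm 𝕜 _ _).trans ΦS.symm))))).trans ΦW.symm
  exact ⟨mapBasis d.basis Θ, hd.mapBasis Θ⟩

end GreedyBases

end

theorem theorem4p10 {𝕜 : Type*} [RCLike 𝕜]
    {X : Type*} [NormedAddCommGroup X] [NormedSpace 𝕜 X] [CompleteSpace X]
    {S : Type*} [NormedAddCommGroup S] [NormedSpace 𝕜 S] [CompleteSpace S]
    (hX : Nonempty (SchauderBasis 𝕜 X))
    (e : SchauderBasis 𝕜 S) (he : GreedyBases.IsSubsymmetric e)
    (hSX : GreedyBases.IsComplementedIn 𝕜 S X)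
    (hS : GreedyBases.HasNontrivialType S)
    (h : GreedyBases.IsComplementedIn 𝕜 (GreedyBases.SpaceEllOne 𝕜) X ∨
      GreedyBases.IsComplementedIn 𝕜 (GreedyBases.SpaceCZero 𝕜) X) :
    ∃ b : SchauderBasis 𝕜 X,
      GreedyBases.IsAlmostGreedy b ∧
      GreedyBases.EquivalentFrom 1 (GreedyBases.fundamentalFunction b)
        (fun m ↦ ‖∑ j ∈ Finset.range m, e.basis j‖) ∧
      GreedyBases.EquivalentFrom 2 (GreedyBases.conditionalityConstant b)
        (fun m ↦ Real.log m) := by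
  obtain ⟨K, hK⟩ := he.exists_isSubsymmetricWith
  have key : ∃ b : SchauderBasis 𝕜 X,
      GreedyBases.IsAlmostGreedyWith b (GreedyBases.initialNorm e.basis) := by
    rcases h with h | h
    · exact GreedyBases.exists_isAlmostGreedyWith hX hK hSX hS h
        GreedyBases.isSubsymmetricWith_ellOneUnitBasis.nonempty_equiv_prod
        GreedyBases.isMaximallyConditional_ellOneDiffBasis
    · exact GreedyBases.exists_isAlmostGreedyWith hX hK hSX hS h
        GreedyBases.isSubsymmetricWith_cZeroUnitBasis.nonempty_equiv_prod
        GreedyBases.isMaximallyConditional_cZeroSummingBasis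
  obtain ⟨b, hb⟩ := key
  exact ⟨b, hb.isAlmostGreedy, hb.equivalentFrom_fundamentalFunction,
    hb.equivalentFrom_conditionalityConstant⟩
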